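/- **Setting.** Alice transmits over $M$ slots of $N$ complex channel uses each ($n=MN$). In slot $m$ Bob and Eve receive $\mathbf y_{tm}=\sqrt{h_{tm}}\,\mathbf x_m+\mathbf z_{tm}$, $t=1,2$ (Bob: $t=1$, Eve: $t=2$), where all noise samples are independent circularly symmetric complex Gaussian of variance $1$, and the power gains $h_{1m},h_{2m}\ge 0$ are independent of each other, of the noise and of the messages, i.i.d. over the slots, with distribution functions $F_1,F_2$; each receiver knows its own gains and Alice knows none. Let $\rho\ge 0$ be an integrable power distribution on $[0,\infty)$, $I(s)=\int_s^\infty\rho(u)\,du$ and $I(0)=P$. Logarithms are natural and entropies are in nats. **Scheme.** For levels $0=s_0<s_1<\dots<s_L$ (with $s_{L+1}=\infty$), layer $l\in\{0,\dots,L\}$ has power $p_l=\int_{s_l}^{s_{l+1}}\rho$ and rate $r_l=\log\Bigl(1+\frac{s_lp_l}{1+s_l\sum_{i>l}p_i}\Bigr)$. A layered scheme with slack $\eta$ consists of the following. (i) For each layer $l$ there is a codebook of block length $N$, with between $e^{N(r_l-\eta)}$ and $e^{Nr_l}$ codewords and average power per symbol between $p_l-\eta$ and $p_l$. In every slot Alice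 draws an independent uniform message for each layer and sends the sum $\mathbf x_m$ of the corresponding codewords, subject to $\frac1N E\|\mathbf x_m\|^2\le P$. (ii) Bob decodes the layers of each slot successively, subtracting the decoded lower layers, and publicly feeds back $\Psi_m=\max\{l: s_l\le h_{1m}\}$, the index of his highest decodable layer. (iii) A binning map, which may depend on the feedback $\Psi=(\Psi_1,\dots,\Psi_M)$, assigns to the messages of the layers $l\le\Psi_m$, $1\le m\le M$, one of $\lfloor e^{nR}\rfloor$ bins. Alice's key $K$ is the bin of the messages sent, and Bob's key $\hat K$ is the bin of his decoded messages. The layered-broadcast-coding scheme with power distribution $\rho$ (a continuum of layers, understood as the limit of ever finer levels) *achieves the secrecy key rate $R\geq 0$* if for every $\epsilon>0$ there are $\delta>0$ and $A$ such that for all levels with all gaps $s_{l+1}-s_l\le\delta$ $(0\le l<L)$ and $s_L\ge A$, for every $\eta>0$, for all sufficiently large $M$ and then all sufficiently large $N$ (depending on $M$), there is a layered scheme with slack $\eta$ such that, with probability at least $1-\epsilon$, Bob correctly decodes all layers up to the index he feeds back in every slot, and $$\Pr(K=\hat K)\ge 1-\epsilon,\qquad \frac1n H(K\mid \mathbf Y_2,\mathbf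 h_2,\Psi)\ge R-\epsilon ,$$ where $\mathbf Y_2$ and $\mathbf h_2$ are all of Eve's received blocks and gains. **Theorem.** For every such $\rho$, $F_1$, $F_2$, the layered-broadcast-coding scheme with power distribution $\rho$ achieves the secrecy key rate $$R_s=\int_0^\infty\int_0^{h_1}\Delta(h_1,h_2)\,dF_2(h_2)\,dF_1(h_1),\qquad \Delta(h_1,h_2)=\int_{h_2}^{h_1}\left[\frac{s\rho(s)}{1+sI(s)}-\frac{h_2\rho(s)}{1+h_2I(s)}\right]ds ,$$ whenever $R_s<\infty$; in general it achieves every finite rate $R$ with $0\le R\le R_s$. -/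

import Mathlib

open MeasureTheory ProbabilityTheory Filter

noncomputable section

namespace LayeredKey

/-! ### The rate formula -/

/-- Total power of the layers above `s`: `I(s) = ∫_s^∞ ρ(u) du`. -/
def interference (ρ : ℝ → ℝ) (s : ℝ) : ℝ := ∫ u in Set.Ioi s, ρ u

/-- The reward `Δ(h₁, h₂)`. -/
def reward (ρ : ℝ → ℝ) (h₁ h₂ : ℝ) : ℝ :=
  ∫ s in h₂..h₁, (s * ρ s / (1 + s * interference ρ s)
    - h₂ * ρ s / (1 + h₂ * interference ρ s))

/-- `R_s = ∫_0^∞ ∫_0^{h₁} Δ(h₁, h₂) dF₂(h₂) dF₁(h₁)`, where `μ₁`, `μ₂` are the laws with distribution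
functions `F₁`, `F₂`. As `Δ(h₁, h₂) ≥ 0` for `0 ≤ h₂ ≤ h₁`, this is well defined in `[0, ∞]`. -/
def secrecyKeyRate (ρ : ℝ → ℝ) (μ₁ μ₂ : Measure ℝ) : ENNReal :=
  ∫⁻ h₁ in Set.Ici 0, ∫⁻ h₂ in Set.Icc 0 h₁, ENNReal.ofReal (reward ρ h₁ h₂) ∂μ₂ ∂μ₁

/-! ### Entropy and noise -/

/-- Conditional entropy `H(K | V)` in nats of a finite-valued `K` given an arbitrary `V`: the mean of
the Shannon entropy of the conditional distribution of `K` given `V`. -/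
def condEntropy {Ω κ V : Type*} [MeasurableSpace Ω] [Fintype κ] [MeasurableSpace V]
    (μ : Measure Ω) (K : Ω → κ) (X : Ω → V) : ℝ :=
  ∫ ω, ∑ k, Real.negMulLog
    ((μ[(K ⁻¹' {k}).indicator (fun _ => (1 : ℝ)) | MeasurableSpace.comap X inferInstance]) ω) ∂μ

/-- The circularly symmetric complex Gaussian law of unit variance: real and imaginary parts are
independent real Gaussians of variance `1/2`. -/
def complexGaussian : Measure ℂ :=
  ((gaussianReal 0 (1 / 2)).prod (gaussianReal 0 (1 / 2))).map
    (fun p : ℝ × ℝ => (⟨p.1, p.2⟩ : ℂ))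

/-! ### Discretised layers -/

/-- Layer levels `0 = s₀ < s₁ < ⋯ < s_L`. -/
structure Levels (L : ℕ) where
  level : Fin (L + 1) → ℝ
  strictMono : StrictMono level
  level_zero : level 0 = 0

namespace Levels

variable {L : ℕ} (s : Levels L)

/-- All gaps between consecutive levels are at most `δ` and the highest level is at least `A`. -/
def IsFine (δ A : ℝ) : Prop :=
  (∀ l : Fin L, s.level l.succ - s.level l.castSucc ≤ δ) ∧ A ≤ s.level (Fin.last L)

/-- Index of the highest layer decodable at power gain `h ≥ 0`: the largest `l` with `s_l ≤ h`. -/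
def topLayer (h : ℝ) : Fin (L + 1) := (Finset.univ.filter fun l => s.level l ≤ h).sup id

/-- Power of layer `l`: `∫ ρ` over `[s_l, s_{l+1})`, and over `[s_L, ∞)` for the highest layer. -/
def power (ρ : ℝ → ℝ) (l : Fin (L + 1)) : ℝ := ∫ u in {u | 0 ≤ u ∧ s.topLayer u = l}, ρ u

/-- Nominal rate of layer `l`, in nats per complex channel use. -/
def rate (ρ : ℝ → ℝ) (l : Fin (L + 1)) : ℝ :=
  Real.log (1 + s.level l * s.power ρ l / (1 + s.level l * ∑ i ∈ Finset.Ioi l, s.power ρ i))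

end Levels

/-! ### Superposition codes -/

/-- One codebook of block length `N` for each of the layers `0, …, L`. -/
structure LayeredCode (L N : ℕ) where
  size : Fin (L + 1) → ℕ
  size_pos : ∀ l, 0 < size l
  codeword : (l : Fin (L + 1)) → Fin (size l) → Fin N → ℂ

namespace LayeredCode

variable {L N : ℕ} (c : LayeredCode L N)

/-- The messages sent in one slot, one for each layer. -/
abbrev Msg : Type := (l : Fin (L + 1)) → Fin (c.size l)

/-- The transmitted block: the superposition of the codewords of all layers. -/
def signal (w : c.Msg) : Fin N → ℂ := ∑ l, c.codeword l (w l)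

/-- `(1/N) E‖x^{[l]}‖²` for a uniform message. -/
def layerPower (l : Fin (L + 1)) : ℝ :=
  (∑ w, ∑ i, ‖c.codeword l w i‖ ^ 2) / (c.size l) / N

/-- `(1/N) E‖x‖²` for uniform messages. -/
def totalPower : ℝ :=
  (∑ w : c.Msg, ∑ i, ‖c.signal w i‖ ^ 2) / (Fintype.card c.Msg) / N

/-- The code carries the power distribution `ρ` on the layers `s`: every layer has the prescribed
power and rate up to a slack `η` (never above), and the block power is at most `P`. -/
def Fits (s : Levels L) (ρ : ℝ → ℝ) (P η : ℝ) : Prop :=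
  (∀ l, s.power ρ l - η ≤ c.layerPower l ∧ c.layerPower l ≤ s.power ρ l) ∧
  (∀ l, Real.exp (N * (s.rate ρ l - η)) ≤ c.size l ∧ (c.size l : ℝ) ≤ Real.exp (N * s.rate ρ l)) ∧
  c.totalPower ≤ P

/-- What happens in one slot: messages, Bob's and Eve's power gains, Bob's and Eve's noise. -/
abbrev Slot : Type := c.Msg × ℝ × ℝ × (Fin N → ℂ) × (Fin N → ℂ)

/-- In one slot the messages are uniform, the gains have laws `μ₁` and `μ₂`, the noise samples are
i.i.d. complex Gaussian, and all of them are independent. -/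
def slotLaw (μ₁ μ₂ : Measure ℝ) : Measure c.Slot :=
  (uniformOn (Set.univ : Set c.Msg)).prod (μ₁.prod (μ₂.prod
    ((Measure.pi fun _ => complexGaussian).prod (Measure.pi fun _ => complexGaussian))))

/-- The law of `M` independent slots. -/
def law (μ₁ μ₂ : Measure ℝ) (M : ℕ) : Measure (Fin M → c.Slot) :=
  Measure.pi fun _ => c.slotLaw μ₁ μ₂

variable {M : ℕ} (ω : Fin M → c.Slot)

/-- Messages sent in slot `m`. -/
def msg (m : Fin M) : c.Msg := (ω m).1

/-- Bob's power gain in slot `m`. -/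
def gain₁ (m : Fin M) : ℝ := (ω m).2.1

/-- Eve's power gain in slot `m`. -/
def gain₂ (m : Fin M) : ℝ := (ω m).2.2.1

/-- Bob's received block in slot `m`. -/
def out₁ (m : Fin M) : Fin N → ℂ :=
  fun i => (Real.sqrt (c.gain₁ ω m) : ℂ) * c.signal (c.msg ω m) i + (ω m).2.2.2.1 i

/-- Eve's received block in slot `m`. -/
def out₂ (m : Fin M) : Fin N → ℂ :=
  fun i => (Real.sqrt (c.gain₂ ω m) : ℂ) * c.signal (c.msg ω m) i + (ω m).2.2.2.2 i

/-- The public feedback: in every slot, the index of Bob's highest decodable layer. -/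
def feedback (s : Levels L) (m : Fin M) : Fin (L + 1) := s.topLayer (c.gain₁ ω m)

/-- Everything Eve observes: her received blocks, her gains and the public feedback. -/
def eveView (s : Levels L) : (Fin M → Fin N → ℂ) × (Fin M → ℝ) × (Fin M → Fin (L + 1)) :=
  (c.out₂ ω, c.gain₂ ω, c.feedback ω s)

end LayeredCode

/-! ### The key generation scheme -/

/-- A key generation scheme with `M` slots of length `N` and `k` keys. -/
structure Scheme (L N M k : ℕ) where
  /-- the codebooks, used in every slot -/
  code : LayeredCode L N
  /-- Bob's decoder for one slot, from his gain and his received block -/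
  dec : ℝ → (Fin N → ℂ) → code.Msg
  measurable_dec : Measurable fun p : ℝ × (Fin N → ℂ) => dec p.1 p.2
  /-- successive decoding: the estimate of layer `l` is computed from the gain and from what remains
  of the received block after the decoded lower layers have been subtracted -/
  successive : ∀ l, ∃ stage : ℝ → (Fin N → ℂ) → Fin (code.size l), ∀ h y,
    dec h y l = stage h
      (y - (Real.sqrt h : ℂ) • ∑ j ∈ Finset.Iio l, code.codeword j (dec h y j))
  /-- secrecy binning: given the feedback, the index of the bin holding the messages of the layers
  that Bob decodes, over all slots -/
  bin : (ψ : Fin M → Fin (L + 1)) →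
    ((m : Fin M) → (l : {l : Fin (L + 1) // l ≤ ψ m}) → Fin (code.size l)) → Fin k

namespace Scheme

variable {L N M k : ℕ} (S : Scheme L N M k) (s : Levels L)

/-- Alice's key, from the feedback and the messages she sent in the decoded layers. -/
def aliceKey (ω : Fin M → S.code.Slot) : Fin k :=
  S.bin (S.code.feedback ω s) fun m l => S.code.msg ω m l

/-- Bob's estimate of the messages in slot `m`. -/
def estimate (ω : Fin M → S.code.Slot) (m : Fin M) : S.code.Msg :=
  S.dec (S.code.gain₁ ω m) (S.code.out₁ ω m)

/-- Bob's key, from his gains and his received blocks. -/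
def bobKey (ω : Fin M → S.code.Slot) : Fin k :=
  S.bin (S.code.feedback ω s) fun m l => S.estimate ω m l

/-- Eve's equivocation rate `(1/n) H(K | Y₂, h₂, Ψ)` with `n = M N`. -/
def equivocationRate (μ₁ μ₂ : Measure ℝ) : ℝ :=
  condEntropy (S.code.law μ₁ μ₂ M) (S.aliceKey s) (fun ω => S.code.eveView ω s) / (M * N)

end Scheme

/-- The layered broadcast scheme with power distribution `ρ` achieves the secrecy key rate `R`.
The continuum of layers is the limit of fine discretisations. For every `ε > 0`, all sufficiently fine
and long discretisations and every slack `η > 0`, if the number `M` of slots is large, and the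
number `N` of channel uses per slot is large (depending on `M`), there is a scheme with
`⌊exp (M N R)⌋` keys whose layers have the powers and rates prescribed by `ρ` up to `η`, for
which, with probability at least `1 - ε`, Bob recovers all messages in the layers up to the index
that he feeds back; Alice's and Bob's keys agree with probability at least `1 - ε`; and Eve's
equivocation rate is at least `R - ε`. -/
def AchievesKeyRate (ρ : ℝ → ℝ) (P : ℝ) (μ₁ μ₂ : Measure ℝ) (R : ℝ) : Prop :=
  ∀ ε : ℝ, 0 < ε → ∃ δ : ℝ, 0 < δ ∧ ∃ A : ℝ, ∀ (L : ℕ) (s : Levels L), s.IsFine δ A →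
    ∀ η : ℝ, 0 < η → ∀ᶠ M : ℕ in atTop, ∀ᶠ N : ℕ in atTop,
      ∃ S : Scheme L N M ⌊Real.exp (M * N * R)⌋₊,
        S.code.Fits s ρ P η ∧
        1 - ε ≤ (S.code.law μ₁ μ₂ M).real
          {ω | ∀ m, ∀ l ≤ S.code.feedback ω s m, S.estimate ω m l = S.code.msg ω m l} ∧
        1 - ε ≤ (S.code.law μ₁ μ₂ M).real {ω | S.aliceKey s ω = S.bobKey s ω} ∧
        R - ε ≤ S.equivocationRate s μ₁ μ₂

end LayeredKey

end

noncomputable section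

namespace LayeredKey

open scoped ENNReal NNReal

/-! ### Product measures -/

/-! The scheme is a random superposition code with Gaussian codewords followed by random binning.
Three exponents have to match: Bob's error, Eve's posterior probability of the decoded messages, and
the number of bins.

Bob. For every set of layers, its superposition in noise is exactly Gaussian, so its energy
concentrates by Chebyshev (`lintegral_not_typical_le`). On the typical event all Gaussian densities
are known up to `exp (2 N τ)`. Layer `l` is decoded by a likelihood ratio test on what remains after
subtracting the lower layers. The true codeword passes at every gain above `s_l`
(`passes_of_typical`). A wrong codeword is independent of the block, its ratio has mean one, and it
passes with probability at most `exp (-N t)` by Markov (`lintegral_false_alarm_le`). A threshold `t`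
between the rate of the code and the nominal rate beats the number of wrong codewords.

Eve. In a slot with feedback `ψ` and eavesdropper gain `h`, her posterior probability of the
messages up to layer `ψ` is a quotient of sums of likelihoods. The numerator is bounded in the mean
over codebooks. Wrong messages above `ψ` are sorted by the set of layers in which they differ, and
each set contributes no more than all layers above `ψ` together, because these layers have rates
above what gain `h` can resolve (`one_add_sum_power_le`, `sum_subsets_le`). The denominator is
bounded below by a change of measure valid for every codebook: the output is rarely found where its
true density is far smaller than the density in which the layers above `h` are replaced by Gaussian
noise (`lintegral_denominator_le`). The quotient is about `exp (-N g)`, where `g = secrecyGain` is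
the rate of the decoded layers above `h` minus the logarithm of the ratio of received variances,
that is, minus what Eve can learn about those layers (`leak_bound_le`, `lintegral_leak_le`). An
average over codebooks and a union bound give one book that serves Bob, Eve and the power
constraints (`exists_good_book`).

Slots. Eve's posterior factorises over slots (`sum_posterior_eq_prod`), and the gains are i.i.d., so
by Chebyshev the product is about `exp (-M N E[g])`, up to small losses, with high probability. If
the posterior is at most `p` on a good event and the binning into `k` bins is uniform among all
functions, the mean posterior of the true bin on that event is at most `p + 1 / k`. The tangent
inequality for the logarithm turns this into an equivocation of order `-log (p + 1 / k)`, and some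
fixed binning is as good as the average (`exists_bin_le_condEntropy`). With `k = ⌊exp (M N R)⌋` this
is `M N (R - ε)`.

Rate. The inequalities `1 - 1/x ≤ log x` and `1 + x ≤ exp x` bound `g` below by a Riemann-type sum
for the reward (`sum_le_secrecyGain`). Dominated convergence in the layer variable and Fatou in the
gains show that fine discretisations lose arbitrarily little (`exists_fine_levels`). Fatou needs no
integrability, so an infinite `R_s` is included. -/

theorem lintegral_fin_prod_eq_prod {α : Type*} [MeasurableSpace α] {n : ℕ}
    (μ : Fin n → Measure α) [∀ i, SigmaFinite (μ i)] (f : Fin n → α → ℝ≥0∞)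
    (hf : ∀ i, Measurable (f i)) :
    ∫⁻ x, ∏ i, f i (x i) ∂(Measure.pi μ) = ∏ i, ∫⁻ x, f i x ∂(μ i) := by
  induction n with
  | zero => simp
  | succ n ih =>
    have h := (measurePreserving_piFinSuccAbove μ 0).symm
    rw [← h.lintegral_comp (by fun_prop)]
    have e : ∀ a : α × (Fin n → α),
        ∏ i, f i ((MeasurableEquiv.piFinSuccAbove (fun _ => α) 0).symm a i)
          = f 0 a.1 * ∏ i : Fin n, f i.succ (a.2 i) := by
      intro a
      rw [Fin.prod_univ_succ]
      rfl
    simp only [e]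
    rw [lintegral_prod_mul (f := f 0) (g := fun x : Fin n → α => ∏ i : Fin n, f i.succ (x i))
      (hf 0).aemeasurable
      (Finset.measurable_prod _ fun i _ => (hf _).comp (measurable_pi_apply i)).aemeasurable, Fin.prod_univ_succ]
    congr 1
    exact ih (fun i => μ i.succ) (fun i => f i.succ) (fun i => hf _)

theorem pi_withDensity {α : Type*} [MeasurableSpace α] {n : ℕ}
    (μ : Fin n → Measure α) [∀ i, SigmaFinite (μ i)] (f : Fin n → α → ℝ≥0∞)
    (hf : ∀ i, Measurable (f i)) [∀ i, SigmaFinite ((μ i).withDensity (f i))] :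
    Measure.pi (fun i => (μ i).withDensity (f i))
      = (Measure.pi μ).withDensity (fun x => ∏ i, f i (x i)) := by
  refine Measure.pi_eq fun s hs => ?_
  rw [withDensity_apply _ (MeasurableSet.univ_pi hs), Measure.restrict_pi_pi,
    lintegral_fin_prod_eq_prod _ _ hf]
  exact Finset.prod_congr rfl fun i _ => (withDensity_apply _ (hs i)).symm

theorem memLp_pi_sum {α : Type*} [MeasurableSpace α] (μ : Measure α)
    [IsProbabilityMeasure μ] {f : α → ℝ} (hf : MemLp f 2 μ) (n : ℕ) :
    MemLp (fun x : Fin n → α => (∑ i, f (x i)) / n - ∫ y, f y ∂μ) 2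
      (Measure.pi fun _ : Fin n => μ) := by
  refine MemLp.sub ?_ (memLp_const _)
  simp only [div_eq_mul_inv]
  exact (memLp_finsetSum _ fun i _ =>
    hf.comp_measurePreserving (measurePreserving_eval (fun _ : Fin n => μ) i)).mul_const _

/-- The mean square deviation of an empirical mean. -/
theorem lintegral_pi_mean_sq {α : Type*} [MeasurableSpace α] (μ : Measure α)
    [IsProbabilityMeasure μ] {f : α → ℝ} (hf : MemLp f 2 μ) {n : ℕ} (hn : 0 < n) :
    ∫⁻ x, ENNReal.ofReal (((∑ i, f (x i)) / n - ∫ y, f y ∂μ) ^ 2) ∂(Measure.pi fun _ : Fin n => μ)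
      = ENNReal.ofReal (Var[f; μ] / n) := by
  have hn' : (0 : ℝ) < n := by exact_mod_cast hn
  set ν := Measure.pi fun _ : Fin n => μ
  set X : (Fin n → α) → ℝ := ∑ i, fun x => f (x i) with hX
  have hmem : ∀ i : Fin n, MemLp (fun x : Fin n → α => f (x i)) 2 ν := fun i =>
    hf.comp_measurePreserving (measurePreserving_eval _ i)
  have hXm : MemLp X 2 ν := memLp_finsetSum' _ fun i _ => hmem i
  have hmean : ∫ x, X x ∂ν = n * ∫ y, f y ∂μ := by
    have : ∀ i : Fin n, ∫ x, f (x i) ∂ν = ∫ y, f y ∂μ := fun i => by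
      have h := (measurePreserving_eval (fun _ : Fin n => μ) i)
      have h2 : AEStronglyMeasurable f (Measure.map (Function.eval i) ν) := by
        rw [h.map_eq]; exact hf.1
      have := integral_map h.measurable.aemeasurable h2
      rw [h.map_eq] at this
      exact this.symm
    simp only [hX, Finset.sum_apply]
    rw [integral_finsetSum _ fun i _ => (hmem i).integrable one_le_two]
    simp [this]
  have hvar : Var[X; ν] = n * Var[f; μ] := by
    rw [hX, variance_sum_pi (fun _ => hf)]; simp
  rw [← ofReal_integral_eq_lintegral_ofReal (memLp_pi_sum μ hf n).integrable_sq
    (ae_of_all _ fun _ => sq_nonneg _)]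
  congr 1
  have e : ∀ x, ((∑ i, f (x i)) / n - ∫ y, f y ∂μ) ^ 2
      = (X x - ∫ x, X x ∂ν) ^ 2 / (n : ℝ) ^ 2 := by
    intro x
    rw [hmean, ← div_pow]
    congr 1
    simp only [hX, Finset.sum_apply]
    field_simp
  simp only [e]
  rw [integral_div, ← variance_eq_integral hXm.aemeasurable, hvar]
  field_simp

/-- Chebyshev with the second moment as a lower integral, so that mean-square bounds can be averaged
and transported without integrability side conditions. -/
theorem measure_le_of_lintegral_sq {α : Type*} [MeasurableSpace α] {μ : Measure α} {f : α → ℝ}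
    (hf : AEMeasurable f μ) {c t : ℝ} (ht : 0 < t)
    (h : ∫⁻ x, ENNReal.ofReal (f x ^ 2) ∂μ ≤ ENNReal.ofReal c) :
    μ {x | t ≤ |f x|} ≤ ENNReal.ofReal (c / t ^ 2) := by
  have h1 := mul_meas_ge_le_lintegral₀ (μ := μ) (f := fun x => ENNReal.ofReal (f x ^ 2))
    (by fun_prop) (ENNReal.ofReal (t ^ 2))
  have h2 : {x | t ≤ |f x|} ⊆ {x | ENNReal.ofReal (t ^ 2) ≤ ENNReal.ofReal (f x ^ 2)} := by
    intro x hx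
    simp only [Set.mem_ofPred_eq] at hx ⊢
    refine ENNReal.ofReal_le_ofReal ?_
    rw [← sq_abs (f x)]
    gcongr
  rw [ENNReal.ofReal_div_of_pos (by positivity), ENNReal.le_div_iff_mul_le (by simp [ht.ne'])
    (by simp), mul_comm]
  exact (mul_le_mul_right (measure_mono h2) _).trans (h1.trans h)

/-- Chebyshev's inequality for an empirical mean. -/
theorem pi_mean_deviation_le {α : Type*} [MeasurableSpace α] (μ : Measure α)
    [IsProbabilityMeasure μ] {f : α → ℝ} (hf : MemLp f 2 μ) {t : ℝ} (ht : 0 < t) {n : ℕ}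
    (hn : 0 < n) :
    (Measure.pi fun _ : Fin n => μ) {x | t ≤ |(∑ i, f (x i)) / n - ∫ y, f y ∂μ|}
      ≤ ENNReal.ofReal (Var[f; μ] / n / t ^ 2) :=
  measure_le_of_lintegral_sq (memLp_pi_sum μ hf n).aemeasurable ht (lintegral_pi_mean_sq μ hf hn).le

/-! ### Complex Gaussian blocks -/

/-- The circularly symmetric complex Gaussian law of variance `v`. -/
def gaussC (v : ℝ≥0) : Measure ℂ :=
  ((gaussianReal 0 (v / 2)).prod (gaussianReal 0 (v / 2))).map Complex.measurableEquivRealProd.symm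

instance (v : ℝ≥0) : IsProbabilityMeasure (gaussC v) :=
  Measure.isProbabilityMeasure_map (Complex.measurableEquivRealProd.symm.measurable.aemeasurable)

/-- The law of a block of `N` independent complex Gaussian samples of variance `v`. -/
def gaussBlock (N : ℕ) (v : ℝ≥0) : Measure (Fin N → ℂ) := Measure.pi fun _ => gaussC v

instance (N : ℕ) (v : ℝ≥0) : IsProbabilityMeasure (gaussBlock N v) := by
  unfold gaussBlock; infer_instance

theorem gaussC_map_mul (v : ℝ≥0) (c : ℝ≥0) :
    (gaussC v).map (fun z => ((c : ℝ) : ℂ) * z) = gaussC (c ^ 2 * v) := by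
  have h : (gaussianReal 0 (v / 2)).map (fun x => (c : ℝ) * x)
      = gaussianReal 0 (c ^ 2 * v / 2) := by
    rw [gaussianReal_map_const_mul]
    congr 1
    · simp
    · ext; push_cast; ring
  rw [gaussC, Measure.map_map (by fun_prop) (by fun_prop), gaussC, ← h,
    Measure.map_prod_map _ _ (by fun_prop) (by fun_prop),
    Measure.map_map (by fun_prop) (by fun_prop)]
  congr 1
  ext p
  simp only [Function.comp_apply, Complex.measurableEquivRealProd_symm_apply]
  apply Complex.ext <;> simp

theorem gaussBlock_map_mul (N : ℕ) (v c : ℝ≥0) :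
    (gaussBlock N v).map (fun y i => ((c : ℝ) : ℂ) * y i) = gaussBlock N (c ^ 2 * v) := by
  rw [gaussBlock, gaussBlock, ← gaussC_map_mul]
  exact Measure.pi_map_pi fun _ => by fun_prop

/-- Characteristic functions turn both convolution and product into multiplication, which makes the
two sides agree. -/
theorem prod_conv_prod {E : Type*} [NormedAddCommGroup E] [NormedSpace ℝ E] [CompleteSpace E]
    [MeasurableSpace E] [BorelSpace E] [SecondCountableTopology E]
    (μ ν : Measure E) [IsProbabilityMeasure μ] [IsProbabilityMeasure ν] :
    (μ.prod μ) ∗ (ν.prod ν) = (μ ∗ ν).prod (μ ∗ ν) := by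
  refine Measure.ext_of_charFunDual (funext fun L => ?_)
  rw [charFunDual_conv, charFunDual_prod, charFunDual_prod, charFunDual_prod, charFunDual_conv,
    charFunDual_conv]
  ring

theorem gaussC_conv (v w : ℝ≥0) : gaussC v ∗ gaussC w = gaussC (v + w) := by
  have h := Measure.map_conv_continuousLinearMap
    (μ := (gaussianReal 0 (v / 2)).prod (gaussianReal 0 (v / 2)))
    (ν := (gaussianReal 0 (w / 2)).prod (gaussianReal 0 (w / 2)))
    (L := Complex.equivRealProdCLM.symm.toContinuousLinearMap)
  rw [prod_conv_prod, gaussianReal_conv_gaussianReal, zero_add, ← add_div] at h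
  exact h.symm

theorem gaussBlock_conv (N : ℕ) (v w : ℝ≥0) :
    gaussBlock N v ∗ gaussBlock N w = gaussBlock N (v + w) := by
  refine Measure.ext_of_charFunDual (funext fun L => ?_)
  rw [charFunDual_conv, gaussBlock, gaussBlock, gaussBlock, charFunDual_pi, charFunDual_pi,
    charFunDual_pi, ← Finset.prod_mul_distrib]
  refine Finset.prod_congr rfl fun i _ => ?_
  rw [← gaussC_conv, charFunDual_conv]

theorem gaussBlock_zero (N : ℕ) : gaussBlock N 0 = Measure.dirac 0 := by
  have h := gaussBlock_map_mul N 0 0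
  simp only [NNReal.coe_zero, Complex.ofReal_zero, zero_mul, mul_zero] at h
  rw [← h, Measure.map_const]
  simp
  rfl

/-- A sum of independent Gaussian blocks is a Gaussian block. -/
theorem map_sum_gaussBlock {ι Ω : Type*} [MeasurableSpace Ω] {μ : Measure Ω}
    [IsProbabilityMeasure μ] {N : ℕ} {X : ι → Ω → Fin N → ℂ} (hX : ∀ i, Measurable (X i))
    (hind : iIndepFun X μ) (v : ι → ℝ≥0) (hlaw : ∀ i, μ.map (X i) = gaussBlock N (v i))
    (s : Finset ι) : μ.map (fun ω => ∑ i ∈ s, X i ω) = gaussBlock N (∑ i ∈ s, v i) := by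
  classical
  induction s using Finset.induction_on with
  | empty => simp [gaussBlock_zero, Measure.map_const]
  | insert i s hi ih =>
    have h1 := (hind.indepFun_finsetSum_of_notMem (fun i => hX i) hi).symm
    have e : (fun ω => ∑ j ∈ s, X j ω) = ∑ j ∈ s, X j := by ext; simp
    have h2 := h1.map_add_eq_map_conv_map (hX i)
      (e ▸ Finset.measurable_sum _ fun i _ => hX i)
    rw [e] at ih
    rw [ih, hlaw, gaussBlock_conv] at h2
    rw [Finset.sum_insert hi, ← h2]
    congr 1
    ext ω : 1
    simp [Finset.sum_insert hi]

/-! ### Energies and densities of Gaussian blocks -/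

/-- The energy of a block. -/
def energy {N : ℕ} (y : Fin N → ℂ) : ℝ := ∑ i, ‖y i‖ ^ 2

@[fun_prop]
theorem measurable_energy {N : ℕ} : Measurable (energy : (Fin N → ℂ) → ℝ) := by
  unfold energy; fun_prop

theorem energy_mul {N : ℕ} (c : ℝ) (y : Fin N → ℂ) :
    energy (fun i => (c : ℂ) * y i) = c ^ 2 * energy y := by
  simp [energy, mul_pow, Finset.mul_sum]

/-- The density of a Gaussian block of variance `v`. -/
def blockDensity {N : ℕ} (v : ℝ) (y : Fin N → ℂ) : ℝ :=
  ((Real.pi * v)⁻¹) ^ N * Real.exp (-energy y / v)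

theorem blockDensity_pos {N : ℕ} {v : ℝ} (hv : 0 < v) (y : Fin N → ℂ) : 0 < blockDensity v y := by
  unfold blockDensity; positivity

theorem measurable_blockDensity {N : ℕ} :
    Measurable (fun p : ℝ × (Fin N → ℂ) => blockDensity p.1 p.2) := by
  unfold blockDensity; fun_prop

theorem gaussC_eq_withDensity {v : ℝ≥0} (hv : 0 < v) :
    gaussC v = volume.withDensity
      (fun z : ℂ => ENNReal.ofReal ((Real.pi * v)⁻¹ * Real.exp (-‖z‖ ^ 2 / v))) := by
  have hv2 : v / 2 ≠ 0 := by positivity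
  have hv' : (0 : ℝ) < v := by exact_mod_cast hv
  rw [gaussC, gaussianReal_of_var_ne_zero _ hv2,
    prod_withDensity (measurable_gaussianPDF _ _) (measurable_gaussianPDF _ _)]
  have hvol := (Complex.volume_preserving_equiv_real_prod.symm)
  ext s hs
  rw [Measure.map_apply (by fun_prop) hs,
    withDensity_apply _ (Complex.measurableEquivRealProd.symm.measurable hs),
    withDensity_apply _ hs, ← hvol.setLIntegral_comp_preimage hs (by fun_prop)]
  refine lintegral_congr fun p => ?_
  rw [gaussianPDF, gaussianPDF, ← ENNReal.ofReal_mul (gaussianPDFReal_nonneg _ _ _)]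
  congr 1
  have e : ‖Complex.measurableEquivRealProd.symm p‖ ^ 2 = p.1 ^ 2 + p.2 ^ 2 := by
    rw [Complex.sq_norm, Complex.normSq_apply]; simp; ring
  rw [e, gaussianPDFReal, gaussianPDFReal, mul_mul_mul_comm, ← Real.exp_add, ← mul_inv,
    Real.mul_self_sqrt (by positivity)]
  push_cast
  congr 2
  · field_simp
  · field_simp; ring

theorem gaussBlock_eq_withDensity (N : ℕ) {v : ℝ≥0} (hv : 0 < v) :
    gaussBlock N v = volume.withDensity (fun y => ENNReal.ofReal (blockDensity v y)) := by
  have hv' : (0 : ℝ) < v := by exact_mod_cast hv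
  rw [gaussBlock, gaussC_eq_withDensity hv, pi_withDensity _ _ (fun _ => by fun_prop), volume_pi]
  congr 1
  ext y
  rw [← ENNReal.ofReal_prod_of_nonneg (fun _ _ => by positivity), Finset.prod_mul_distrib,
    ← Real.exp_sum, blockDensity, energy, ← Finset.sum_div, Finset.sum_neg_distrib]
  simp

/-- Fourth moments of the real and imaginary parts are finite. This is what allows Chebyshev to be
applied to energies. -/
theorem memLp_sq_norm_gaussC (v : ℝ≥0) : MemLp (fun z : ℂ => ‖z‖ ^ 2) 2 (gaussC v) := by
  have hg : MemLp (fun x : ℝ => x ^ 2) 2 (gaussianReal 0 (v / 2)) := by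
    have h4 := memLp_id_gaussianReal' (μ := 0) (v := v / 2) 4 (by simp)
    have := h4.norm_rpow_div 2
    have e : (4 : ℝ≥0∞) / 2 = 2 := by
      rw [ENNReal.div_eq_inv_mul, show (4 : ℝ≥0∞) = 2 * 2 by norm_num, ← mul_assoc,
        ENNReal.inv_mul_cancel (by simp) (by simp), one_mul]
    rw [e] at this
    refine this.congr_norm (by fun_prop) (ae_of_all _ fun x => ?_)
    simp
  have hm : AEStronglyMeasurable (fun z : ℂ => ‖z‖ ^ 2) (gaussC v) := by fun_prop
  unfold gaussC at hm ⊢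
  rw [memLp_map_measure_iff hm (by fun_prop)]
  refine ((hg.comp_fst (gaussianReal 0 (v / 2))).add
    (hg.comp_snd (gaussianReal 0 (v / 2)))).congr_norm (by fun_prop) (ae_of_all _ fun p => ?_)
  simp only [Function.comp_apply, Pi.add_apply, Complex.sq_norm, Complex.normSq_apply,
    Complex.measurableEquivRealProd_symm_apply]
  ring_nf

theorem integral_sq_norm_gaussC (v : ℝ≥0) : ∫ z, ‖z‖ ^ 2 ∂(gaussC v) = v := by
  have hg : ∫ x, x ^ 2 ∂(gaussianReal 0 (v / 2)) = v / 2 := by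
    have h := variance_id_gaussianReal (μ := 0) (v := v / 2)
    rw [variance_eq_integral (by fun_prop)] at h
    simpa using h
  have hi : Integrable (fun x : ℝ => x ^ 2) (gaussianReal 0 (v / 2)) := by
    have := (memLp_id_gaussianReal' (μ := 0) (v := v / 2) 2 (by simp)).integrable_sq
    simpa using this
  rw [gaussC, integral_map (by fun_prop) (by fun_prop)]
  have e : ∀ p : ℝ × ℝ, ‖Complex.measurableEquivRealProd.symm p‖ ^ 2 = p.1 ^ 2 + p.2 ^ 2 := by
    intro p; rw [Complex.sq_norm, Complex.normSq_apply]; simp; ring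
  simp only [e]
  rw [integral_add (hi.comp_fst _) (hi.comp_snd _), integral_fun_fst (fun x : ℝ => x ^ 2),
    integral_fun_snd (fun x : ℝ => x ^ 2), hg]
  simp

/-- The variance of the energy of one standard complex Gaussian sample. -/
def energyVar : ℝ := Var[fun z : ℂ => ‖z‖ ^ 2; gaussC 1]

theorem energyVar_nonneg : 0 ≤ energyVar := variance_nonneg _ _

/-- The mean square deviation of the energy of a Gaussian block. -/
theorem lintegral_energy_sq_deviation {N : ℕ} (hN : 0 < N) (v : ℝ≥0) :
    ∫⁻ y, ENNReal.ofReal ((energy y / N - v) ^ 2) ∂(gaussBlock N v)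
      = ENNReal.ofReal (v ^ 2 * (energyVar / N)) := by
  have h := gaussBlock_map_mul N 1 (NNReal.sqrt v)
  rw [NNReal.sq_sqrt, mul_one] at h
  have h1 := lintegral_pi_mean_sq (gaussC 1) (memLp_sq_norm_gaussC 1) hN
  rw [integral_sq_norm_gaussC] at h1
  rw [← h, lintegral_map (by fun_prop) (by fun_prop), ENNReal.ofReal_mul (by positivity),
    energyVar, ← h1, ← lintegral_const_mul' _ _ (by simp)]
  refine lintegral_congr fun y => ?_
  rw [← ENNReal.ofReal_mul (by positivity), energy_mul, ← NNReal.coe_pow, NNReal.sq_sqrt]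
  congr 1
  simp only [energy, NNReal.coe_one]
  ring

/-- The energy of a Gaussian block is close to its mean. -/
theorem gaussBlock_deviation_le {N : ℕ} (hN : 0 < N) {t : ℝ} (ht : 0 < t) {v : ℝ≥0} (hv : 0 < v) :
    gaussBlock N v {y | t ≤ |energy y / (N * v) - 1|}
      ≤ ENNReal.ofReal (energyVar / N / t ^ 2) := by
  have hv' : (0 : ℝ) < v := by exact_mod_cast hv
  have h := measure_le_of_lintegral_sq (μ := gaussBlock N v)
    (f := fun y => energy y / N - v) (by fun_prop) (t := v * t) (by positivity)
    (lintegral_energy_sq_deviation hN v).le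
  refine (measure_mono fun y hy => ?_).trans (h.trans_eq ?_)
  · simp only [Set.mem_ofPred_eq] at hy ⊢
    have e : energy y / N - v = v * (energy y / (N * v) - 1) := by
      field_simp
    rw [e, abs_mul, abs_of_pos hv']
    gcongr
  · congr 1
    field_simp

end LayeredKey

end

noncomputable section

namespace LayeredKey

open scoped ENNReal NNReal Topology

/-! ### Superposed powers -/

/-- A chain rule, by induction on the smallest layer `a`. If `a ∈ T`, its factor telescopes with
equality. If `a ∉ T`, its power joins the first factor, and since the product is at least one the
inequality survives. Thus the layers outside `T` act as interference, and only the layers above `l`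
count against `l`. -/
theorem one_add_sum_le_mul_prod {ι : Type*} [LinearOrder ι] (q : ι → ℝ) (hq : ∀ i, 0 ≤ q i)
    {h : ℝ} (hh : 0 ≤ h) (T U : Finset ι) :
    1 + h * ∑ i ∈ U, q i ≤ (1 + h * ∑ i ∈ U with i ∉ T, q i) *
      ∏ l ∈ U with l ∈ T, (1 + h * q l / (1 + h * ∑ i ∈ U with l < i, q i)) := by
  induction U using Finset.induction_on_min with
  | empty => simp
  | insert a U ha ih =>
    have haU : a ∉ U := fun h => lt_irrefl _ (ha a h)
    have hS : ∀ S : Finset ι, 0 ≤ h * ∑ i ∈ S, q i := fun S =>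
      mul_nonneg hh (Finset.sum_nonneg fun i _ => hq i)
    have e1 : ∀ l ∈ U, ({i ∈ insert a U | l < i} : Finset ι) = {i ∈ U | l < i} := by
      intro l hl
      rw [Finset.filter_insert, if_neg (not_lt.mpr (ha l hl).le)]
    have e2 : ({i ∈ insert a U | a < i} : Finset ι) = U := by
      rw [Finset.filter_insert, if_neg (lt_irrefl _), Finset.filter_true_of_mem ha]
    have e3 : ∏ l ∈ U with l ∈ T, (1 + h * q l / (1 + h * ∑ i ∈ insert a U with l < i, q i))
        = ∏ l ∈ U with l ∈ T, (1 + h * q l / (1 + h * ∑ i ∈ U with l < i, q i)) :=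
      Finset.prod_congr rfl fun l hl => by rw [e1 l (Finset.mem_filter.1 hl).1]
    set Q := ∏ l ∈ U with l ∈ T, (1 + h * q l / (1 + h * ∑ i ∈ U with l < i, q i)) with hQ
    have hQ1 : 1 ≤ Q := by
      refine Finset.one_le_prod fun l _ => ?_
      have := hS {i ∈ U | l < i}
      have : 0 ≤ h * q l / (1 + h * ∑ i ∈ U with l < i, q i) :=
        div_nonneg (mul_nonneg hh (hq l)) (by linarith)
      linarith
    have hqa := mul_nonneg hh (hq a)
    rw [Finset.sum_insert haU, Finset.filter_insert, Finset.filter_insert]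
    by_cases hT : a ∈ T
    · rw [if_pos hT, if_neg (not_not.mpr hT), Finset.prod_insert (by simp [haU]), e3, e2]
      have hp : 0 < 1 + h * ∑ i ∈ U, q i := by linarith [hS U]
      have : 1 + h * (q a + ∑ i ∈ U, q i)
          = (1 + h * ∑ i ∈ U, q i) * (1 + h * q a / (1 + h * ∑ i ∈ U, q i)) := by
        field_simp
        ring
      rw [this]
      have h3 : 0 ≤ 1 + h * q a / (1 + h * ∑ i ∈ U, q i) := by positivity
      calc _ ≤ ((1 + h * ∑ i ∈ U with i ∉ T, q i) * Q) * (1 + h * q a / (1 + h * ∑ i ∈ U, q i)) :=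
            mul_le_mul_of_nonneg_right ih h3
        _ = _ := by ring
    · rw [if_neg hT, if_pos hT, Finset.sum_insert (by simp [haU]), e3]
      nlinarith

/-- The ratio of received variances of a larger and a smaller power is nondecreasing in the gain. -/
theorem scaled_ratio_le {a b c h : ℝ} (hb : 0 ≤ b) (hab : b ≤ a) (hh : 0 ≤ h) (hc1 : c ≤ h)
    (hc0 : 0 ≤ c) : (1 + c * a) / (1 + c * b) ≤ (1 + h * a) / (1 + h * b) := by
  rw [div_le_div_iff₀ (by positivity) (by positivity)]
  nlinarith [mul_nonneg (sub_nonneg.2 hc1) (sub_nonneg.2 hab)]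

/-! ### Levels -/

namespace Levels

variable {L : ℕ} (s : Levels L)

theorem topLayer_mono : Monotone s.topLayer := fun _ _ hab =>
  Finset.sup_mono fun _ hl => by
    simp only [Finset.mem_filter, Finset.mem_univ, true_and] at hl ⊢
    exact hl.trans hab

theorem measurable_topLayer : Measurable s.topLayer :=
  measurable_to_countable' fun l => by
    have : (s.topLayer ⁻¹' {l}).OrdConnected :=
      Set.OrdConnected.preimage_mono Set.ordConnected_singleton s.topLayer_mono
    exact this.measurableSet

theorem level_nonneg (l : Fin (L + 1)) : 0 ≤ s.level l := by
  rw [← s.level_zero]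
  exact s.strictMono.monotone (Fin.zero_le l)

theorem level_topLayer_le {h : ℝ} (hh : 0 ≤ h) : s.level (s.topLayer h) ≤ h := by
  have hne : (Finset.univ.filter fun l => s.level l ≤ h).Nonempty :=
    ⟨0, by simp [s.level_zero, hh]⟩
  obtain ⟨i, hi, he⟩ := Finset.exists_mem_eq_sup _ hne id
  have : s.topLayer h = i := he
  rw [this]
  simpa using hi

theorem le_topLayer_iff {h : ℝ} (hh : 0 ≤ h) (l : Fin (L + 1)) :
    l ≤ s.topLayer h ↔ s.level l ≤ h := by
  constructor
  · intro hl
    exact (s.strictMono.monotone hl).trans (s.level_topLayer_le hh)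
  · intro hl
    exact Finset.le_sup (f := id) (by simpa using hl)

/-- The decoded layers above the gain `h` when the highest decoded layer is `ψ`. -/
def hidden (ψ : Fin (L + 1)) (h : ℝ) : Finset (Fin (L + 1)) :=
  Finset.univ.filter fun l => l ≤ ψ ∧ h < s.level l

theorem mem_hidden {ψ l : Fin (L + 1)} {h : ℝ} : l ∈ s.hidden ψ h ↔ l ≤ ψ ∧ h < s.level l := by
  simp [hidden]

/-- One hidden layer, at or below `ψ`, already has a level above `h`, and levels increase. Hence
every undecoded layer is also beyond Eve's gain. -/
theorem level_lt_of_hidden_nonempty {ψ : Fin (L + 1)} {h : ℝ} (hne : (s.hidden ψ h).Nonempty)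
    {l : Fin (L + 1)} (hl : ψ < l) : h < s.level l := by
  obtain ⟨j, hj⟩ := hne
  rw [mem_hidden] at hj
  exact hj.2.trans_le (s.strictMono.monotone (hj.1.trans hl.le))

variable {ρ : ℝ → ℝ}

theorem power_nonneg (hρ : ∀ u, 0 ≤ u → 0 ≤ ρ u) (l : Fin (L + 1)) : 0 ≤ s.power ρ l := by
  refine setIntegral_nonneg ?_ fun u hu => hρ u hu.1
  exact measurableSet_Ici.inter (s.measurable_topLayer (measurableSet_singleton l))

theorem sum_power_nonneg (hρ : ∀ u, 0 ≤ u → 0 ≤ ρ u) (S : Finset (Fin (L + 1))) :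
    0 ≤ ∑ l ∈ S, s.power ρ l := Finset.sum_nonneg fun l _ => s.power_nonneg hρ l

/-- Layer sums become integrals of step functions against `ρ`, the form in which dominated
convergence applies. -/
theorem sum_mul_power (hρ : IntegrableOn ρ (Set.Ioi 0)) (S : Finset (Fin (L + 1)))
    (c : Fin (L + 1) → ℝ) :
    ∑ l ∈ S, c l * s.power ρ l
      = ∫ u in Set.Ioi 0, if s.topLayer u ∈ S then c (s.topLayer u) * ρ u else 0 := by
  have hm : ∀ l, MeasurableSet (s.topLayer ⁻¹' {l}) := fun l =>
    s.measurable_topLayer (measurableSet_singleton l)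
  have h1 : ∀ l, s.power ρ l = ∫ u in Set.Ioi 0, (s.topLayer ⁻¹' {l}).indicator ρ u := by
    intro l
    rw [power, setIntegral_indicator (hm l)]
    have : {u : ℝ | 0 ≤ u ∧ s.topLayer u = l} = Set.Ici 0 ∩ s.topLayer ⁻¹' {l} := rfl
    rw [this]
    refine setIntegral_congr_set ?_
    exact Ioi_ae_eq_Ici.symm.inter (ae_eq_refl _)
  simp only [h1, ← integral_const_mul]
  rw [← integral_finsetSum]
  · refine integral_congr_ae (ae_of_all _ fun u => ?_)
    have e : ∀ l, c l * (s.topLayer ⁻¹' {l}).indicator ρ u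
        = if s.topLayer u = l then c l * ρ u else 0 := by
      intro l
      by_cases h : s.topLayer u = l <;> simp [h]
    simp only [e, Finset.sum_ite_eq]
  · intro l _
    exact (hρ.indicator (hm l)).const_mul _

theorem sum_power (hρ : IntegrableOn ρ (Set.Ioi 0)) (S : Finset (Fin (L + 1))) :
    ∑ l ∈ S, s.power ρ l = ∫ u in Set.Ioi 0 ∩ {u | s.topLayer u ∈ S}, ρ u := by
  have := s.sum_mul_power hρ S fun _ => 1
  simp only [one_mul] at this
  rw [this]
  refine Eq.trans ?_ (setIntegral_indicator (s.measurable_topLayer S.measurableSet))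
  refine integral_congr_ae (ae_of_all _ fun u => ?_)
  by_cases h : s.topLayer u ∈ S <;> simp [h]

theorem sum_power_univ (hρ : IntegrableOn ρ (Set.Ioi 0)) :
    ∑ l, s.power ρ l = interference ρ 0 := by
  rw [s.sum_power hρ]; simp [interference]

theorem sum_power_Ici (hρ : IntegrableOn ρ (Set.Ioi 0)) (l : Fin (L + 1)) :
    ∑ i ∈ Finset.Ici l, s.power ρ i = interference ρ (s.level l) := by
  rw [s.sum_power hρ, interference]
  have : Set.Ioi 0 ∩ {u | s.topLayer u ∈ Finset.Ici l} = Set.Ioi 0 ∩ Set.Ici (s.level l) := by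
    ext u
    simp only [Set.mem_inter_iff, Set.mem_Ioi, Set.mem_ofPred_eq, Finset.mem_Ici, Set.mem_Ici]
    exact and_congr_right fun hu => s.le_topLayer_iff hu.le l
  rw [this]
  have h0 := s.level_nonneg l
  have h2 : (Set.Ioi 0 ∩ Set.Ici (s.level l) : Set ℝ)
      =ᵐ[volume] (Set.Ioi 0 ∩ Set.Ioi (s.level l) : Set ℝ) := 
    (ae_eq_refl _).inter Ioi_ae_eq_Ici.symm
  rw [setIntegral_congr_set h2, Set.Ioi_inter_Ioi, max_eq_right h0]

theorem power_add_sum_Ioi (l : Fin (L + 1)) :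
    s.power ρ l + ∑ i ∈ Finset.Ioi l, s.power ρ i = ∑ i ∈ Finset.Ici l, s.power ρ i := by
  rw [Finset.Ici_eq_cons_Ioi, Finset.sum_cons]

theorem exp_rate (hρ : ∀ u, 0 ≤ u → 0 ≤ ρ u) (l : Fin (L + 1)) :
    Real.exp (s.rate ρ l)
      = 1 + s.level l * s.power ρ l / (1 + s.level l * ∑ i ∈ Finset.Ioi l, s.power ρ i) := by
  have h1 := s.power_nonneg hρ l
  have h2 := s.sum_power_nonneg hρ (Finset.Ioi l)
  have h3 := s.level_nonneg l
  rw [rate, Real.exp_log (by positivity)]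

theorem rate_nonneg (hρ : ∀ u, 0 ≤ u → 0 ≤ ρ u) (l : Fin (L + 1)) : 0 ≤ s.rate ρ l := by
  have h1 := s.power_nonneg hρ l
  have h2 := s.sum_power_nonneg hρ (Finset.Ioi l)
  have h3 := s.level_nonneg l
  refine Real.log_nonneg ?_
  have : 0 ≤ s.level l * s.power ρ l / (1 + s.level l * ∑ i ∈ Finset.Ioi l, s.power ρ i) := by
    positivity
  linarith

theorem filter_lt_of_isUpperSet {U : Finset (Fin (L + 1))} (hU : IsUpperSet (U : Set (Fin (L + 1))))
    {l : Fin (L + 1)} (hl : l ∈ U) : ({i ∈ U | l < i} : Finset _) = Finset.Ioi l := by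
  ext i
  simp only [Finset.mem_filter, Finset.mem_Ioi, and_iff_right_iff_imp]
  exact fun h => hU h.le hl

/-- At a gain below their levels, the layers in `T` carry no more than their rates. -/
theorem one_add_sum_power_le (hρ : ∀ u, 0 ≤ u → 0 ≤ ρ u) {h : ℝ} (hh : 0 ≤ h)
    {U : Finset (Fin (L + 1))} (hU : IsUpperSet (U : Set (Fin (L + 1)))) (T : Finset (Fin (L + 1)))
    (hT : ∀ l ∈ U, l ∈ T → h ≤ s.level l) :
    1 + h * ∑ i ∈ U, s.power ρ i ≤ (1 + h * ∑ i ∈ U with i ∉ T, s.power ρ i) *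
      Real.exp (∑ l ∈ U with l ∈ T, s.rate ρ l) := by
  refine (one_add_sum_le_mul_prod (s.power ρ) (s.power_nonneg hρ) hh T U).trans ?_
  have h0 := s.sum_power_nonneg hρ {i ∈ U | i ∉ T}
  refine mul_le_mul_of_nonneg_left ?_ (by positivity)
  rw [Real.exp_sum]
  refine Finset.prod_le_prod (fun l _ => ?_) fun l hl => ?_
  · have h1 := s.power_nonneg hρ l
    have h2 := s.sum_power_nonneg hρ {i ∈ U | l < i}
    positivity
  · rw [Finset.mem_filter] at hl
    rw [s.exp_rate hρ, filter_lt_of_isUpperSet hU hl.1]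
    have h1 := s.power_nonneg hρ l
    have h2 := s.sum_power_nonneg hρ (Finset.Ioi l)
    have h3 := hT l hl.1 hl.2
    have h4 := s.level_nonneg l
    gcongr 1 + ?_
    rw [div_le_div_iff₀ (by positivity) (by positivity)]
    nlinarith [mul_nonneg (sub_nonneg.2 h3) h1]

/-! ### The secrecy gain of a slot -/

/-- The rate of secrecy, in nats per channel use, left in the layers that Bob decodes in a slot where
he feeds back `ψ` and the eavesdropper's gain is `h`. -/
def secrecyGain (ρ : ℝ → ℝ) (ψ : Fin (L + 1)) (h : ℝ) : ℝ :=
  ∑ l ∈ s.hidden ψ h, s.rate ρ l -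
    Real.log ((1 + h * ∑ i ∈ s.hidden ψ h ∪ Finset.Ioi ψ, s.power ρ i)
      / (1 + h * ∑ i ∈ Finset.Ioi ψ, s.power ρ i))

theorem isUpperSet_hidden_union (ψ : Fin (L + 1)) (h : ℝ) :
    IsUpperSet ((s.hidden ψ h ∪ Finset.Ioi ψ : Finset _) : Set (Fin (L + 1))) := by
  intro a b hab ha
  simp only [Finset.coe_union, Set.mem_union, Finset.mem_coe, mem_hidden, Finset.mem_Ioi] at ha ⊢
  rcases ha with ha | ha
  · by_cases hb : b ≤ ψ
    · exact .inl ⟨hb, ha.2.trans_le (s.strictMono.monotone hab)⟩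
    · exact .inr (not_le.1 hb)
  · exact .inr (ha.trans_le hab)

theorem hidden_union_filter (ψ : Fin (L + 1)) (h : ℝ) :
    ({i ∈ s.hidden ψ h ∪ Finset.Ioi ψ | i ∈ s.hidden ψ h} : Finset _) = s.hidden ψ h ∧
    ({i ∈ s.hidden ψ h ∪ Finset.Ioi ψ | i ∉ s.hidden ψ h} : Finset _) = Finset.Ioi ψ := by
  constructor <;> ext i <;> simp only [Finset.mem_filter, Finset.mem_union, mem_hidden,
    Finset.mem_Ioi]
  · tauto
  · constructor
    · tauto
    · intro hi
      exact ⟨.inr hi, fun h => absurd hi (not_lt.2 h.1)⟩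

/-- Hidden layers have rates computed at levels above `h`, so at gain `h` they carry at least as
much as Eve can learn about them. -/
theorem secrecyGain_nonneg (hρ : ∀ u, 0 ≤ u → 0 ≤ ρ u) (ψ : Fin (L + 1)) {h : ℝ} (hh : 0 ≤ h) :
    0 ≤ s.secrecyGain ρ ψ h := by
  have h1 := s.one_add_sum_power_le hρ hh (s.isUpperSet_hidden_union ψ h) (s.hidden ψ h)
    (fun l _ hl => (s.mem_hidden.1 hl).2.le)
  rw [(s.hidden_union_filter ψ h).1, (s.hidden_union_filter ψ h).2] at h1
  have h2 := s.sum_power_nonneg hρ (Finset.Ioi ψ)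
  have h3 := s.sum_power_nonneg hρ (s.hidden ψ h ∪ Finset.Ioi ψ)
  rw [secrecyGain, sub_nonneg, Real.log_le_iff_le_exp (by positivity),
    div_le_iff₀ (by positivity), mul_comm (Real.exp _)]
  exact h1

theorem secrecyGain_of_hidden_empty {ψ : Fin (L + 1)} {h : ℝ} (he : s.hidden ψ h = ∅) :
    s.secrecyGain ρ ψ h = 0 := by
  rw [secrecyGain, he]
  simp only [Finset.sum_empty, Finset.empty_union, zero_sub, neg_eq_zero]
  -- The gain is not assumed nonnegative, so the quotient may be `0 / 0`; then it equals `0` by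
  -- convention, and so does its logarithm.
  by_cases h0 : 1 + h * ∑ i ∈ Finset.Ioi ψ, s.power ρ i = 0
  · simp [h0]
  · simp [div_self h0]

/-- The bound `1 - 1/x ≤ log x` on Bob's rates puts `Finset.Ici l` in the first denominator, and `1
+ x ≤ exp x` on Eve's side leaves `Finset.Ioi l` in the second. Both sums tend to `I(s)` as the
levels become fine, so the left side is a Riemann-type sum for the reward. -/
theorem sum_le_secrecyGain (hρ : ∀ u, 0 ≤ u → 0 ≤ ρ u) (ψ : Fin (L + 1)) {h : ℝ} (hh : 0 ≤ h) :
    ∑ l ∈ s.hidden ψ h, (s.level l / (1 + s.level l * ∑ i ∈ Finset.Ici l, s.power ρ i)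
      - h / (1 + h * ∑ i ∈ Finset.Ioi l, s.power ρ i)) * s.power ρ l ≤ s.secrecyGain ρ ψ h := by
  have h1 := one_add_sum_le_mul_prod (s.power ρ) (s.power_nonneg hρ) hh (s.hidden ψ h)
    (s.hidden ψ h ∪ Finset.Ioi ψ)
  rw [(s.hidden_union_filter ψ h).1, (s.hidden_union_filter ψ h).2] at h1
  have h2 := s.sum_power_nonneg hρ (Finset.Ioi ψ)
  have h3 := s.sum_power_nonneg hρ (s.hidden ψ h ∪ Finset.Ioi ψ)
  have hlog : Real.log ((1 + h * ∑ i ∈ s.hidden ψ h ∪ Finset.Ioi ψ, s.power ρ i)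
      / (1 + h * ∑ i ∈ Finset.Ioi ψ, s.power ρ i))
      ≤ ∑ l ∈ s.hidden ψ h, h / (1 + h * ∑ i ∈ Finset.Ioi l, s.power ρ i) * s.power ρ l := by
    rw [Real.log_le_iff_le_exp (by positivity), div_le_iff₀ (by positivity), mul_comm (Real.exp _)]
    refine h1.trans (mul_le_mul_of_nonneg_left ?_ (by positivity))
    rw [Real.exp_sum]
    refine Finset.prod_le_prod (fun l _ => ?_) fun l hl => ?_
    · have h1 := s.power_nonneg hρ l
      have h2 := s.sum_power_nonneg hρ {i ∈ s.hidden ψ h ∪ Finset.Ioi ψ | l < i}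
      positivity
    · rw [filter_lt_of_isUpperSet (s.isUpperSet_hidden_union ψ h) (Finset.mem_union_left _ hl),
        add_comm, div_mul_eq_mul_div]
      exact Real.add_one_le_exp _
  have hrate : ∀ l, s.level l / (1 + s.level l * ∑ i ∈ Finset.Ici l, s.power ρ i) * s.power ρ l
      ≤ s.rate ρ l := by
    intro l
    have h1 := s.power_nonneg hρ l
    have h2 := s.sum_power_nonneg hρ (Finset.Ioi l)
    have h4 := s.level_nonneg l
    rw [← s.power_add_sum_Ioi, rate]
    refine le_trans (le_of_eq ?_) (Real.one_sub_inv_le_log_of_pos (by positivity))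
    field_simp
    ring
  rw [secrecyGain]
  simp only [sub_mul, Finset.sum_sub_distrib]
  exact sub_le_sub (Finset.sum_le_sum fun l _ => hrate l) hlog

theorem measurable_secrecyGain (ρ : ℝ → ℝ) :
    Measurable fun p : Fin (L + 1) × ℝ => s.secrecyGain ρ p.1 p.2 := by
  refine measurable_from_prod_countable_right fun ψ => ?_
  have hs : ∀ c : Fin (L + 1) → ℝ, Measurable fun h => ∑ l ∈ s.hidden ψ h, c l := by
    intro c
    simp only [hidden, Finset.sum_filter]
    refine Finset.measurable_sum _ fun l _ => Measurable.ite ?_ measurable_const measurable_const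
    exact (MeasurableSet.const (l ≤ ψ)).inter measurableSet_Iio
  have e : ∀ h, ∑ i ∈ s.hidden ψ h ∪ Finset.Ioi ψ, s.power ρ i
      = ∑ i ∈ s.hidden ψ h, s.power ρ i + ∑ i ∈ Finset.Ioi ψ, s.power ρ i := by
    intro h
    refine Finset.sum_union ?_
    rw [Finset.disjoint_left]
    intro i hi hi'
    exact absurd (Finset.mem_Ioi.1 hi') (not_lt.2 (s.mem_hidden.1 hi).1)
  simp only [secrecyGain, e]
  exact (hs _).sub (Real.measurable_log.comp
    ((measurable_const.add (measurable_id.mul ((hs _).add_const _))).div (by fun_prop)))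

/-- A bound independent of the gains; it supplies the second moment needed to average over slots. -/
theorem secrecyGain_le (hρ : ∀ u, 0 ≤ u → 0 ≤ ρ u) (ψ : Fin (L + 1)) {h : ℝ} (hh : 0 ≤ h) :
    s.secrecyGain ρ ψ h ≤ ∑ l, s.rate ρ l := by
  have h2 := s.sum_power_nonneg hρ (Finset.Ioi ψ)
  have hsub : ∑ i ∈ Finset.Ioi ψ, s.power ρ i ≤ ∑ i ∈ s.hidden ψ h ∪ Finset.Ioi ψ, s.power ρ i :=
    Finset.sum_le_sum_of_subset_of_nonneg Finset.subset_union_right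
      fun l _ _ => s.power_nonneg hρ l
  have h1 : 0 ≤ Real.log ((1 + h * ∑ i ∈ s.hidden ψ h ∪ Finset.Ioi ψ, s.power ρ i)
      / (1 + h * ∑ i ∈ Finset.Ioi ψ, s.power ρ i)) := by
    refine Real.log_nonneg ?_
    rw [le_div_iff₀ (by positivity), one_mul]
    gcongr
  rw [secrecyGain]
  refine (sub_le_self _ h1).trans ?_
  exact Finset.sum_le_sum_of_subset_of_nonneg (Finset.subset_univ _)
    fun l _ _ => s.rate_nonneg hρ l

end Levels

end LayeredKey

end

noncomputable section

namespace LayeredKey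

open scoped ENNReal NNReal Topology

/-! ### Fine discretisations -/

/-- Only `ρ` on `(0, ∞)` is integrable, so `ρ` is extended by zero; `I` then differs from a constant
by a primitive. -/
theorem continuousOn_interference {ρ : ℝ → ℝ} (hρ : IntegrableOn ρ (Set.Ioi 0)) :
    ContinuousOn (interference ρ) (Set.Ici 0) := by
  set F : ℝ → ℝ := (Set.Ioi 0).indicator ρ with hF
  have hFi : Integrable F := hρ.integrable_indicator measurableSet_Ioi
  have e : ∀ s ∈ Set.Ici (0 : ℝ), interference ρ s = interference ρ 0 - ∫ u in (0 : ℝ)..s, F u := by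
    intro s hs
    have h1 : ∀ t ∈ Set.Ici (0 : ℝ), interference ρ t = ∫ u in Set.Ioi t, F u := by
      intro t ht
      refine setIntegral_congr_fun measurableSet_Ioi fun u hu => ?_
      have : u ∈ Set.Ioi (0 : ℝ) := Set.mem_Ioi.2 (lt_of_le_of_lt ht hu)
      simp [hF, this]
    rw [h1 s hs, h1 0 Set.self_mem_Ici]
    have := intervalIntegral.integral_interval_add_Ioi' (a := 0) (b := s) (f := F) (μ := volume)
      hFi.intervalIntegrable hFi.integrableOn
    linarith
  refine ContinuousOn.congr ?_ e
  exact (continuous_const.sub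
    (intervalIntegral.continuous_primitive (fun _ _ => hFi.intervalIntegrable) 0)).continuousOn

theorem interference_nonneg {ρ : ℝ → ℝ} (hρ : ∀ u, 0 ≤ u → 0 ≤ ρ u) {s : ℝ} (hs : 0 ≤ s) :
    0 ≤ interference ρ s :=
  setIntegral_nonneg measurableSet_Ioi fun _ hu => hρ _ (hs.trans (le_of_lt hu))

namespace Levels

variable {L : ℕ} (s : Levels L) {ρ : ℝ → ℝ}

theorem lt_level_topLayer_add {δ A u : ℝ} (hs : s.IsFine δ A) (hu : 0 ≤ u) (huA : u < A) :
    u < s.level (s.topLayer u) + δ ∧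
      ∀ v, s.level (s.topLayer u) + δ ≤ v → s.topLayer u < s.topLayer v := by
  -- The highest cell is unbounded, so gaps control nothing there. The bound `u < A ≤ s_L` keeps `u`
  -- out of it.
  have hlast : s.topLayer u ≠ Fin.last L := by
    intro h
    have := s.level_topLayer_le hu
    rw [h] at this
    exact absurd (hs.2.trans this) (not_le.2 huA)
  obtain ⟨l, hl⟩ := Fin.exists_castSucc_eq.2 hlast
  have hgap := hs.1 l
  rw [hl] at hgap
  have hlt : s.topLayer u < l.succ := by rw [← hl]; exact Fin.castSucc_lt_succ
  constructor
  · have : ¬ s.level l.succ ≤ u := by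
      rw [← s.le_topLayer_iff hu]; exact not_le.2 hlt
    linarith [not_le.1 this]
  · intro v hv
    refine hlt.trans_le ((s.le_topLayer_iff ?_ _).2 (by linarith))
    linarith [s.level_nonneg l.succ]

/-- The power strictly above the cell of `u` has no closed form in `u`. Everything beyond `u + δ`
lies in a higher cell and everything in a higher cell lies beyond `u`, which squeezes it. -/
theorem sum_power_Ioi_bounds (hρ0 : ∀ u, 0 ≤ u → 0 ≤ ρ u) (hρ : IntegrableOn ρ (Set.Ioi 0))
    {δ A u : ℝ} (hδ : 0 ≤ δ) (hs : s.IsFine δ A) (hu : 0 < u) (huA : u < A) :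
    interference ρ (u + δ) ≤ ∑ i ∈ Finset.Ioi (s.topLayer u), s.power ρ i ∧
      ∑ i ∈ Finset.Ioi (s.topLayer u), s.power ρ i ≤ interference ρ u := by
  have hnn : ∀ t : Set ℝ, t ⊆ Set.Ioi 0 → MeasurableSet t → 0 ≤ᵐ[volume.restrict t] ρ :=
    fun t ht hm => (ae_restrict_iff' hm).2 (ae_of_all _ fun x hx => hρ0 x (le_of_lt (ht hx)))
  have hm : MeasurableSet (Set.Ioi 0 ∩ {v | s.topLayer v ∈ Finset.Ioi (s.topLayer u)}) :=
    measurableSet_Ioi.inter (s.measurable_topLayer (Finset.measurableSet _))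
  rw [s.sum_power hρ]
  constructor
  · refine setIntegral_mono_set (hρ.mono_set Set.inter_subset_left)
      (hnn _ Set.inter_subset_left hm) (LE.le.eventuallyLE fun v hv => ?_)
    have hv' : u + δ < v := hv
    refine ⟨show 0 < v by linarith, ?_⟩
    simp only [Finset.mem_Ioi, Set.mem_ofPred_eq]
    have := s.level_topLayer_le hu.le
    exact (s.lt_level_topLayer_add hs hu.le huA).2 v (by linarith)
  · refine setIntegral_mono_set (hρ.mono_set (Set.Ioi_subset_Ioi hu.le))
      (hnn _ (Set.Ioi_subset_Ioi hu.le) measurableSet_Ioi)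
      (LE.le.eventuallyLE fun v hv => ?_)
    simp only [Finset.mem_Ioi, Set.mem_inter_iff, Set.mem_ofPred_eq] at hv
    by_contra hc
    exact absurd (s.topLayer_mono (not_lt.1 hc)) (not_le.2 hv.2)

end Levels

/-! ### Convergence of the discretised gains to the reward -/

/-- The reward is the limit of lower bounds for the discretised secrecy gains. -/
theorem reward_le_liminf_secrecyGain {ρ : ℝ → ℝ} (hρ0 : ∀ u, 0 ≤ u → 0 ≤ ρ u)
    (hρ : IntegrableOn ρ (Set.Ioi 0)) (L : ℕ → ℕ) (s : (n : ℕ) → Levels (L n)) {δ A : ℕ → ℝ}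
    (hδ0 : ∀ n, 0 ≤ δ n) (hδ : Tendsto δ atTop (𝓝 0)) (hA : Tendsto A atTop atTop)
    (hs : ∀ n, (s n).IsFine (δ n) (A n)) {h₁ h₂ : ℝ} (hh₂ : 0 ≤ h₂) (hh : h₂ ≤ h₁) :
    ENNReal.ofReal (reward ρ h₁ h₂) ≤
      liminf (fun n => ENNReal.ofReal ((s n).secrecyGain ρ ((s n).topLayer h₁) h₂)) atTop := by
  have hh₁ : 0 ≤ h₁ := hh₂.trans hh
  set c : (n : ℕ) → Fin (L n + 1) → ℝ := fun n l =>
    (s n).level l / (1 + (s n).level l * ∑ i ∈ Finset.Ici l, (s n).power ρ i)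
      - h₂ / (1 + h₂ * ∑ i ∈ Finset.Ioi l, (s n).power ρ i) with hc
  set f : ℕ → ℝ → ℝ := fun n u =>
    if (s n).topLayer u ∈ (s n).hidden ((s n).topLayer h₁) h₂
      then c n ((s n).topLayer u) * ρ u else 0 with hf
  have hA_le : ∀ n, ∫ u in Set.Ioi 0, f n u ≤ (s n).secrecyGain ρ ((s n).topLayer h₁) h₂ := by
    intro n
    rw [← (s n).sum_mul_power hρ]
    exact (s n).sum_le_secrecyGain hρ0 _ hh₂
  set g : ℝ → ℝ := fun u => u * ρ u / (1 + u * interference ρ u)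
    - h₂ * ρ u / (1 + h₂ * interference ρ u) with hg
  have hreward : reward ρ h₁ h₂ = ∫ u in Set.Ioi 0, (Set.Ioc h₂ h₁).indicator g u := by
    rw [reward, intervalIntegral.integral_of_le hh, setIntegral_indicator measurableSet_Ioc,
      Set.inter_eq_right.2 fun u (hu : u ∈ Set.Ioc h₂ h₁) => Set.mem_Ioi.2 (hh₂.trans_lt hu.1)]
  have hmem : ∀ n u, 0 ≤ u → ((s n).topLayer u ∈ (s n).hidden ((s n).topLayer h₁) h₂ ↔
      (s n).level ((s n).topLayer u) ≤ h₁ ∧ h₂ < (s n).level ((s n).topLayer u)) := by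
    intro n u hu
    rw [Levels.mem_hidden, Levels.le_topLayer_iff _ hh₁]
  have hlim : Tendsto (fun n => ∫ u in Set.Ioi 0, f n u) atTop (𝓝 (reward ρ h₁ h₂)) := by
    rw [hreward]
    -- On the hidden layers the two nonnegative parts of the coefficient are at most `h₁` and `h₂`,
    -- so `(h₁ + h₂) ρ` dominates for every discretisation.
    refine tendsto_integral_of_dominated_convergence (fun u => (h₁ + h₂) * ρ u) ?_
      (hρ.const_mul _) ?_ ?_
    · intro n
      have e : f n = ((s n).topLayer ⁻¹' (s n).hidden ((s n).topLayer h₁) h₂).indicator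
          (fun u => c n ((s n).topLayer u) * ρ u) := by
        ext u
        simp only [hf]
        split_ifs with h <;> simp [h]
      rw [e]
      refine AEStronglyMeasurable.indicator ?_
        ((s n).measurable_topLayer (Finset.measurableSet _))
      exact ((Measurable.of_discrete (f := c n)).comp
        (s n).measurable_topLayer).aestronglyMeasurable.mul hρ.1
    · intro n
      refine (ae_restrict_iff' measurableSet_Ioi).2 (ae_of_all _ fun u hu => ?_)
      have hu0 : 0 ≤ u := le_of_lt hu
      have hρu := hρ0 u hu0
      simp only [hf]
      split_ifs with hif
      · rw [Real.norm_eq_abs, abs_mul, abs_of_nonneg hρu]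
        refine mul_le_mul_of_nonneg_right ?_ hρu
        have h1 := (hmem n u hu0).1 hif
        have hl := (s n).level_nonneg ((s n).topLayer u)
        have h2 := (s n).sum_power_nonneg hρ0 (Finset.Ici ((s n).topLayer u))
        have h3 := (s n).sum_power_nonneg hρ0 (Finset.Ioi ((s n).topLayer u))
        have b1 : (s n).level ((s n).topLayer u) / (1 + (s n).level ((s n).topLayer u) *
            ∑ i ∈ Finset.Ici ((s n).topLayer u), (s n).power ρ i) ≤ h₁ :=
          (div_le_self hl (by nlinarith)).trans h1.1
        have b2 : h₂ / (1 + h₂ * ∑ i ∈ Finset.Ioi ((s n).topLayer u), (s n).power ρ i) ≤ h₂ :=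
          div_le_self hh₂ (by nlinarith)
        have b3 : 0 ≤ (s n).level ((s n).topLayer u) / (1 + (s n).level ((s n).topLayer u) *
            ∑ i ∈ Finset.Ici ((s n).topLayer u), (s n).power ρ i) := by positivity
        have b4 : 0 ≤ h₂ / (1 + h₂ * ∑ i ∈ Finset.Ioi ((s n).topLayer u), (s n).power ρ i) := by
          positivity
        rw [abs_le]
        constructor <;> simp only [hc] <;> linarith
      · rw [norm_zero]; positivity
    -- The two ends of the interval of integration form a null set. Away from them, whether the cell
    -- of `u` is hidden is eventually decided by whether `u` lies in the interval.
    · have hne : ∀ a : ℝ, ∀ᵐ u ∂(volume.restrict (Set.Ioi (0 : ℝ))), u ≠ a := fun a =>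
        ae_restrict_of_ae (Measure.ae_ne volume a)
      filter_upwards [hne h₁, hne h₂, ae_restrict_mem measurableSet_Ioi] with u hu1 hu2 hu
      have hu : 0 < u := hu
      have hev : ∀ᶠ n in atTop, u < A n := hA.eventually_gt_atTop u
      have hlev : Tendsto (fun n => (s n).level ((s n).topLayer u)) atTop (𝓝 u) := by
        refine tendsto_of_tendsto_of_tendsto_of_le_of_le' (g := fun n => u - δ n) (h := fun _ => u)
          (by simpa using tendsto_const_nhds.sub hδ) tendsto_const_nhds ?_ ?_
        · filter_upwards [hev] with n hn
          linarith [((s n).lt_level_topLayer_add (hs n) hu.le hn).1]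
        · exact Eventually.of_forall fun n => (s n).level_topLayer_le hu.le
      by_cases hin : u ∈ Set.Ioc h₂ h₁
      · rw [Set.indicator_of_mem hin]
        have hev2 : ∀ᶠ n in atTop, (s n).topLayer u ∈ (s n).hidden ((s n).topLayer h₁) h₂ := by
          filter_upwards [hlev.eventually (eventually_gt_nhds hin.1)] with n hn
          exact (hmem n u hu.le).2 ⟨((s n).level_topLayer_le hu.le).trans hin.2, hn⟩
        have hcont := continuousOn_interference hρ
        have hI1 : Tendsto (fun n => ∑ i ∈ Finset.Ici ((s n).topLayer u), (s n).power ρ i) atTop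
            (𝓝 (interference ρ u)) := by
          simp only [Levels.sum_power_Ici _ hρ]
          exact (hcont u hu.le).tendsto.comp (tendsto_nhdsWithin_iff.2
            ⟨hlev, Eventually.of_forall fun n => (s n).level_nonneg _⟩)
        have hI2 : Tendsto (fun n => ∑ i ∈ Finset.Ioi ((s n).topLayer u), (s n).power ρ i) atTop
            (𝓝 (interference ρ u)) := by
          have : Tendsto (fun n => interference ρ (u + δ n)) atTop (𝓝 (interference ρ u)) := by
            refine (hcont u hu.le).tendsto.comp (tendsto_nhdsWithin_iff.2 ⟨?_, ?_⟩)
            · simpa using tendsto_const_nhds.add hδ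
            · exact Eventually.of_forall fun n => show (0 : ℝ) ≤ _ by linarith [hδ0 n]
          refine tendsto_of_tendsto_of_tendsto_of_le_of_le' this tendsto_const_nhds ?_ ?_
          · filter_upwards [hev] with n hn
            exact ((s n).sum_power_Ioi_bounds hρ0 hρ (hδ0 n) (hs n) hu hn).1
          · filter_upwards [hev] with n hn
            exact ((s n).sum_power_Ioi_bounds hρ0 hρ (hδ0 n) (hs n) hu hn).2
        have hI0 := interference_nonneg hρ0 hu.le
        have hlimc : Tendsto (fun n => c n ((s n).topLayer u) * ρ u) atTop (𝓝 (g u)) := by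
          have e : g u = (u / (1 + u * interference ρ u) - h₂ / (1 + h₂ * interference ρ u)) * ρ u := by
            simp only [hg]; ring
          rw [e]
          refine Tendsto.mul_const _ (Tendsto.sub ?_ ?_)
          · exact hlev.div (tendsto_const_nhds.add (hlev.mul hI1)) (by positivity)
          · exact tendsto_const_nhds.div (tendsto_const_nhds.add (tendsto_const_nhds.mul hI2))
              (by positivity)
        refine hlimc.congr' ?_
        filter_upwards [hev2] with n hn
        simp only [hf, if_pos hn]
      · rw [Set.indicator_of_notMem hin]
        refine tendsto_const_nhds.congr' ?_
        have hcase : u < h₂ ∨ h₁ < u := by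
          by_contra hcon
          push Not at hcon
          exact hin ⟨lt_of_le_of_ne hcon.1 (Ne.symm hu2), hcon.2⟩
        have hev2 : ∀ᶠ n in atTop, (s n).topLayer u ∉ (s n).hidden ((s n).topLayer h₁) h₂ := by
          rcases hcase with hlt | hgt
          · refine Eventually.of_forall fun n hn => ?_
            have := ((hmem n u hu.le).1 hn).2
            linarith [(s n).level_topLayer_le hu.le]
          · filter_upwards [hlev.eventually (eventually_gt_nhds hgt)] with n hn hn'
            linarith [((hmem n u hu.le).1 hn').1]
        filter_upwards [hev2] with n hn
        simp only [hf, if_neg hn]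
  have h1 : Tendsto (fun n => ENNReal.ofReal (∫ u in Set.Ioi 0, f n u)) atTop
      (𝓝 (ENNReal.ofReal (reward ρ h₁ h₂))) := ENNReal.tendsto_ofReal hlim
  rw [← h1.liminf_eq]
  exact liminf_le_liminf (Eventually.of_forall fun n => ENNReal.ofReal_le_ofReal (hA_le n))

/-- Fine discretisations lose an arbitrarily small part of the secrecy key rate. -/
theorem exists_fine_levels {ρ : ℝ → ℝ} (hρ0 : ∀ u, 0 ≤ u → 0 ≤ ρ u)
    (hρ : IntegrableOn ρ (Set.Ioi 0)) (μ₁ μ₂ : Measure ℝ) [IsProbabilityMeasure μ₁]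
    [IsProbabilityMeasure μ₂] {R ε : ℝ} (hε : 0 < ε)
    (hR : ENNReal.ofReal R ≤ secrecyKeyRate ρ μ₁ μ₂) :
    ∃ δ : ℝ, 0 < δ ∧ ∃ A : ℝ, ∀ (L : ℕ) (s : Levels L), s.IsFine δ A →
      ENNReal.ofReal (R - ε) ≤
        ∫⁻ h₁, ∫⁻ h₂, ENNReal.ofReal (s.secrecyGain ρ (s.topLayer h₁) h₂) ∂μ₂ ∂μ₁ := by
  -- Otherwise there are counterexamples with gaps at most `1 / (n + 1)` and top level at least `n`.
  -- Along this sequence Fatou, once for each gain, contradicts the limit bound.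
  by_contra hcon
  push Not at hcon
  have hpos : ∀ n : ℕ, (0 : ℝ) < 1 / ((n : ℝ) + 1) := fun n => Nat.one_div_pos_of_nat
  choose L s hs hlt using fun n : ℕ => hcon (1 / ((n : ℝ) + 1)) (hpos n) n
  have hmeas : ∀ n, Measurable fun p : ℝ × ℝ =>
      ENNReal.ofReal ((s n).secrecyGain ρ ((s n).topLayer p.1) p.2) := fun n =>
    (((s n).measurable_secrecyGain ρ).comp
      (((s n).measurable_topLayer.comp measurable_fst).prodMk measurable_snd)).ennreal_ofReal
  have hmeas₂ : ∀ n h₁, Measurable fun h₂ =>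
      ENNReal.ofReal ((s n).secrecyGain ρ ((s n).topLayer h₁) h₂) := fun n h₁ =>
    (((s n).measurable_secrecyGain ρ).comp measurable_prodMk_left).ennreal_ofReal
  have hle : secrecyKeyRate ρ μ₁ μ₂ ≤ liminf (fun n => ∫⁻ h₁, ∫⁻ h₂,
      ENNReal.ofReal ((s n).secrecyGain ρ ((s n).topLayer h₁) h₂) ∂μ₂ ∂μ₁) atTop := by
    refine le_trans ?_ (lintegral_liminf_le fun n => (hmeas n).lintegral_prod_right')
    rw [secrecyKeyRate, ← lintegral_indicator measurableSet_Ici]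
    refine lintegral_mono (Set.indicator_le fun h₁ hh₁ => ?_)
    refine le_trans ?_ (lintegral_liminf_le fun n => hmeas₂ n h₁)
    rw [← lintegral_indicator measurableSet_Icc]
    refine lintegral_mono (Set.indicator_le fun h₂ hh₂ => ?_)
    exact reward_le_liminf_secrecyGain hρ0 hρ L s (fun n => (hpos n).le)
      tendsto_one_div_add_atTop_nhds_zero_nat tendsto_natCast_atTop_atTop hs hh₂.1 hh₂.2
  have h2 : liminf (fun n => ∫⁻ h₁, ∫⁻ h₂,
      ENNReal.ofReal ((s n).secrecyGain ρ ((s n).topLayer h₁) h₂) ∂μ₂ ∂μ₁) atTop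
      ≤ ENNReal.ofReal (R - ε) := by
    refine liminf_le_of_le (by isBoundedDefault) fun b hb => ?_
    obtain ⟨n, hn⟩ := hb.exists
    exact hn.trans (hlt n).le
  have h3 := hR.trans (hle.trans h2)
  -- `ENNReal.ofReal` can only be inverted for positive arguments. A counterexample with `R - ε ≤ 0`
  -- would have an integral below zero.
  have h4 : 0 < R - ε := by
    by_contra hc
    have := hlt 0
    rw [ENNReal.ofReal_of_nonpos (not_lt.1 hc)] at this
    exact absurd this (by simp)
  rw [ENNReal.ofReal_le_ofReal_iff h4.le] at h3
  linarith

end LayeredKey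

end

noncomputable section

namespace LayeredKey

open scoped ENNReal NNReal Topology

/-! ### Equivocation of a random bin -/

section Equivocation

set_option linter.unusedSectionVars false

variable {Ω 𝒲 𝒱 κ : Type*} [MeasurableSpace Ω] [MeasurableSpace 𝒱]
  [Fintype 𝒲] [MeasurableSpace 𝒲] [MeasurableSingletonClass 𝒲]
  {μ : Measure Ω} [IsProbabilityMeasure μ] {W : Ω → 𝒲} {V : Ω → 𝒱}

/-- `π w v` is a version of the posterior probability of `W = w` given `V = v`. -/
structure IsPosterior (μ : Measure Ω) (W : Ω → 𝒲) (V : Ω → 𝒱) (π : 𝒲 → 𝒱 → ℝ) : Prop where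
  measurable : ∀ w, Measurable (π w)
  nonneg : ∀ w v, 0 ≤ π w v
  sum_le_one : ∀ v, ∑ w, π w v ≤ 1
  ae_eq : ∀ w, (fun ω => π w (V ω)) =ᵐ[μ]
    μ[(W ⁻¹' {w}).indicator (fun _ => (1 : ℝ)) | MeasurableSpace.comap V inferInstance]

variable {π : 𝒲 → 𝒱 → ℝ}

theorem IsPosterior.le_one (hπ : IsPosterior μ W V π) (w : 𝒲) (v : 𝒱) : π w v ≤ 1 :=
  (Finset.single_le_sum (f := fun w => π w v) (fun w _ => hπ.nonneg w v)
    (Finset.mem_univ w)).trans (hπ.sum_le_one v)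

/-- Splitting by the value of `W` leaves factors that depend on `V` only, and these come out of the
conditional expectation. -/
theorem condExp_sum_indicator_mul (hW : Measurable W) (hV : Measurable V)
    (hπ : IsPosterior μ W V π) {φ : 𝒲 → 𝒱 → ℝ} (hφ : ∀ w, Measurable (φ w)) {C : ℝ}
    (hC : ∀ w v, |φ w v| ≤ C) :
    μ[fun ω => φ (W ω) (V ω) | MeasurableSpace.comap V inferInstance] =ᵐ[μ]
      fun ω => ∑ w, φ w (V ω) * π w (V ω) := by
  classical
  set I : 𝒲 → Ω → ℝ := fun w => (W ⁻¹' {w}).indicator (fun _ => (1 : ℝ)) with hI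
  have hWm : ∀ w, MeasurableSet (W ⁻¹' {w}) := fun w => hW (measurableSet_singleton w)
  have e : (fun ω => φ (W ω) (V ω)) = ∑ w, (fun ω => φ w (V ω)) * I w := by
    ext ω
    simp only [Finset.sum_apply, Pi.mul_apply, hI]
    rw [Finset.sum_eq_single (W ω)]
    · simp
    · intro w _ hw
      have : ω ∉ W ⁻¹' {w} := fun h => hw h.symm
      simp [this]
    · simp
  have hIint : ∀ w, Integrable (I w) μ := fun w => (integrable_const 1).indicator (hWm w)
  have hφs : ∀ w, StronglyMeasurable[MeasurableSpace.comap V inferInstance]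
      (fun ω => φ w (V ω)) := fun w =>
    ((hφ w).comp (comap_measurable V)).stronglyMeasurable
  have hprod : ∀ w, Integrable ((fun ω => φ w (V ω)) * I w) μ := fun w =>
    (hIint w).bdd_mul ((hφ w).comp hV).aestronglyMeasurable (c := C)
      (ae_of_all _ fun ω => by simpa using hC w (V ω))
  rw [e]
  refine (condExp_finsetSum (fun w _ => hprod w) _).trans ?_
  have h1 : ∀ w, μ[(fun ω => φ w (V ω)) * I w | MeasurableSpace.comap V inferInstance] =ᵐ[μ]
      fun ω => φ w (V ω) * π w (V ω) := fun w => by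
    refine (condExp_mul_of_stronglyMeasurable_left (hφs w) (hprod w) (hIint w)).trans ?_
    filter_upwards [hπ.ae_eq w] with ω hω
    simp only [Pi.mul_apply]
    rw [hω]
  filter_upwards [ae_all_iff.2 h1] with ω hω
  simp only [Finset.sum_apply, hω]

/-- The tower property: a posterior average has the same mean as the function evaluated at the true
`W`. -/
theorem integral_sum_mul_posterior (hW : Measurable W) (hV : Measurable V)
    (hπ : IsPosterior μ W V π) {φ : 𝒲 → 𝒱 → ℝ} (hφ : ∀ w, Measurable (φ w)) {C : ℝ}
    (hC : ∀ w v, |φ w v| ≤ C) :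
    ∫ ω, ∑ w, φ w (V ω) * π w (V ω) ∂μ = ∫ ω, φ (W ω) (V ω) ∂μ := by
  rw [← integral_congr_ae (condExp_sum_indicator_mul hW hV hπ hφ hC)]
  exact integral_condExp hV.comap_le

theorem negMulLog_nonneg_le_one {x : ℝ} (h0 : 0 ≤ x) (h1 : x ≤ 1) :
    0 ≤ Real.negMulLog x ∧ Real.negMulLog x ≤ 1 := by
  refine ⟨Real.negMulLog_nonneg h0 h1, ?_⟩
  rcases h0.eq_or_lt with h | h
  · simp [← h]
  · have := Real.one_sub_inv_le_log_of_pos h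
    have h2 : x * (1 - x⁻¹) ≤ x * Real.log x := mul_le_mul_of_nonneg_left this h0
    rw [mul_sub, mul_inv_cancel₀ h.ne'] at h2
    rw [Real.negMulLog]
    linarith

/-- The probability of the bin of `w` given `v`. -/
def binPosterior [DecidableEq κ] (π : 𝒲 → 𝒱 → ℝ) (b : 𝒱 → 𝒲 → κ) (k : κ) (v : 𝒱) : ℝ :=
  ∑ w, if b v w = k then π w v else 0

variable [Fintype κ] [DecidableEq κ]

theorem binPosterior_nonneg (hπ : IsPosterior μ W V π) (b : 𝒱 → 𝒲 → κ) (k : κ) (v : 𝒱) :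
    0 ≤ binPosterior π b k v :=
  Finset.sum_nonneg fun w _ => by split_ifs; exacts [hπ.nonneg w v, le_rfl]

theorem binPosterior_le_one (hπ : IsPosterior μ W V π) (b : 𝒱 → 𝒲 → κ) (k : κ) (v : 𝒱) :
    binPosterior π b k v ≤ 1 :=
  (Finset.sum_le_sum fun w _ => by
    split_ifs; exacts [le_rfl, hπ.nonneg w v]).trans (hπ.sum_le_one v)

theorem measurable_binPosterior (hπ : IsPosterior μ W V π) {b : 𝒱 → 𝒲 → κ}
    (hb : ∀ w k, MeasurableSet {v | b v w = k}) (k : κ) : Measurable (binPosterior π b k) :=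
  Finset.measurable_sum _ fun w _ => (hπ.measurable w).ite (hb w k) measurable_const

/-- Lower bound for the equivocation of a bin, from the tangent of the logarithm at `a`. -/
theorem le_condEntropy_bin (hW : Measurable W) (hV : Measurable V) (hπ : IsPosterior μ W V π)
    {b : 𝒱 → 𝒲 → κ} (hb : ∀ w k, MeasurableSet {v | b v w = k})
    {G : 𝒲 → Set 𝒱} (hG : ∀ w, MeasurableSet (G w)) {a : ℝ} (ha : 0 < a) :
    μ.real {ω | V ω ∈ G (W ω)} * (1 - Real.log a)
      - (∫ ω, (G (W ω)).indicator (fun v => binPosterior π b (b v (W ω)) v) (V ω) ∂μ) / a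
      ≤ condEntropy μ (fun ω => b (V ω) (W ω)) V := by
  classical
  have hQ : ∀ w, Measurable fun v => binPosterior π b (b v w) v := by
    intro w
    have e : (fun v => binPosterior π b (b v w) v)
        = fun v => ∑ k, if b v w = k then binPosterior π b k v else 0 := by
      ext v; simp
    rw [e]
    exact Finset.measurable_sum _ fun k _ =>
      (measurable_binPosterior hπ hb k).ite (hb w k) measurable_const
  -- On the good event this is the tangent bound `-log Q ≥ 1 - log a - Q / a` for the bin
  -- probability `Q`. Elsewhere the trivial bound `-log Q ≥ 0` is enough.
  set φ : 𝒲 → 𝒱 → ℝ := fun w => (G w).indicator fun v =>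
    (1 - Real.log a) - binPosterior π b (b v w) v / a with hφ
  have hφm : ∀ w, Measurable (φ w) := fun w =>
    (measurable_const.sub ((hQ w).div_const a)).indicator (hG w)
  have hφC : ∀ w v, |φ w v| ≤ |1 - Real.log a| + 1 / a := by
    intro w v
    by_cases h : v ∈ G w
    · simp only [hφ, Set.indicator_of_mem h]
      refine (abs_sub _ _).trans (add_le_add le_rfl ?_)
      rw [abs_of_nonneg (div_nonneg (binPosterior_nonneg hπ _ _ _) ha.le)]
      exact div_le_div_of_nonneg_right (binPosterior_le_one hπ _ _ _) ha.le
    · simp only [hφ, Set.indicator_of_notMem h, abs_zero]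
      positivity
  have hcond : ∀ k, μ[((fun ω => b (V ω) (W ω)) ⁻¹' {k}).indicator (fun _ => (1 : ℝ)) |
      MeasurableSpace.comap V inferInstance] =ᵐ[μ] fun ω => binPosterior π b k (V ω) := by
    intro k
    have h1 := condExp_sum_indicator_mul hW hV hπ
      (φ := fun w v => if b v w = k then (1 : ℝ) else 0) (C := 1)
      (fun w => Measurable.ite (hb w k) measurable_const measurable_const)
      (fun w v => by split_ifs <;> simp)
    have e : ((fun ω => b (V ω) (W ω)) ⁻¹' {k}).indicator (fun _ => (1 : ℝ))
        = fun ω => if b (V ω) (W ω) = k then (1 : ℝ) else 0 := by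
      ext ω
      by_cases h : b (V ω) (W ω) = k <;> simp [h]
    rw [e]
    refine h1.trans (ae_of_all _ fun ω => ?_)
    simp [binPosterior]
  have hent : condEntropy μ (fun ω => b (V ω) (W ω)) V
      = ∫ ω, ∑ k, Real.negMulLog (binPosterior π b k (V ω)) ∂μ := by
    refine integral_congr_ae ?_
    filter_upwards [ae_all_iff.2 hcond] with ω hω
    simp only [hω]
  have hpt : ∀ v, ∑ w, φ w v * π w v ≤ ∑ k, Real.negMulLog (binPosterior π b k v) := by
    intro v
    -- The entropy over bins is rewritten as a posterior average over messages of the surprisal of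
    -- their bin, so it can be compared message by message.
    have e : ∑ k, Real.negMulLog (binPosterior π b k v)
        = ∑ w, -Real.log (binPosterior π b (b v w) v) * π w v := by
      have h1 : ∀ k, Real.negMulLog (binPosterior π b k v)
          = ∑ w, if b v w = k then -Real.log (binPosterior π b k v) * π w v else 0 := by
        intro k
        rw [Real.negMulLog]
        generalize Real.log (binPosterior π b k v) = c
        rw [binPosterior, neg_mul, Finset.sum_mul, ← Finset.sum_neg_distrib]
        refine Finset.sum_congr rfl fun w _ => ?_
        split_ifs
        · ring
        · simp
      simp only [h1]
      rw [Finset.sum_comm]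
      simp
    rw [e]
    refine Finset.sum_le_sum fun w _ => ?_
    rcases (hπ.nonneg w v).eq_or_lt with h | h
    · simp [← h]
    · refine mul_le_mul_of_nonneg_right ?_ h.le
      -- A message of positive posterior makes its bin probability positive, so the logarithm is
      -- genuine.
      have hle : π w v ≤ binPosterior π b (b v w) v := by
        have := Finset.single_le_sum (f := fun w' => if b v w' = b v w then π w' v else 0)
          (fun w' _ => by split_ifs; exacts [hπ.nonneg w' v, le_rfl]) (Finset.mem_univ w)
        simpa [binPosterior] using this
      have hpos : 0 < binPosterior π b (b v w) v := h.trans_le hle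
      by_cases hv : v ∈ G w
      · simp only [hφ, Set.indicator_of_mem hv]
        have h2 := Real.log_le_sub_one_of_pos (div_pos hpos ha)
        rw [Real.log_div hpos.ne' ha.ne'] at h2
        linarith
      · simp only [hφ, Set.indicator_of_notMem hv]
        linarith [Real.log_nonpos hpos.le (binPosterior_le_one hπ b (b v w) v)]
  have hρi : Integrable (fun ω => ∑ k, Real.negMulLog (binPosterior π b k (V ω))) μ := by
    refine integrable_finsetSum _ fun k _ => Integrable.of_bound (C := 1) ?_ (ae_of_all _ fun ω => ?_)
    · exact (Real.continuous_negMulLog.measurable.comp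
        ((measurable_binPosterior hπ hb k).comp hV)).aestronglyMeasurable
    · have := negMulLog_nonneg_le_one (binPosterior_nonneg hπ b k (V ω))
        (binPosterior_le_one hπ b k (V ω))
      rw [Real.norm_eq_abs, abs_of_nonneg this.1]
      exact this.2
  have hint2 : Integrable (fun ω => ∑ w, φ w (V ω) * π w (V ω)) μ := by
    refine integrable_finsetSum _ fun w _ => Integrable.of_bound (C := |1 - Real.log a| + 1 / a)
      (((hφm w).comp hV).mul ((hπ.measurable w).comp hV)).aestronglyMeasurable
      (ae_of_all _ fun ω => ?_)
    rw [Real.norm_eq_abs, abs_mul, abs_of_nonneg (hπ.nonneg _ _)]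
    exact (mul_le_of_le_one_right (abs_nonneg _) (hπ.le_one _ _)).trans (hφC _ _)
  have hGm : MeasurableSet {ω | V ω ∈ G (W ω)} := by
    have : {ω | V ω ∈ G (W ω)} = ⋃ w, (W ⁻¹' {w} ∩ V ⁻¹' G w) := by
      ext ω; simp
    rw [this]
    exact MeasurableSet.iUnion fun w => (hW (measurableSet_singleton w)).inter (hV (hG w))
  have hint3 : Integrable (fun ω =>
      (G (W ω)).indicator (fun v => binPosterior π b (b v (W ω)) v) (V ω)) μ := by
    refine Integrable.of_bound (C := 1) ?_ (ae_of_all _ fun ω => ?_)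
    · have hm : Measurable fun p : 𝒲 × 𝒱 =>
          (G p.1).indicator (fun v => binPosterior π b (b v p.1) v) p.2 :=
        measurable_from_prod_countable_right fun w => (hQ w).indicator (hG w)
      exact (hm.comp (hW.prodMk hV)).aestronglyMeasurable
    · by_cases h : V ω ∈ G (W ω)
      · rw [Set.indicator_of_mem h, Real.norm_eq_abs, abs_of_nonneg (binPosterior_nonneg hπ _ _ _)]
        exact binPosterior_le_one hπ _ _ _
      · rw [Set.indicator_of_notMem h]; simp
  rw [hent]
  refine le_trans (le_of_eq ?_) (integral_mono hint2 hρi fun ω => hpt (V ω))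
  rw [integral_sum_mul_posterior hW hV hπ hφm hφC]
  have e : ∀ ω, φ (W ω) (V ω) = {ω | V ω ∈ G (W ω)}.indicator (fun _ => 1 - Real.log a) ω
      - (G (W ω)).indicator (fun v => binPosterior π b (b v (W ω)) v) (V ω) / a := by
    intro ω
    by_cases h : V ω ∈ G (W ω)
    · have h' : ω ∈ {ω | V ω ∈ G (W ω)} := h
      simp only [hφ, Set.indicator_of_mem h, Set.indicator_of_mem h']
    · have h' : ω ∉ {ω | V ω ∈ G (W ω)} := h
      simp only [hφ, Set.indicator_of_notMem h, Set.indicator_of_notMem h', zero_div, sub_zero]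
  simp only [e]
  rw [integral_sub ((integrable_const _).indicator hGm) (hint3.div_const a), integral_div,
    integral_indicator hGm, setIntegral_const, smul_eq_mul]

/-- If the posterior probability of the class of `W` is at most `p` on the good event, then some bin
function of a universal family has a large equivocation. -/
theorem exists_bin_le_condEntropy {𝓑 : Type*} [Fintype 𝓑] [Nonempty 𝓑] (hW : Measurable W)
    (hV : Measurable V) (hπ : IsPosterior μ W V π) (b : 𝓑 → 𝒱 → 𝒲 → κ)
    (hb : ∀ β w k, MeasurableSet {v | b β v w = k}) (same : 𝒱 → 𝒲 → 𝒲 → Prop)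
    [∀ v w w', Decidable (same v w w')] {c : ℕ} (hc : 0 < c)
    (hcount : ∀ v w w', ¬ same v w w' →
      (Finset.univ.filter fun β => b β v w' = b β v w).card * c ≤ Fintype.card 𝓑)
    {G : 𝒲 → Set 𝒱} (hG : ∀ w, MeasurableSet (G w)) {p : ℝ} (hp : 0 ≤ p)
    (hGp : ∀ w, ∀ v ∈ G w, (∑ w', if same v w w' then π w' v else 0) ≤ p) :
    ∃ β, μ.real {ω | V ω ∈ G (W ω)} * (1 - Real.log (p + 1 / c)) - 1
      ≤ condEntropy μ (fun ω => b β (V ω) (W ω)) V := by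
  classical
  have hc' : (0 : ℝ) < c := by exact_mod_cast hc
  have ha : 0 < p + 1 / (c : ℝ) := by positivity
  set J : 𝓑 → Ω → ℝ := fun β ω =>
    (G (W ω)).indicator (fun v => binPosterior π (b β) (b β v (W ω)) v) (V ω) with hJ
  have hJint : ∀ β, Integrable (J β) μ := by
    intro β
    have hQ : ∀ w, Measurable fun v => binPosterior π (b β) (b β v w) v := by
      intro w
      have e : (fun v => binPosterior π (b β) (b β v w) v)
          = fun v => ∑ k, if b β v w = k then binPosterior π (b β) k v else 0 := by
        ext v; simp
      rw [e]
      exact Finset.measurable_sum _ fun k _ =>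
        (measurable_binPosterior hπ (hb β) k).ite (hb β w k) measurable_const
    refine Integrable.of_bound (C := 1) ?_ (ae_of_all _ fun ω => ?_)
    · have hm : Measurable fun p : 𝒲 × 𝒱 =>
          (G p.1).indicator (fun v => binPosterior π (b β) (b β v p.1) v) p.2 :=
        measurable_from_prod_countable_right fun w => (hQ w).indicator (hG w)
      exact (hm.comp (hW.prodMk hV)).aestronglyMeasurable
    · by_cases h : V ω ∈ G (W ω)
      · simp only [hJ]
        rw [Set.indicator_of_mem h, Real.norm_eq_abs, abs_of_nonneg (binPosterior_nonneg hπ _ _ _)]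
        exact binPosterior_le_one hπ _ _ _
      · simp only [hJ]
        rw [Set.indicator_of_notMem h]; simp
  -- Averaged over the family, the messages in the class of the true one contribute at most `p`. Any
  -- other message shares the true bin for a fraction at most `1 / c` of the functions.
  have hsum : ∀ ω, ∑ β, J β ω ≤ Fintype.card 𝓑 * (p + 1 / c) := by
    intro ω
    by_cases h : V ω ∈ G (W ω)
    · simp only [hJ, Set.indicator_of_mem h, binPosterior]
      rw [Finset.sum_comm]
      have h1 : ∀ w', (∑ β, if b β (V ω) w' = b β (V ω) (W ω) then π w' (V ω) else 0)
          ≤ Fintype.card 𝓑 * ((if same (V ω) (W ω) w' then π w' (V ω) else 0)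
            + π w' (V ω) * (1 / c)) := by
        intro w'
        have hπ0 := hπ.nonneg w' (V ω)
        rw [← Finset.sum_filter, Finset.sum_const, nsmul_eq_mul]
        by_cases hs : same (V ω) (W ω) w'
        · rw [if_pos hs]
          have : ((Finset.univ.filter fun β => b β (V ω) w' = b β (V ω) (W ω)).card : ℝ)
              ≤ Fintype.card 𝓑 := by exact_mod_cast Finset.card_le_univ _
          have h3 : 0 ≤ (Fintype.card 𝓑 : ℝ) * (π w' (V ω) * (1 / c)) := by positivity
          nlinarith
        · rw [if_neg hs, zero_add]
          have h2 : ((Finset.univ.filter fun β => b β (V ω) w' = b β (V ω) (W ω)).card : ℝ) * c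
              ≤ Fintype.card 𝓑 := by exact_mod_cast hcount _ _ _ hs
          rw [← le_div_iff₀ hc'] at h2
          calc _ ≤ (Fintype.card 𝓑 / c : ℝ) * π w' (V ω) := mul_le_mul_of_nonneg_right h2 hπ0
            _ = _ := by ring
      refine (Finset.sum_le_sum fun w' _ => h1 w').trans ?_
      rw [← Finset.mul_sum, Finset.sum_add_distrib, ← Finset.sum_mul]
      refine mul_le_mul_of_nonneg_left (add_le_add (hGp _ _ h) ?_) (by positivity)
      exact mul_le_of_le_one_left (by positivity) (hπ.sum_le_one _)
    · simp only [hJ, Set.indicator_of_notMem h, Finset.sum_const_zero]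
      positivity
  -- Some member is no worse than the average. Taking the tangent point `a = p + 1 / c` then makes
  -- the subtracted term at most one.
  have hex : ∃ β, ∫ ω, J β ω ∂μ ≤ p + 1 / c := by
    by_contra hcon
    push Not at hcon
    have h1 : ∑ _β : 𝓑, (p + 1 / (c : ℝ)) < ∑ β, ∫ ω, J β ω ∂μ :=
      Finset.sum_lt_sum_of_nonempty Finset.univ_nonempty fun β _ => hcon β
    rw [← integral_finsetSum _ fun β _ => hJint β] at h1
    have h2 : ∫ ω, ∑ β, J β ω ∂μ ≤ Fintype.card 𝓑 * (p + 1 / c) := by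
      refine (integral_mono (integrable_finsetSum _ fun β _ => hJint β) (integrable_const _)
        hsum).trans_eq ?_
      simp
    simp only [Finset.sum_const, Finset.card_univ, nsmul_eq_mul] at h1
    exact absurd h2 (not_le.2 h1)
  obtain ⟨β, hβ⟩ := hex
  refine ⟨β, le_trans ?_ (le_condEntropy_bin hW hV hπ (hb β) hG ha)⟩
  exact sub_le_sub_left ((div_le_one ha).2 hβ) _

/-- The posterior probabilities from densities of the observation. -/
theorem isPosterior_of_density (hW : Measurable W) (hV : Measurable V) {ν : Measure 𝒱}
    {f : 𝒲 → 𝒱 → ℝ} (hf : ∀ w, Measurable (f w)) (hf0 : ∀ w v, 0 ≤ f w v)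
    (hlaw : ∀ w, (μ.restrict (W ⁻¹' {w})).map V
      = ν.withDensity fun v => ENNReal.ofReal (f w v)) :
    IsPosterior μ W V fun w v => f w v / ∑ w', f w' v := by
  classical
  have hF : Measurable fun v => ∑ w', f w' v := Finset.measurable_sum _ fun w _ => hf w
  have hF0 : ∀ v, 0 ≤ ∑ w', f w' v := fun v => Finset.sum_nonneg fun w _ => hf0 w v
  have hm : ∀ w, Measurable fun v => f w v / ∑ w', f w' v := fun w => (hf w).div hF
  have h0 : ∀ w v, 0 ≤ f w v / ∑ w', f w' v := fun w v => div_nonneg (hf0 w v) (hF0 v)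
  have h1 : ∀ w v, f w v / ∑ w', f w' v ≤ 1 := fun w v =>
    div_le_one_of_le₀ (Finset.single_le_sum (f := fun w => f w v) (fun w _ => hf0 w v)
      (Finset.mem_univ w)) (hF0 v)
  refine ⟨hm, h0, fun v => ?_, fun w => ?_⟩
  · rw [← Finset.sum_div]
    exact div_self_le_one _
  have hWm : ∀ w, MeasurableSet (W ⁻¹' {w}) := fun w => hW (measurableSet_singleton w)
  have e1 : ∀ w B, MeasurableSet B →
      μ (W ⁻¹' {w} ∩ V ⁻¹' B) = ∫⁻ v in B, ENNReal.ofReal (f w v) ∂ν := fun w B hB => by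
    rw [← withDensity_apply _ hB, ← hlaw, Measure.map_apply hV hB,
      Measure.restrict_apply (hV hB), Set.inter_comm]
  -- The law of the observation is the mixture over messages, so the candidate is Bayes' formula.
  have hmap : μ.map V = ν.withDensity fun v => ENNReal.ofReal (∑ w, f w v) := by
    ext B hB
    have h2 := sum_measure_preimage_singleton (μ := μ.restrict (V ⁻¹' B)) (f := W) Finset.univ
      fun w _ => hWm w
    rw [Finset.coe_univ, Set.preimage_univ, Measure.restrict_apply_univ] at h2
    rw [Measure.map_apply hV hB, ← h2, withDensity_apply _ hB]
    simp only [ENNReal.ofReal_sum_of_nonneg fun w _ => hf0 w _]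
    rw [lintegral_finsetSum _ fun w _ => (hf w).ennreal_ofReal]
    refine Finset.sum_congr rfl fun w _ => ?_
    rw [Measure.restrict_apply (hWm w), e1 w B hB]
  have hposint : ∀ B, MeasurableSet B → ∫⁻ ω in V ⁻¹' B, ENNReal.ofReal (f w (V ω) / ∑ w', f w' (V ω)) ∂μ
      = μ (W ⁻¹' {w} ∩ V ⁻¹' B) := by
    intro B hB
    rw [e1 w B hB, ← setLIntegral_map hB (hm w).ennreal_ofReal hV, hmap,
      setLIntegral_withDensity_eq_setLIntegral_mul _ hF.ennreal_ofReal (hm w).ennreal_ofReal hB]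
    refine setLIntegral_congr_fun hB fun v _ => ?_
    simp only [Pi.mul_apply]
    rw [← ENNReal.ofReal_mul (hF0 v)]
    congr 1
    -- Where the total density vanishes every summand does, so division by zero does no harm.
    rcases (hF0 v).eq_or_lt with h | h
    · have : f w v = 0 := (Finset.sum_eq_zero_iff_of_nonneg fun w _ => hf0 w v).1 h.symm w
        (Finset.mem_univ w)
      rw [← h, this]; simp
    · field_simp
  have hbd : Integrable (fun ω => f w (V ω) / ∑ w', f w' (V ω)) μ :=
    Integrable.of_bound (C := 1) ((hm w).comp hV).aestronglyMeasurable (ae_of_all _ fun ω => by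
      rw [Real.norm_eq_abs, abs_of_nonneg (h0 w _)]; exact h1 w _)
  refine ae_eq_condExp_of_forall_setIntegral_eq hV.comap_le
    ((integrable_const (1 : ℝ)).indicator (hWm w)) (fun _ _ _ => hbd.integrableOn) ?_ ?_
  · rintro _ ⟨B, hB, rfl⟩ _
    rw [integral_eq_lintegral_of_nonneg_ae (ae_of_all _ fun ω => h0 w _)
      ((hm w).comp hV).aestronglyMeasurable, hposint B hB, integral_indicator (hWm w),
      setIntegral_const, Measure.real, Measure.restrict_apply (hWm w)]
    simp
  · exact ((hm w).comp (comap_measurable V)).aestronglyMeasurable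

end Equivocation

end LayeredKey

end

noncomputable section

namespace LayeredKey

open scoped ENNReal NNReal Topology

/-! ### Random codebooks -/

/-- The equal and the unequal case are written as one image of `γ.prod γ`, so that in
`lintegral_book_pair` all layers can be treated at once whatever their pattern of agreement. -/
theorem map_eval_pair {α : Type*} [MeasurableSpace α] (γ : Measure α) [IsProbabilityMeasure γ]
    {n : ℕ} (i j : Fin n) :
    (Measure.pi fun _ : Fin n => γ).map (fun y => (y i, y j))
      = (γ.prod γ).map (fun p => (p.1, if i = j then p.1 else p.2)) := by
  have hev : ∀ i : Fin n, (Measure.pi fun _ : Fin n => γ).map (fun y => y i) = γ := fun i =>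
    (measurePreserving_eval (fun _ : Fin n => γ) i).map_eq
  by_cases hij : i = j
  · subst hij
    simp only [if_true]
    have h1 : (fun y : Fin n → α => (y i, y i)) = (fun a : α => (a, a)) ∘ fun y => y i := rfl
    have h2 : (fun p : α × α => (p.1, p.1)) = (fun a : α => (a, a)) ∘ Prod.fst := rfl
    rw [h1, h2, ← Measure.map_map (by fun_prop) (by fun_prop),
      ← Measure.map_map (by fun_prop) (by fun_prop), hev, Measure.map_fst_prod]
    simp
  · simp only [if_neg hij]
    have hind : IndepFun (fun y : Fin n → α => y i) (fun y => y j) (Measure.pi fun _ => γ) :=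
      (iIndepFun_pi (X := fun _ : Fin n => (id : α → α)) fun _ => aemeasurable_id).indepFun hij
    rw [(indepFun_iff_map_prod_eq_prod_map_map (measurable_pi_apply i).aemeasurable
      (measurable_pi_apply j).aemeasurable).1 hind, hev, hev]
    exact Measure.map_id.symm

variable {L : ℕ}

/-- Unscaled codebooks: a block for every message of every layer. -/
abbrev Book (sz : Fin (L + 1) → ℕ) (N : ℕ) : Type := (l : Fin (L + 1)) → Fin (sz l) → Fin N → ℂ

/-- The law of codebooks with independent standard complex Gaussian entries. -/
def bookLaw (sz : Fin (L + 1) → ℕ) (N : ℕ) : Measure (Book sz N) :=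
  Measure.pi fun _ => Measure.pi fun _ => gaussBlock N 1

instance (sz : Fin (L + 1) → ℕ) (N : ℕ) : IsProbabilityMeasure (bookLaw sz N) := by
  unfold bookLaw; infer_instance

/-- The law of independent standard complex Gaussian blocks, one for each layer. -/
def layerLaw (L N : ℕ) : Measure (Fin (L + 1) → Fin N → ℂ) := Measure.pi fun _ => gaussBlock N 1

instance (L N : ℕ) : IsProbabilityMeasure (layerLaw L N) := by
  unfold layerLaw; infer_instance

/-- The blocks selected by the messages `w`. -/
def pick {sz : Fin (L + 1) → ℕ} {N : ℕ} (x : Book sz N) (w : (l : Fin (L + 1)) → Fin (sz l)) :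
    Fin (L + 1) → Fin N → ℂ := fun l => x l (w l)

@[fun_prop]
theorem measurable_pick {sz : Fin (L + 1) → ℕ} {N : ℕ} (w : (l : Fin (L + 1)) → Fin (sz l)) :
    Measurable fun x : Book sz N => pick x w := by
  unfold pick; fun_prop

/-- The blocks of two message tuples agree where the messages agree and are independent elsewhere. -/
theorem lintegral_book_pair (sz : Fin (L + 1) → ℕ) (N : ℕ) (w w' : (l : Fin (L + 1)) → Fin (sz l))
    {F : (Fin (L + 1) → Fin N → ℂ) × (Fin (L + 1) → Fin N → ℂ) → ℝ≥0∞} (hF : Measurable F) :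
    ∫⁻ x, F (pick x w, pick x w') ∂(bookLaw sz N)
      = ∫⁻ p, F (p.1, fun l => if w l = w' l then p.1 l else p.2 l)
        ∂((layerLaw L N).prod (layerLaw L N)) := by
  set γ := gaussBlock N 1
  let k : (l : Fin (L + 1)) → (Fin N → ℂ) × (Fin N → ℂ) → (Fin N → ℂ) × (Fin N → ℂ) :=
    fun l p => (p.1, if w l = w' l then p.1 else p.2)
  have hk : ∀ l, Measurable (k l) := fun l => by
    by_cases h : w l = w' l
    · simp only [k, if_pos h]; fun_prop
    · simp only [k, if_neg h]; fun_prop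
  let e := MeasurableEquiv.arrowProdEquivProdArrow (Fin N → ℂ) (Fin N → ℂ) (Fin (L + 1))
  have he : MeasurePreserving e (Measure.pi fun _ => γ.prod γ)
      ((layerLaw L N).prod (layerLaw L N)) :=
    measurePreserving_arrowProdEquivProdArrow _ _ _ (fun _ => γ) (fun _ => γ)
  -- Layers are independent, so the joint law of the two selections is the product of the laws per
  -- layer.
  have hmap : (bookLaw sz N).map (fun x l => (x l (w l), x l (w' l)))
      = (Measure.pi fun _ : Fin (L + 1) => γ.prod γ).map (fun y l => k l (y l)) := by
    rw [Measure.pi_map_pi (fun l => (hk l).aemeasurable)]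
    simp only [k, ← map_eval_pair]
    exact Measure.pi_map_pi (f := fun l (y : Fin (sz l) → Fin N → ℂ) => (y (w l), y (w' l)))
      (fun l => by fun_prop)
  have h1 : ∫⁻ x, F (pick x w, pick x w') ∂(bookLaw sz N)
      = ∫⁻ y, F (e y) ∂((bookLaw sz N).map (fun x l => (x l (w l), x l (w' l)))) := by
    rw [lintegral_map (f := fun y => F (e y)) (hF.comp e.measurable) (by fun_prop)]
    rfl
  have hkm : Measurable fun (y : Fin (L + 1) → (Fin N → ℂ) × (Fin N → ℂ)) l => k l (y l) :=
    measurable_pi_lambda _ fun l => (hk l).comp (measurable_pi_apply l)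
  rw [h1, hmap, lintegral_map (f := fun y => F (e y)) (hF.comp e.measurable) hkm, ← he.symm.lintegral_comp
    (f := fun y => F (e fun l => k l (y l))) ((hF.comp e.measurable).comp hkm)]
  rfl

theorem lintegral_book_pick (sz : Fin (L + 1) → ℕ) (N : ℕ) (w : (l : Fin (L + 1)) → Fin (sz l))
    {F : (Fin (L + 1) → Fin N → ℂ) → ℝ≥0∞} (hF : Measurable F) :
    ∫⁻ x, F (pick x w) ∂(bookLaw sz N) = ∫⁻ a, F a ∂(layerLaw L N) := by
  have h := lintegral_book_pair sz N w w (F := fun p => F p.1) (hF.comp measurable_fst)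
  rw [h, lintegral_prod _ (by fun_prop)]
  simp

/-! ### Superpositions -/

variable {N : ℕ} (q : Fin (L + 1) → ℝ≥0)

/-- The superposition of the layers in `T`, layer `l` having power `q l`. -/
def superpose (T : Finset (Fin (L + 1))) (a : Fin (L + 1) → Fin N → ℂ) : Fin N → ℂ :=
  fun i => ∑ l ∈ T, ((Real.sqrt (q l) : ℝ) : ℂ) * a l i

/-- What is received at gain `h` when the layers in `T` are sent. -/
def recv (h : ℝ) (T : Finset (Fin (L + 1))) (a : Fin (L + 1) → Fin N → ℂ) (z : Fin N → ℂ) :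
    Fin N → ℂ := fun i => ((Real.sqrt h : ℝ) : ℂ) * superpose q T a i + z i

/-- The variance of the received samples. -/
def recvVar (h : ℝ) (T : Finset (Fin (L + 1))) : ℝ≥0 := 1 + h.toNNReal * ∑ l ∈ T, q l

theorem recvVar_pos (h : ℝ) (T : Finset (Fin (L + 1))) : 0 < recvVar q h T := by
  unfold recvVar; positivity

theorem recvVar_pos' (h : ℝ) (T : Finset (Fin (L + 1))) : (0 : ℝ) < recvVar q h T := by
  exact_mod_cast recvVar_pos q h T

theorem coe_recvVar {h : ℝ} (hh : 0 ≤ h) (T : Finset (Fin (L + 1))) :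
    (recvVar q h T : ℝ) = 1 + h * ∑ l ∈ T, (q l : ℝ) := by
  simp [recvVar, hh]

@[fun_prop]
theorem measurable_superpose (T : Finset (Fin (L + 1))) :
    Measurable (superpose q T : (Fin (L + 1) → Fin N → ℂ) → Fin N → ℂ) := by
  unfold superpose; fun_prop

@[fun_prop]
theorem measurable_recv (T : Finset (Fin (L + 1))) {α : Type*} [MeasurableSpace α] {f : α → ℝ}
    {a : α → Fin (L + 1) → Fin N → ℂ} {z : α → Fin N → ℂ} (hf : Measurable f) (ha : Measurable a)
    (hz : Measurable z) : Measurable fun t => recv q (f t) T (a t) (z t) := by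
  unfold recv superpose
  fun_prop

@[fun_prop]
theorem measurable_recvVar (T : Finset (Fin (L + 1))) :
    Measurable fun h => (recvVar q h T : ℝ) := by
  unfold recvVar; fun_prop

theorem superpose_congr {T : Finset (Fin (L + 1))} {a b : Fin (L + 1) → Fin N → ℂ}
    (h : ∀ l ∈ T, a l = b l) : superpose q T a = superpose q T b := by
  ext i
  exact Finset.sum_congr rfl fun l hl => by rw [h l hl]

theorem recv_sub_superpose (h : ℝ) {S T : Finset (Fin (L + 1))} (hST : Disjoint S T)
    (a : Fin (L + 1) → Fin N → ℂ) (z : Fin N → ℂ) :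
    (fun i => recv q h (S ∪ T) a z i - ((Real.sqrt h : ℝ) : ℂ) * superpose q S a i)
      = recv q h T a z := by
  ext i
  simp only [recv, superpose, Finset.sum_union hST]
  ring

/-- A superposition of independent Gaussian blocks received in Gaussian noise is Gaussian. -/
theorem map_superpose (T : Finset (Fin (L + 1))) (c : ℝ≥0) :
    (layerLaw L N).map (fun a i => ((Real.sqrt c : ℝ) : ℂ) * superpose q T a i)
      = gaussBlock N (c * ∑ l ∈ T, q l) := by
  set X : Fin (L + 1) → (Fin (L + 1) → Fin N → ℂ) → Fin N → ℂ := fun l a i =>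
    ((NNReal.sqrt (c * q l) : ℝ) : ℂ) * a l i with hX
  have hXm : ∀ l, Measurable (X l) := fun l => by simp only [hX]; fun_prop
  have hind : iIndepFun X (layerLaw L N) :=
    iIndepFun_pi (X := fun l (y : Fin N → ℂ) i => ((NNReal.sqrt (c * q l) : ℝ) : ℂ) * y i)
      fun l => Measurable.aemeasurable (by fun_prop)
  have hlaw : ∀ l, (layerLaw L N).map (X l) = gaussBlock N (c * q l) := by
    intro l
    have h1 := gaussBlock_map_mul N 1 (NNReal.sqrt (c * q l))
    rw [NNReal.sq_sqrt, mul_one,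
      ← (measurePreserving_eval (fun _ : Fin (L + 1) => gaussBlock N 1) l).map_eq,
      Measure.map_map (by fun_prop) (by fun_prop)] at h1
    exact h1
  have h := map_sum_gaussBlock hXm hind _ hlaw T
  rw [Finset.mul_sum, ← h]
  congr 1
  ext a i
  simp only [superpose, hX, Finset.sum_apply, Finset.mul_sum]
  refine Finset.sum_congr rfl fun l _ => ?_
  rw [← mul_assoc, NNReal.sqrt_mul]
  simp

theorem map_recv (h : ℝ) (T : Finset (Fin (L + 1))) :
    ((layerLaw L N).prod (gaussBlock N 1)).map (fun p => recv q h T p.1 p.2)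
      = gaussBlock N (recvVar q h T) := by
  have h1 := map_superpose (N := N) q T h.toNNReal
  -- Both `Real.sqrt` and `Real.toNNReal` vanish on negative gains, so no sign condition is needed.
  have e : Real.sqrt h = Real.sqrt h.toNNReal := by
    rcases le_total 0 h with hh | hh
    · simp [hh]
    · simp [Real.toNNReal_of_nonpos hh, Real.sqrt_eq_zero_of_nonpos hh]
  rw [recvVar, add_comm 1 (_ * _), ← gaussBlock_conv, ← h1, Measure.conv]
  conv_rhs => rw [← Measure.map_id (μ := gaussBlock N 1)]
  rw [Measure.map_prod_map _ _ (by fun_prop) (by fun_prop),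
    Measure.map_map (by fun_prop) (by fun_prop)]
  congr 1
  ext p i
  simp [recv, e]

/-! ### Densities and likelihood ratios -/

theorem lintegral_gaussBlock {v : ℝ≥0} (hv : 0 < v) {F : (Fin N → ℂ) → ℝ≥0∞} (hF : Measurable F) :
    ∫⁻ y, F y ∂(gaussBlock N v) = ∫⁻ y, ENNReal.ofReal (blockDensity v y) * F y := by
  rw [gaussBlock_eq_withDensity N hv, lintegral_withDensity_eq_lintegral_mul _ ?_ hF]
  · rfl
  · exact (measurable_blockDensity.comp (measurable_const.prodMk measurable_id)).ennreal_ofReal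

theorem lintegral_blockDensity {v : ℝ≥0} (hv : 0 < v) :
    ∫⁻ y : Fin N → ℂ, ENNReal.ofReal (blockDensity v y) = 1 := by
  have := lintegral_gaussBlock (N := N) hv (F := fun _ => 1) measurable_const
  simpa using this.symm

theorem lintegral_blockDensity_sub {v : ℝ≥0} (hv : 0 < v) (m : Fin N → ℂ) :
    ∫⁻ y : Fin N → ℂ, ENNReal.ofReal (blockDensity v (y - m)) = 1 := by
  rw [lintegral_sub_right_eq_self (fun y => ENNReal.ofReal (blockDensity v y)) m]
  exact lintegral_blockDensity hv

@[fun_prop]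
theorem measurable_blockDensity_comp {α : Type*} [MeasurableSpace α] {f : α → ℝ}
    {g : α → Fin N → ℂ} (hf : Measurable f) (hg : Measurable g) :
    Measurable fun t => blockDensity (f t) (g t) :=
  measurable_blockDensity.comp (hf.prodMk hg)

/-- The likelihood ratio of an independent codeword has mean one. -/
theorem lintegral_density_ratio {β : Type*} [MeasurableSpace β] (ξ : Measure β)
    [IsProbabilityMeasure ξ] {m : β → Fin N → ℂ} (hm : Measurable m) {v v' : ℝ≥0} (hv : 0 < v)
    (hv' : 0 < v') :
    ∫⁻ y, ∫⁻ b, ENNReal.ofReal (blockDensity v' (y - m b) / blockDensity v y) ∂ξ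
      ∂(gaussBlock N v) = 1 := by
  have hm1 : Measurable fun p : (Fin N → ℂ) × β =>
      ENNReal.ofReal (blockDensity v' (p.1 - m p.2) / blockDensity v p.1) := by fun_prop
  have hm2 : Measurable fun p : (Fin N → ℂ) × β =>
      ENNReal.ofReal (blockDensity v' (p.1 - m p.2)) := by fun_prop
  rw [lintegral_gaussBlock hv hm1.lintegral_prod_right']
  have e : ∀ y, ENNReal.ofReal (blockDensity v y) *
      ∫⁻ b, ENNReal.ofReal (blockDensity v' (y - m b) / blockDensity v y) ∂ξ
      = ∫⁻ b, ENNReal.ofReal (blockDensity v' (y - m b)) ∂ξ := by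
    intro y
    rw [← lintegral_const_mul' _ _ ENNReal.ofReal_ne_top]
    refine lintegral_congr fun b => ?_
    have := blockDensity_pos (show (0 : ℝ) < v by exact_mod_cast hv) y
    rw [← ENNReal.ofReal_mul this.le, mul_div_cancel₀ _ this.ne']
  simp only [e]
  rw [lintegral_lintegral_swap hm2.aemeasurable]
  simp [lintegral_blockDensity_sub hv']

/-- Densities at typical points are comparable. -/
theorem blockDensity_le_of_typical {v v' τ : ℝ} (hv : 0 < v) (hv' : 0 < v') (hN : 0 < N)
    {a b : Fin N → ℂ} (ha : |energy a / (N * v) - 1| < τ) (hb : |energy b / (N * v') - 1| < τ) :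
    blockDensity v a ≤ (v' / v) ^ N * Real.exp (2 * N * τ) * blockDensity v' b := by
  have hN' : (0 : ℝ) < N := by exact_mod_cast hN
  rw [abs_lt] at ha hb
  have h1 : energy a / v = N * (energy a / (N * v)) := by field_simp
  have h2 : energy b / v' = N * (energy b / (N * v')) := by field_simp
  have h3 : -energy a / v ≤ 2 * N * τ + -energy b / v' := by
    rw [neg_div, neg_div, h1, h2]
    nlinarith
  rw [blockDensity, blockDensity]
  have e : (v' / v) ^ N * Real.exp (2 * N * τ) * ((Real.pi * v')⁻¹ ^ N * Real.exp (-energy b / v'))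
      = (Real.pi * v)⁻¹ ^ N * Real.exp (2 * N * τ + -energy b / v') := by
    rw [Real.exp_add]
    have : (Real.pi * v)⁻¹ ^ N = (v' / v) ^ N * (Real.pi * v')⁻¹ ^ N := by
      rw [← mul_pow]
      congr 1
      field_simp
    rw [this]; ring
  rw [e]
  gcongr

end LayeredKey

end

noncomputable section

namespace LayeredKey

open scoped ENNReal NNReal Topology

variable {L N : ℕ} (q : Fin (L + 1) → ℝ≥0)

/-! ### Probabilities of the atypical events -/

/-- The energies of all partial superpositions are close to their means. -/
def Typical (τ h : ℝ) (a : Fin (L + 1) → Fin N → ℂ) (z : Fin N → ℂ) : Prop :=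
  ∀ T, |energy (recv q h T a z) / (N * recvVar q h T) - 1| < τ

theorem measurableSet_typical (τ : ℝ) {α : Type*} [MeasurableSpace α] {f : α → ℝ}
    {a : α → Fin (L + 1) → Fin N → ℂ} {z : α → Fin N → ℂ} (hf : Measurable f) (ha : Measurable a)
    (hz : Measurable z) : MeasurableSet {t | Typical q τ (f t) (a t) (z t)} := by
  simp only [Typical, Set.ofPred_forall]
  refine MeasurableSet.iInter fun T => measurableSet_lt ?_ measurable_const
  have := (measurable_recvVar q T).comp hf
  simp only [Function.comp_def] at this
  fun_prop

/-- Averaged over the codebooks, the selected blocks are independent Gaussian layers, so each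
partial superposition is Gaussian and Chebyshev applies; the factor `2 ^ (L + 1)` is the union over
sets of layers. -/
theorem lintegral_not_typical_le (hN : 0 < N) {τ : ℝ} (hτ : 0 < τ) (h : ℝ)
    {sz : Fin (L + 1) → ℕ} (w : (l : Fin (L + 1)) → Fin (sz l)) :
    ∫⁻ z, bookLaw sz N {x | ¬ Typical q τ h (pick x w) z} ∂(gaussBlock N 1)
      ≤ 2 ^ (L + 1) * ENNReal.ofReal (energyVar / N / τ ^ 2) := by
  have hm : MeasurableSet {p : (Fin (L + 1) → Fin N → ℂ) × (Fin N → ℂ) |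
      ¬ Typical q τ h p.1 p.2} :=
    (measurableSet_typical q τ measurable_const measurable_fst measurable_snd).compl
  have h1 : ∀ z, bookLaw sz N {x | ¬ Typical q τ h (pick x w) z}
      = layerLaw L N {a | ¬ Typical q τ h a z} := by
    intro z
    have hz : MeasurableSet {a : Fin (L + 1) → Fin N → ℂ | ¬ Typical q τ h a z} :=
      (measurableSet_typical q τ measurable_const measurable_id measurable_const).compl
    have h2 := lintegral_book_pick sz N w
      (F := {a | ¬ Typical q τ h a z}.indicator 1) (measurable_one.indicator hz)
    rw [lintegral_indicator_one hz] at h2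
    rw [← h2]
    exact (lintegral_indicator_one ((measurable_pick w) hz)).symm
  simp only [h1]
  have h2 := Measure.prod_apply_symm (μ := layerLaw L N) (ν := gaussBlock N 1) hm
  refine (le_of_eq h2.symm).trans ?_
  have hsub : {p : (Fin (L + 1) → Fin N → ℂ) × (Fin N → ℂ) | ¬ Typical q τ h p.1 p.2}
      ⊆ ⋃ T, (fun p : (Fin (L + 1) → Fin N → ℂ) × (Fin N → ℂ) => recv q h T p.1 p.2) ⁻¹'
        {y | τ ≤ |energy y / (N * recvVar q h T) - 1|} := by
    intro p hp
    simp only [Typical, Set.mem_ofPred_eq, not_forall, not_lt] at hp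
    simpa using hp
  refine (measure_mono hsub).trans ((measure_iUnion_fintype_le _ _).trans ?_)
  have h3 : ∀ T, ((layerLaw L N).prod (gaussBlock N 1))
      ((fun p : (Fin (L + 1) → Fin N → ℂ) × (Fin N → ℂ) => recv q h T p.1 p.2) ⁻¹'
        {y | τ ≤ |energy y / (N * recvVar q h T) - 1|})
      ≤ ENNReal.ofReal (energyVar / N / τ ^ 2) := by
    intro T
    rw [← Measure.map_apply (by fun_prop) (measurableSet_le (by fun_prop) (by fun_prop)), map_recv]
    exact gaussBlock_deviation_le hN hτ (recvVar_pos q h T)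
  refine (Finset.sum_le_sum fun T _ => h3 T).trans (le_of_eq ?_)
  simp

/-- The likelihood ratio of an independent superposition has mean one. -/
theorem lintegral_recv_ratio (h : ℝ) (T : Finset (Fin (L + 1)))
    {m : (Fin (L + 1) → Fin N → ℂ) → Fin N → ℂ} (hm : Measurable m) {v : ℝ≥0} (hv : 0 < v) :
    ∫⁻ z, ∫⁻ p, ENNReal.ofReal (blockDensity v (recv q h T p.1 z - m p.2)
        / blockDensity (recvVar q h T) (recv q h T p.1 z))
      ∂((layerLaw L N).prod (layerLaw L N)) ∂(gaussBlock N 1) = 1 := by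
  set H : (Fin N → ℂ) → ℝ≥0∞ := fun y => ∫⁻ b, ENNReal.ofReal (blockDensity v (y - m b)
    / blockDensity (recvVar q h T) y) ∂(layerLaw L N) with hH
  have hHm : Measurable H := by
    have : Measurable fun p : (Fin N → ℂ) × (Fin (L + 1) → Fin N → ℂ) =>
      ENNReal.ofReal (blockDensity v (p.1 - m p.2) / blockDensity (recvVar q h T) p.1) := by
      fun_prop
    exact this.lintegral_prod_right'
  have h1 : ∀ z, ∫⁻ p, ENNReal.ofReal (blockDensity v (recv q h T p.1 z - m p.2)
        / blockDensity (recvVar q h T) (recv q h T p.1 z)) ∂((layerLaw L N).prod (layerLaw L N))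
      = ∫⁻ a, H (recv q h T a z) ∂(layerLaw L N) := by
    intro z
    rw [lintegral_prod _ (by fun_prop)]
  simp only [h1]
  have hrm : Measurable fun p : (Fin (L + 1) → Fin N → ℂ) × (Fin N → ℂ) =>
      recv q h T p.1 p.2 := by fun_prop
  rw [← lintegral_prod_symm (fun p : (Fin (L + 1) → Fin N → ℂ) × (Fin N → ℂ) =>
    H (recv q h T p.1 p.2)) (hHm.comp hrm).aemeasurable, ← lintegral_map hHm hrm, map_recv]
  exact lintegral_density_ratio (layerLaw L N) hm (recvVar_pos q h T) hv

/-- A wrong codeword of layer `l` rarely looks likely. -/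
theorem lintegral_false_alarm_le (h t : ℝ) {sz : Fin (L + 1) → ℕ}
    (w : (l : Fin (L + 1)) → Fin (sz l)) (l : Fin (L + 1)) {j : Fin (sz l)} (hj : w l ≠ j) :
    ∫⁻ z, bookLaw sz N {x | Real.exp (N * t) *
        blockDensity (recvVar q h (Finset.Ici l)) (recv q h (Finset.Ici l) (pick x w) z)
      ≤ blockDensity (recvVar q h (Finset.Ioi l)) (recv q h (Finset.Ici l) (pick x w) z
        - fun i => ((Real.sqrt h : ℝ) : ℂ) * (((Real.sqrt (q l) : ℝ) : ℂ) * x l j i))}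
      ∂(gaussBlock N 1) ≤ ENNReal.ofReal (Real.exp (-(N * t))) := by
  set m : (Fin (L + 1) → Fin N → ℂ) → Fin N → ℂ := fun a i =>
    ((Real.sqrt h : ℝ) : ℂ) * (((Real.sqrt (q l) : ℝ) : ℂ) * a l i) with hm
  have hmm : Measurable m := by simp only [hm]; fun_prop
  set v := recvVar q h (Finset.Ioi l)
  set u := recvVar q h (Finset.Ici l)
  -- Changing only layer `l` gives a second tuple whose block in that layer is independent of
  -- everything received.
  set w' := Function.update w l j with hw'
  have hw'l : w' l = j := by simp [hw']
  set ratio : (Fin N → ℂ) → (Fin N → ℂ) → ℝ := fun y c => blockDensity v (y - c) / blockDensity u y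
  have hbound : ∀ z, bookLaw sz N {x | Real.exp (N * t) *
        blockDensity u (recv q h (Finset.Ici l) (pick x w) z)
      ≤ blockDensity v (recv q h (Finset.Ici l) (pick x w) z
        - fun i => ((Real.sqrt h : ℝ) : ℂ) * (((Real.sqrt (q l) : ℝ) : ℂ) * x l j i))}
      ≤ ENNReal.ofReal (Real.exp (-(N * t))) * ∫⁻ p, ENNReal.ofReal
          (ratio (recv q h (Finset.Ici l) p.1 z) (m p.2)) ∂((layerLaw L N).prod (layerLaw L N)) := by
    intro z
    have hset : MeasurableSet {x : Book sz N | Real.exp (N * t) *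
        blockDensity u (recv q h (Finset.Ici l) (pick x w) z)
      ≤ blockDensity v (recv q h (Finset.Ici l) (pick x w) z
        - fun i => ((Real.sqrt h : ℝ) : ℂ) * (((Real.sqrt (q l) : ℝ) : ℂ) * x l j i))} :=
      measurableSet_le (by fun_prop) (by fun_prop)
    have hpair := lintegral_book_pair sz N w w'
      (F := fun p => ENNReal.ofReal (ratio (recv q h (Finset.Ici l) p.1 z) (m p.2)))
      (by simp only [ratio]; fun_prop)
    have e : ∀ p : (Fin (L + 1) → Fin N → ℂ) × (Fin (L + 1) → Fin N → ℂ),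
        m (fun l => if w l = w' l then p.1 l else p.2 l) = m p.2 := by
      intro p
      simp only [hm, hw'l, if_neg hj]
    simp only [e] at hpair
    rw [← hpair, ← lintegral_const_mul' _ _ ENNReal.ofReal_ne_top, ← lintegral_indicator_one hset]
    -- Markov: on the event, the likelihood ratio is at least `exp (N t)`.
    refine lintegral_mono (Set.indicator_le fun x hx => ?_)
    rw [← ENNReal.ofReal_mul (Real.exp_pos _).le, Pi.one_apply, ENNReal.one_le_ofReal]
    have hx' : Real.exp (N * t) * blockDensity u (recv q h (Finset.Ici l) (pick x w) z)
      ≤ blockDensity v (recv q h (Finset.Ici l) (pick x w) z - m (pick x w')) := by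
      have : m (pick x w') = fun i => ((Real.sqrt h : ℝ) : ℂ) *
          (((Real.sqrt (q l) : ℝ) : ℂ) * x l j i) := by
        simp only [hm, pick, hw'l]
      rw [this]
      exact hx
    have hpos := blockDensity_pos (recvVar_pos' q h (Finset.Ici l))
      (recv q h (Finset.Ici l) (pick x w) z)
    rw [Real.exp_neg, ← div_eq_inv_mul, le_div_iff₀ (Real.exp_pos _), one_mul, le_div_iff₀ hpos]
    exact hx'
  refine (lintegral_mono hbound).trans ?_
  rw [lintegral_const_mul' _ _ ENNReal.ofReal_ne_top,
    lintegral_recv_ratio q h (Finset.Ici l) hmm (recvVar_pos q h (Finset.Ioi l)), mul_one]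

/-! ### Sums of likelihoods at Eve's block -/

/-- The likelihood of the messages `w` for the block `y`. -/
def likelihood {sz : Fin (L + 1) → ℕ} (h : ℝ) (x : Book sz N) (y : Fin N → ℂ)
    (w : (l : Fin (L + 1)) → Fin (sz l)) : ℝ :=
  blockDensity 1 (y - fun i => ((Real.sqrt h : ℝ) : ℂ) * superpose q Finset.univ (pick x w) i)

theorem likelihood_pos {sz : Fin (L + 1) → ℕ} (h : ℝ) (x : Book sz N) (y : Fin N → ℂ)
    (w : (l : Fin (L + 1)) → Fin (sz l)) : 0 < likelihood q h x y w := blockDensity_pos one_pos _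

@[fun_prop]
theorem measurable_likelihood {sz : Fin (L + 1) → ℕ} (w : (l : Fin (L + 1)) → Fin (sz l))
    {α : Type*} [MeasurableSpace α] {f : α → ℝ} {x : α → Book sz N} {y : α → Fin N → ℂ}
    (hf : Measurable f) (hx : Measurable x) (hy : Measurable y) :
    Measurable fun t => likelihood q (f t) (x t) (y t) w := by
  unfold likelihood superpose pick
  fun_prop

/-- The mean likelihood of the messages `w'` at a typical received block. -/
theorem lintegral_likelihood_le (hN : 0 < N) (τ h : ℝ) {sz : Fin (L + 1) → ℕ}
    (w w' : (l : Fin (L + 1)) → Fin (sz l)) (U T : Finset (Fin (L + 1)))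
    (hT : ∀ l, l ∈ T ↔ w l ≠ w' l) :
    ∫⁻ z, ∫⁻ x, {x | Typical q τ h (pick x w) z}.indicator (fun x => ENNReal.ofReal
        (likelihood q h x (recv q h Finset.univ (pick x w) z) w'
          / blockDensity (recvVar q h U) (recv q h U (pick x w) z))) x
        ∂(bookLaw sz N) ∂(gaussBlock N 1)
      ≤ ENNReal.ofReal ((recvVar q h U / recvVar q h T : ℝ) ^ N * Real.exp (2 * N * τ)) := by
  set c : ℝ := (recvVar q h U / recvVar q h T : ℝ) ^ N * Real.exp (2 * N * τ)
  have hc : 0 ≤ c := by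
    have := recvVar_pos' q h U
    have := recvVar_pos' q h T
    positivity
  set m : (Fin (L + 1) → Fin N → ℂ) → Fin N → ℂ := fun a i =>
    ((Real.sqrt h : ℝ) : ℂ) * superpose q T a i with hm
  have hmm : Measurable m := by simp only [hm]; fun_prop
  have hbound : ∀ z, ∫⁻ x, {x | Typical q τ h (pick x w) z}.indicator (fun x => ENNReal.ofReal
        (likelihood q h x (recv q h Finset.univ (pick x w) z) w'
          / blockDensity (recvVar q h U) (recv q h U (pick x w) z))) x ∂(bookLaw sz N)
      ≤ ENNReal.ofReal c * ∫⁻ p, ENNReal.ofReal (blockDensity 1 (recv q h T p.1 z - m p.2)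
        / blockDensity (recvVar q h T) (recv q h T p.1 z))
      ∂((layerLaw L N).prod (layerLaw L N)) := by
    intro z
    have hpair := lintegral_book_pair sz N w w'
      (F := fun p => ENNReal.ofReal (blockDensity 1 (recv q h T p.1 z - m p.2)
        / blockDensity (recvVar q h T) (recv q h T p.1 z))) (by fun_prop)
    have e : ∀ p : (Fin (L + 1) → Fin N → ℂ) × (Fin (L + 1) → Fin N → ℂ),
        m (fun l => if w l = w' l then p.1 l else p.2 l) = m p.2 := by
      intro p
      simp only [hm]
      rw [superpose_congr q (b := p.2)]
      intro l hl
      rw [if_neg ((hT l).1 hl)]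
    simp only [e] at hpair
    rw [← hpair, ← lintegral_const_mul' _ _ ENNReal.ofReal_ne_top]
    refine lintegral_mono (Set.indicator_le fun x hx => ?_)
    rw [← ENNReal.ofReal_mul hc]
    refine ENNReal.ofReal_le_ofReal ?_
    have hU := blockDensity_pos (recvVar_pos' q h U) (recv q h U (pick x w) z)
    have hTp := blockDensity_pos (recvVar_pos' q h T) (recv q h T (pick x w) z)
    -- The ratio has mean one only against the Gaussian density for `T`, the layers in which the
    -- tuples differ. Typicality exchanges it for the density for `U` at the cost `c`.
    have hle : blockDensity (recvVar q h T) (recv q h T (pick x w) z)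
        ≤ c * blockDensity (recvVar q h U) (recv q h U (pick x w) z) :=
      blockDensity_le_of_typical (recvVar_pos' q h T) (recvVar_pos' q h U) hN (hx T) (hx U)
    -- The layers in which `w` and `w'` agree cancel in the difference, and only those in `T`
    -- remain.
    have heq : likelihood q h x (recv q h Finset.univ (pick x w) z) w'
        = blockDensity 1 (recv q h T (pick x w) z - m (pick x w')) := by
      rw [likelihood]
      congr 1
      ext i
      have hs : ∀ a : Fin (L + 1) → Fin N → ℂ, superpose q Finset.univ a i
          = superpose q T a i + superpose q Tᶜ a i := by
        intro a
        simp only [superpose]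
        exact (Finset.sum_add_sum_compl T _).symm
      have hcongr : superpose q Tᶜ (pick x w) = superpose q Tᶜ (pick x w') := by
        refine superpose_congr q fun l hl => ?_
        have : w l = w' l := by
          by_contra hne
          exact (Finset.mem_compl.1 hl) ((hT l).2 hne)
        simp [pick, this]
      simp only [Pi.sub_apply, recv, hm, hs, hcongr]
      ring
    rw [heq, div_le_iff₀ hU]
    calc _ = blockDensity 1 (recv q h T (pick x w) z - m (pick x w'))
          / blockDensity (recvVar q h T) (recv q h T (pick x w) z)
          * blockDensity (recvVar q h T) (recv q h T (pick x w) z) := by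
          rw [div_mul_cancel₀ _ hTp.ne']
      _ ≤ blockDensity 1 (recv q h T (pick x w) z - m (pick x w'))
          / blockDensity (recvVar q h T) (recv q h T (pick x w) z)
          * (c * blockDensity (recvVar q h U) (recv q h U (pick x w) z)) :=
          mul_le_mul_of_nonneg_left hle
            (div_nonneg (blockDensity_pos one_pos _).le hTp.le)
      _ = _ := by ring
  refine (lintegral_mono hbound).trans ?_
  rw [lintegral_const_mul' _ _ ENNReal.ofReal_ne_top]
  have := lintegral_recv_ratio q h T hmm (v := 1) one_pos
  simp only [NNReal.coe_one] at this
  rw [this, mul_one]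

/-- The messages that agree with `w` on the layers in `S`. -/
def agreeing {sz : Fin (L + 1) → ℕ} (S : Finset (Fin (L + 1)))
    (w : (l : Fin (L + 1)) → Fin (sz l)) : Finset ((l : Fin (L + 1)) → Fin (sz l)) :=
  Finset.univ.filter fun w' => ∀ l ∈ S, w' l = w l

theorem card_agreeing {sz : Fin (L + 1) → ℕ} (S : Finset (Fin (L + 1)))
    (w : (l : Fin (L + 1)) → Fin (sz l)) : (agreeing S w).card = ∏ l ∈ Sᶜ, sz l := by
  classical
  have : agreeing S w = Fintype.piFinset fun l => if l ∈ S then {w l} else Finset.univ := by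
    ext w'
    simp only [agreeing, Finset.mem_filter, Finset.mem_univ, true_and, Fintype.mem_piFinset]
    refine forall_congr' fun l => ?_
    by_cases hl : l ∈ S <;> simp [hl]
  rw [this, Fintype.card_piFinset, ← Finset.prod_mul_prod_compl S,
    Finset.prod_eq_one (fun l hl => by simp [hl]), one_mul]
  refine Finset.prod_congr rfl fun l hl => ?_
  simp [Finset.mem_compl.1 hl]

/-- The total likelihood of the messages that agree with `w` up to layer `ψ`, relative to its
Gaussian approximation, is rarely larger than `C`. -/
theorem lintegral_numerator_le (hN : 0 < N) (τ h : ℝ) {sz : Fin (L + 1) → ℕ}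
    (w : (l : Fin (L + 1)) → Fin (sz l)) (ψ : Fin (L + 1)) {C : ℝ} (hC : 0 < C) :
    ∫⁻ z, bookLaw sz N {x | Typical q τ h (pick x w) z ∧
        C * blockDensity (recvVar q h (Finset.Ioi ψ)) (recv q h (Finset.Ioi ψ) (pick x w) z)
          < ∑ w' ∈ agreeing (Finset.Iic ψ) w,
            likelihood q h x (recv q h Finset.univ (pick x w) z) w'} ∂(gaussBlock N 1)
      ≤ ENNReal.ofReal ((∑ T ∈ (Finset.Ioi ψ).powerset, (∏ l ∈ T, (sz l : ℝ)) *
          ((recvVar q h (Finset.Ioi ψ) / recvVar q h T : ℝ) ^ N * Real.exp (2 * N * τ))) / C) := by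
  classical
  set U := Finset.Ioi ψ
  set g : Finset (Fin (L + 1)) → ℝ := fun T =>
    (recvVar q h U / recvVar q h T : ℝ) ^ N * Real.exp (2 * N * τ) with hg
  have hg0 : ∀ T, 0 ≤ g T := fun T => by
    have := recvVar_pos' q h U
    have := recvVar_pos' q h T
    positivity
  set F : ((l : Fin (L + 1)) → Fin (sz l)) → (Fin N → ℂ) → Book sz N → ℝ≥0∞ := fun w' z =>
    {x | Typical q τ h (pick x w) z}.indicator (fun x => ENNReal.ofReal
        (likelihood q h x (recv q h Finset.univ (pick x w) z) w'
          / blockDensity (recvVar q h U) (recv q h U (pick x w) z))) with hF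
  have hFm : ∀ w', Measurable fun p : (Fin N → ℂ) × Book sz N => F w' p.1 p.2 := by
    intro w'
    have hs : MeasurableSet {p : (Fin N → ℂ) × Book sz N | Typical q τ h (pick p.2 w) p.1} :=
      measurableSet_typical q τ measurable_const (by fun_prop) (by fun_prop)
    have hmm : Measurable fun p : (Fin N → ℂ) × Book sz N => ENNReal.ofReal
        (likelihood q h p.2 (recv q h Finset.univ (pick p.2 w) p.1) w'
          / blockDensity (recvVar q h U) (recv q h U (pick p.2 w) p.1)) := by fun_prop
    exact hmm.indicator hs
  have hpt : ∀ z, bookLaw sz N {x | Typical q τ h (pick x w) z ∧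
        C * blockDensity (recvVar q h U) (recv q h U (pick x w) z)
          < ∑ w' ∈ agreeing (Finset.Iic ψ) w,
            likelihood q h x (recv q h Finset.univ (pick x w) z) w'}
      ≤ ENNReal.ofReal (1 / C) * ∑ w' ∈ agreeing (Finset.Iic ψ) w, ∫⁻ x, F w' z x ∂(bookLaw sz N) := by
    intro z
    have hset : MeasurableSet {x : Book sz N | Typical q τ h (pick x w) z ∧
        C * blockDensity (recvVar q h U) (recv q h U (pick x w) z)
          < ∑ w' ∈ agreeing (Finset.Iic ψ) w,
            likelihood q h x (recv q h Finset.univ (pick x w) z) w'} :=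
      (measurableSet_typical q τ measurable_const (measurable_pick w) measurable_const).inter
        (measurableSet_lt (f := fun x => C * blockDensity (recvVar q h U) (recv q h U (pick x w) z))
          (g := fun x => ∑ w' ∈ agreeing (Finset.Iic ψ) w,
            likelihood q h x (recv q h Finset.univ (pick x w) z) w')
          (by fun_prop) (by fun_prop))
    have hFz : ∀ w', Measurable (F w' z) := fun w' =>
      Measurable.comp (g := fun p : (Fin N → ℂ) × Book sz N => F w' p.1 p.2) (f := Prod.mk z)
        (hFm w') measurable_prodMk_left
    rw [← lintegral_finsetSum _ fun w' _ => hFz w',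
      ← lintegral_const_mul' _ _ ENNReal.ofReal_ne_top, ← lintegral_indicator_one hset]
    refine lintegral_mono (Set.indicator_le fun x hx => ?_)
    have hx1 : x ∈ {x | Typical q τ h (pick x w) z} := hx.1
    have hpos := blockDensity_pos (recvVar_pos' q h U) (recv q h U (pick x w) z)
    simp only [hF, Set.indicator_of_mem hx1]
    rw [← ENNReal.ofReal_sum_of_nonneg fun w' _ => div_nonneg (likelihood_pos q h x _ w').le hpos.le,
      ← ENNReal.ofReal_mul (by positivity), Pi.one_apply, ENNReal.one_le_ofReal, ← Finset.sum_div,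
      one_div, ← div_eq_inv_mul, le_div_iff₀ hC, one_mul, le_div_iff₀ hpos]
    exact hx.2.le
  refine (lintegral_mono hpt).trans ?_
  rw [lintegral_const_mul' _ _ ENNReal.ofReal_ne_top,
    lintegral_finsetSum _ fun w' _ => (hFm w').lintegral_prod_right', one_div, div_eq_inv_mul,
    ENNReal.ofReal_mul (by positivity)]
  refine mul_le_mul_right ?_ _
  -- The wrong messages are grouped by the set of layers in which they differ from `w`: the mean
  -- bound depends on this set only, and a set `T` accounts for at most `∏ l ∈ T, sz l` messages.
  set D : ((l : Fin (L + 1)) → Fin (sz l)) → Finset (Fin (L + 1)) := fun w' =>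
    Finset.univ.filter fun l => w l ≠ w' l with hD
  have hterm : ∀ w', ∫⁻ z, ∫⁻ x, F w' z x ∂(bookLaw sz N) ∂(gaussBlock N 1)
      ≤ ENNReal.ofReal (g (D w')) := fun w' =>
    lintegral_likelihood_le q hN τ h w w' U (D w') fun l => by simp [hD]
  refine (Finset.sum_le_sum fun w' _ => hterm w').trans ?_
  rw [← ENNReal.ofReal_sum_of_nonneg fun w' _ => hg0 _]
  refine ENNReal.ofReal_le_ofReal ?_
  have hmaps : ∀ w' ∈ agreeing (Finset.Iic ψ) w, D w' ∈ U.powerset := by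
    intro w' hw'
    simp only [agreeing, Finset.mem_filter, Finset.mem_univ, true_and, Finset.mem_Iic] at hw'
    simp only [Finset.mem_powerset, Finset.subset_iff, hD, Finset.mem_filter, Finset.mem_univ,
      true_and, U, Finset.mem_Ioi]
    intro l hl
    by_contra hc
    exact hl (hw' l (not_lt.1 hc)).symm
  rw [← Finset.sum_fiberwise_of_maps_to hmaps]
  refine Finset.sum_le_sum fun T _ => ?_
  have h1 : ∑ w' ∈ agreeing (Finset.Iic ψ) w with D w' = T, g (D w')
      = ((agreeing (Finset.Iic ψ) w).filter fun w' => D w' = T).card * g T := by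
    rw [Finset.sum_congr rfl fun w' hw' => by rw [(Finset.mem_filter.1 hw').2], Finset.sum_const,
      nsmul_eq_mul]
  rw [h1]
  refine mul_le_mul_of_nonneg_right ?_ (hg0 T)
  have h2 : ((agreeing (Finset.Iic ψ) w).filter fun w' => D w' = T).card ≤ ∏ l ∈ T, sz l := by
    have := card_agreeing Tᶜ w
    rw [compl_compl] at this
    rw [← this]
    refine Finset.card_le_card fun w' hw' => ?_
    have hw2 := (Finset.mem_filter.1 hw').2
    simp only [agreeing, Finset.mem_filter, Finset.mem_univ, true_and, Finset.mem_compl]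
    intro l hl
    by_contra hne
    apply hl
    rw [← hw2]
    simp only [hD, Finset.mem_filter, Finset.mem_univ, true_and]
    exact fun h => hne h.symm
  calc _ ≤ ((∏ l ∈ T, sz l : ℕ) : ℝ) := by exact_mod_cast h2
    _ = _ := by push_cast; rfl

theorem lintegral_uniformOn_univ {α : Type*} [Fintype α] [Nonempty α] [MeasurableSpace α]
    [MeasurableSingletonClass α] (f : α → ℝ≥0∞) :
    ∫⁻ a, f a ∂(uniformOn (Set.univ : Set α)) = (Fintype.card α : ℝ≥0∞)⁻¹ * ∑ a, f a := by
  rw [uniformOn, ProbabilityTheory.cond, lintegral_smul_measure, Measure.restrict_univ, lintegral_count,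
    tsum_fintype, Measure.count_univ, smul_eq_mul]
  simp

/-- The total likelihood is rarely far below that of a Gaussian superposition of the layers in `S`. -/
theorem lintegral_denominator_le (h : ℝ) {sz : Fin (L + 1) → ℕ} (hsz : ∀ l, 0 < sz l)
    (x : Book sz N) (S : Finset (Fin (L + 1))) {κ : ℝ} (hκ : 0 ≤ κ) :
    ∫⁻ w, gaussBlock N 1 {z | ∑ w', likelihood q h x (recv q h Finset.univ (pick x w) z) w'
        < κ * ∑ w', blockDensity (recvVar q h S) (recv q h Finset.univ (pick x w) z
          - fun i => ((Real.sqrt h : ℝ) : ℂ) * superpose q Sᶜ (pick x w') i)}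
        ∂(uniformOn (Set.univ : Set ((l : Fin (L + 1)) → Fin (sz l))))
      ≤ ENNReal.ofReal κ := by
  classical
  have : ∀ l, Nonempty (Fin (sz l)) := fun l => ⟨⟨0, hsz l⟩⟩
  -- The event is a fixed set of received blocks, the same for all messages. Averaging over the
  -- messages therefore integrates over it the very sum that is small on it.
  set E : Set (Fin N → ℂ) := {y | ∑ w', likelihood q h x y w'
        < κ * ∑ w', blockDensity (recvVar q h S) (y
          - fun i => ((Real.sqrt h : ℝ) : ℂ) * superpose q Sᶜ (pick x w') i)} with hE
  have hEm : MeasurableSet E := measurableSet_lt (by fun_prop) (by fun_prop)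
  have h1 : ∀ w, gaussBlock N 1 {z | ∑ w', likelihood q h x (recv q h Finset.univ (pick x w) z) w'
        < κ * ∑ w', blockDensity (recvVar q h S) (recv q h Finset.univ (pick x w) z
          - fun i => ((Real.sqrt h : ℝ) : ℂ) * superpose q Sᶜ (pick x w') i)}
      = ∫⁻ y, E.indicator (fun y => ENNReal.ofReal (likelihood q h x y w)) y := by
    intro w
    set m : Fin N → ℂ := fun i => ((Real.sqrt h : ℝ) : ℂ) * superpose q Finset.univ (pick x w) i
    have hrm : Measurable fun z : Fin N → ℂ => recv q h Finset.univ (pick x w) z := by fun_prop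
    have e1 : ∀ z, recv q h Finset.univ (pick x w) z = z + m := by
      intro z; ext i; simp only [recv, Pi.add_apply, m]; ring
    calc _ = ∫⁻ z, E.indicator 1 (z + m) ∂(gaussBlock N 1) := by
          refine (lintegral_indicator_one (hrm hEm)).symm.trans (lintegral_congr fun z => ?_)
          rw [← e1 z]; rfl
      _ = ∫⁻ z, ENNReal.ofReal (blockDensity 1 z) * E.indicator 1 (z + m) := by
          rw [lintegral_gaussBlock (F := fun z => E.indicator 1 (z + m)) one_pos
            ((measurable_one.indicator hEm).comp (measurable_add_const m))]
          rfl
      _ = ∫⁻ z, ENNReal.ofReal (blockDensity 1 (z + m - m)) * E.indicator 1 (z + m) := by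
          simp only [add_sub_cancel_right]
      _ = ∫⁻ y, ENNReal.ofReal (blockDensity 1 (y - m)) * E.indicator 1 y :=
          lintegral_add_right_eq_self
            (fun y => ENNReal.ofReal (blockDensity 1 (y - m)) * E.indicator 1 y) m
      _ = _ := by
          refine lintegral_congr fun y => ?_
          by_cases hy : y ∈ E
          · rw [Set.indicator_of_mem hy, Set.indicator_of_mem hy]; simp [likelihood, m]
          · rw [Set.indicator_of_notMem hy, Set.indicator_of_notMem hy]; simp
  simp only [h1]
  rw [lintegral_uniformOn_univ, ← lintegral_finsetSum _ fun w _ =>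
    Measurable.indicator (by fun_prop) hEm]
  -- On `E` the total likelihood is below `κ` times a sum of probability densities, one for each
  -- message tuple.
  have hle : ∫⁻ y, ∑ w, E.indicator (fun y => ENNReal.ofReal (likelihood q h x y w)) y
      ≤ ENNReal.ofReal κ * (Fintype.card ((l : Fin (L + 1)) → Fin (sz l)) : ℝ≥0∞) := by
    calc _ ≤ ∫⁻ y, ENNReal.ofReal κ * ∑ w', ENNReal.ofReal (blockDensity (recvVar q h S) (y
          - fun i => ((Real.sqrt h : ℝ) : ℂ) * superpose q Sᶜ (pick x w') i)) := by
          refine lintegral_mono fun y => ?_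
          by_cases hy : y ∈ E
          · simp only [Set.indicator_of_mem hy]
            rw [← ENNReal.ofReal_sum_of_nonneg fun w _ => (likelihood_pos q h x y w).le,
              ← ENNReal.ofReal_sum_of_nonneg fun w _ =>
                (blockDensity_pos (recvVar_pos' q h S) _).le, ← ENNReal.ofReal_mul hκ]
            exact ENNReal.ofReal_le_ofReal hy.le
          · simp only [Set.indicator_of_notMem hy, Finset.sum_const_zero]
            exact zero_le
      _ = _ := by
          rw [lintegral_const_mul' _ _ ENNReal.ofReal_ne_top,
            lintegral_finsetSum _ fun w _ => by fun_prop]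
          simp [lintegral_blockDensity_sub (recvVar_pos q h S)]
  refine (mul_le_mul_right hle _).trans (le_of_eq ?_)
  rw [mul_comm, mul_assoc, ENNReal.mul_inv_cancel, mul_one]
  · exact Nat.cast_ne_zero.2 Fintype.card_ne_zero
  · exact ENNReal.natCast_ne_top _

end LayeredKey

end

noncomputable section

namespace LayeredKey

open scoped ENNReal NNReal Topology

/-! ### Successive decoding -/

/-- The first admissible index is a measurable choice. It makes the decision rule of a layer
measurable jointly in the gain and the block. -/
theorem exists_measurable_selector {X : Type*} [MeasurableSpace X] {n : ℕ} (hn : 0 < n)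
    (A : Fin n → Set X) (hA : ∀ j, MeasurableSet (A j)) :
    ∃ f : X → Fin n, Measurable f ∧ ∀ x, (∃ j, x ∈ A j) → x ∈ A (f x) := by
  classical
  set p : X → ℕ → Prop := fun x k => (∃ h : k < n, x ∈ A ⟨k, h⟩) ∨ k = n with hp
  have hex : ∀ x, ∃ k, p x k := fun x => ⟨n, .inr rfl⟩
  have hm : Measurable fun x => Nat.find (hex x) := by
    refine measurable_find hex fun k => ?_
    by_cases hk : k < n
    · have : {x | p x k} = A ⟨k, hk⟩ := by
        ext x
        simp [hp, hk, hk.ne]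
      rw [this]; exact hA _
    · have : {x | p x k} = {_x | k = n} := by
        ext x
        simp [hp, hk]
      rw [this]; exact MeasurableSet.const _
  refine ⟨fun x => if h : Nat.find (hex x) < n then ⟨Nat.find (hex x), h⟩ else ⟨0, hn⟩, ?_, ?_⟩
  · exact (Measurable.of_discrete (f := fun k : ℕ => if h : k < n then (⟨k, h⟩ : Fin n)
      else ⟨0, hn⟩)).comp hm
  · rintro x ⟨j, hj⟩
    have h1 : Nat.find (hex x) ≤ j := Nat.find_min' _ (.inl ⟨j.2, hj⟩)
    have h2 : Nat.find (hex x) < n := h1.trans_lt j.2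
    simp only [dif_pos h2]
    rcases Nat.find_spec (hex x) with ⟨_, h⟩ | h
    · exact h
    · exact absurd h h2.ne

variable {L N : ℕ}

/-- Successive decoding with a given decision rule for each layer. -/
def succDec (c : LayeredCode L N) (st : (l : Fin (L + 1)) → ℝ → (Fin N → ℂ) → Fin (c.size l))
    (h : ℝ) (y : Fin N → ℂ) (l : Fin (L + 1)) : Fin (c.size l) :=
  st l h (y - (Real.sqrt h : ℂ) •
    ∑ j ∈ (Finset.Iio l).attach, c.codeword j (succDec c st h y j))
termination_by l.val
decreasing_by
  have := Finset.mem_Iio.1 j.2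
  exact this

theorem succDec_eq (c : LayeredCode L N)
    (st : (l : Fin (L + 1)) → ℝ → (Fin N → ℂ) → Fin (c.size l)) (h : ℝ) (y : Fin N → ℂ)
    (l : Fin (L + 1)) :
    succDec c st h y l = st l h (y - (Real.sqrt h : ℂ) •
      ∑ j ∈ Finset.Iio l, c.codeword j (succDec c st h y j)) := by
  rw [succDec]
  congr 3
  exact Finset.sum_attach (Finset.Iio l) fun j => c.codeword j (succDec c st h y j)

theorem measurable_succDec (c : LayeredCode L N)
    {st : (l : Fin (L + 1)) → ℝ → (Fin N → ℂ) → Fin (c.size l)}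
    (hst : ∀ l, Measurable fun p : ℝ × (Fin N → ℂ) => st l p.1 p.2) :
    Measurable fun p : ℝ × (Fin N → ℂ) => succDec c st p.1 p.2 := by
  refine measurable_pi_lambda _ fun l => ?_
  induction l using WellFoundedLT.induction with
  | ind l ih =>
    simp only [succDec_eq c st _ _ l]
    have hcw : ∀ j ∈ Finset.Iio l, Measurable fun p : ℝ × (Fin N → ℂ) =>
        c.codeword j (succDec c st p.1 p.2 j) := fun j hj =>
      (Measurable.of_discrete (f := c.codeword j)).comp (ih j (Finset.mem_Iio.1 hj))
    have hsum : Measurable fun p : ℝ × (Fin N → ℂ) =>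
        ∑ j ∈ Finset.Iio l, c.codeword j (succDec c st p.1 p.2 j) :=
      Finset.measurable_sum _ hcw
    have hsub : Measurable fun p : ℝ × (Fin N → ℂ) => p.2 - (Real.sqrt p.1 : ℂ) •
        ∑ j ∈ Finset.Iio l, c.codeword j (succDec c st p.1 p.2 j) := by
      have hs : Measurable fun p : ℝ × (Fin N → ℂ) => ((Real.sqrt p.1 : ℝ) : ℂ) := by fun_prop
      exact measurable_snd.sub (hs.smul hsum)
    exact (hst l).comp (measurable_fst.prodMk hsub)

variable (q : Fin (L + 1) → ℝ≥0) {sz : Fin (L + 1) → ℕ}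

/-- The layered code with given codebooks and layer powers. -/
def bookCode (hsz : ∀ l, 0 < sz l) (x : Book sz N) : LayeredCode L N where
  size := sz
  size_pos := hsz
  codeword l j i := ((Real.sqrt (q l) : ℝ) : ℂ) * x l j i

/-- Message `j` of layer `l` is likely, by the threshold `t`, given the residual block `y`. -/
def Passes (t : ℝ) (x : Book sz N) (l : Fin (L + 1)) (j : Fin (sz l)) (h : ℝ) (y : Fin N → ℂ) :
    Prop :=
  Real.exp (N * t) * blockDensity (recvVar q h (Finset.Ici l)) y
    ≤ blockDensity (recvVar q h (Finset.Ioi l))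
      (y - fun i => ((Real.sqrt h : ℝ) : ℂ) * (((Real.sqrt (q l) : ℝ) : ℂ) * x l j i))

theorem bookCode_signal (hsz : ∀ l, 0 < sz l) (x : Book sz N)
    (w : (l : Fin (L + 1)) → Fin (sz l)) :
    (bookCode q hsz x).signal w = superpose q Finset.univ (pick x w) := by
  ext i
  simp [LayeredCode.signal, bookCode, superpose, pick]

/-- Removing the true codeword leaves a typical block for the higher layers. The likelihood ratio is
therefore at least the `N`-th power of the variance ratio times `exp (-2 N τ)`, and the assumed
capacity makes this exceed the threshold. -/
theorem passes_of_typical (hN : 0 < N) {t τ h : ℝ} {x : Book sz N}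
    {w : (l : Fin (L + 1)) → Fin (sz l)} {z : Fin N → ℂ} (htyp : Typical q τ h (pick x w) z)
    {l : Fin (L + 1)} (hcap : Real.exp (t + 2 * τ)
      ≤ recvVar q h (Finset.Ici l) / recvVar q h (Finset.Ioi l)) :
    Passes q t x l (w l) h (recv q h (Finset.Ici l) (pick x w) z) := by
  have hu := recvVar_pos' q h (Finset.Ici l)
  have hv := recvVar_pos' q h (Finset.Ioi l)
  have hres : (recv q h (Finset.Ici l) (pick x w) z - fun i =>
      ((Real.sqrt h : ℝ) : ℂ) * (((Real.sqrt (q l) : ℝ) : ℂ) * x l (w l) i))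
      = recv q h (Finset.Ioi l) (pick x w) z := by
    ext i
    simp only [Pi.sub_apply, recv, superpose]
    rw [Finset.Ici_eq_cons_Ioi, Finset.sum_cons]
    simp only [pick]
    ring
  rw [Passes, hres]
  have h1 := blockDensity_le_of_typical hu hv hN (htyp _) (htyp (Finset.Ioi l))
  have hpos := blockDensity_pos hv (recv q h (Finset.Ioi l) (pick x w) z)
  refine (mul_le_mul_of_nonneg_left h1 (Real.exp_pos _).le).trans ?_
  have h2 : Real.exp (N * t) * Real.exp (2 * N * τ)
      ≤ (recvVar q h (Finset.Ici l) / recvVar q h (Finset.Ioi l) : ℝ) ^ N := by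
    calc _ = Real.exp (t + 2 * τ) ^ N := by
          rw [← Real.exp_add, ← Real.exp_nat_mul]; ring_nf
      _ ≤ _ := pow_le_pow_left₀ (Real.exp_pos _).le hcap N
  have h3 : (recvVar q h (Finset.Ioi l) / recvVar q h (Finset.Ici l) : ℝ) ^ N
      * (recvVar q h (Finset.Ici l) / recvVar q h (Finset.Ioi l) : ℝ) ^ N = 1 := by
    rw [← mul_pow]
    have : (recvVar q h (Finset.Ioi l) / recvVar q h (Finset.Ici l) : ℝ)
      * (recvVar q h (Finset.Ici l) / recvVar q h (Finset.Ioi l) : ℝ) = 1 := by field_simp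
    rw [this, one_pow]
  have h4 : 0 ≤ (recvVar q h (Finset.Ioi l) / recvVar q h (Finset.Ici l) : ℝ) ^ N := by positivity
  calc _ = (recvVar q h (Finset.Ioi l) / recvVar q h (Finset.Ici l) : ℝ) ^ N
        * (Real.exp (N * t) * Real.exp (2 * N * τ))
        * blockDensity (recvVar q h (Finset.Ioi l)) (recv q h (Finset.Ioi l) (pick x w) z) := by ring
    _ ≤ 1 * blockDensity (recvVar q h (Finset.Ioi l)) (recv q h (Finset.Ioi l) (pick x w) z) := by
        refine mul_le_mul_of_nonneg_right ?_ hpos.le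
        rw [← h3]
        exact mul_le_mul_of_nonneg_left h2 h4
    _ = _ := one_mul _

/-- A successive decoder that recovers every layer whose capacity exceeds its threshold when the
received block is typical and no wrong codeword is likely. -/
theorem exists_decoder (hN : 0 < N) (hsz : ∀ l, 0 < sz l) (x : Book sz N) (t : Fin (L + 1) → ℝ)
    {τ : ℝ} :
    ∃ dec : ℝ → (Fin N → ℂ) → (bookCode q hsz x).Msg,
      (Measurable fun p : ℝ × (Fin N → ℂ) => dec p.1 p.2) ∧
      (∀ l, ∃ stage : ℝ → (Fin N → ℂ) → Fin ((bookCode q hsz x).size l), ∀ h y,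
        dec h y l = stage h (y - (Real.sqrt h : ℂ) •
          ∑ j ∈ Finset.Iio l, (bookCode q hsz x).codeword j (dec h y j))) ∧
      ∀ (h : ℝ) (w : (l : Fin (L + 1)) → Fin (sz l)) (z : Fin N → ℂ) (ψ : Fin (L + 1)),
        Typical q τ h (pick x w) z →
        (∀ l ≤ ψ, Real.exp (t l + 2 * τ)
          ≤ recvVar q h (Finset.Ici l) / recvVar q h (Finset.Ioi l)) →
        (∀ l j, w l ≠ j →
          ¬ Passes q (t l) x l j h (recv q h (Finset.Ici l) (pick x w) z)) →
        ∀ l ≤ ψ, dec h (recv q h Finset.univ (pick x w) z) l = w l := by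
  have hsel : ∀ l, ∃ f : ℝ × (Fin N → ℂ) → Fin (sz l), Measurable f ∧
      ∀ p, (∃ j, Passes q (t l) x l j p.1 p.2) → Passes q (t l) x l (f p) p.1 p.2 := by
    intro l
    have hmeas : ∀ j : Fin (sz l),
        MeasurableSet {p : ℝ × (Fin N → ℂ) | Passes q (t l) x l j p.1 p.2} := by
      intro j
      have h1 : Measurable fun p : ℝ × (Fin N → ℂ) => (recvVar q p.1 (Finset.Ici l) : ℝ) :=
        (measurable_recvVar q (Finset.Ici l)).comp measurable_fst
      have h2 : Measurable fun p : ℝ × (Fin N → ℂ) => (recvVar q p.1 (Finset.Ioi l) : ℝ) :=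
        (measurable_recvVar q (Finset.Ioi l)).comp measurable_fst
      have h3 : Measurable fun p : ℝ × (Fin N → ℂ) => Real.exp (N * t l) *
          blockDensity (recvVar q p.1 (Finset.Ici l)) p.2 := by fun_prop
      have h4 : Measurable fun p : ℝ × (Fin N → ℂ) => (p.2 - fun i => ((Real.sqrt p.1 : ℝ) : ℂ) *
          (((Real.sqrt (q l) : ℝ) : ℂ) * x l j i)) := by fun_prop
      exact measurableSet_le h3 (measurable_blockDensity_comp h2 h4)
    obtain ⟨f, hf, hfp⟩ := exists_measurable_selector (hsz l)
      (fun j => {p : ℝ × (Fin N → ℂ) | Passes q (t l) x l j p.1 p.2}) hmeas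
    exact ⟨f, hf, hfp⟩
  choose f hf hfp using hsel
  set c := bookCode q hsz x with hc
  set st : (l : Fin (L + 1)) → ℝ → (Fin N → ℂ) → Fin (c.size l) := fun l h y => f l (h, y) with hst
  refine ⟨succDec c st, measurable_succDec c fun l => hf l, fun l => ⟨st l, fun h y =>
    succDec_eq c st h y l⟩, ?_⟩
  intro h w z ψ htyp hcap hfalse l
  induction l using WellFoundedLT.induction with
  | ind l ih =>
    intro hl
    -- By induction the lower layers are already correct, so the subtraction leaves exactly the
    -- layers from `l` upwards.
    have hres : recv q h Finset.univ (pick x w) z - (Real.sqrt h : ℂ) •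
        ∑ j ∈ Finset.Iio l, c.codeword j (succDec c st h (recv q h Finset.univ (pick x w) z) j)
        = recv q h (Finset.Ici l) (pick x w) z := by
      have e1 : ∑ j ∈ Finset.Iio l,
          c.codeword j (succDec c st h (recv q h Finset.univ (pick x w) z) j)
          = superpose q (Finset.Iio l) (pick x w) := by
        ext i
        rw [Finset.sum_apply]
        refine Finset.sum_congr rfl fun j hj => ?_
        have hjl := Finset.mem_Iio.1 hj
        rw [ih j hjl (hjl.le.trans hl)]
        rfl
      rw [e1, ← recv_sub_superpose q h (S := Finset.Iio l) (T := Finset.Ici l)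
        (Finset.disjoint_left.2 fun j h1 h2 =>
          absurd (Finset.mem_Iio.1 h1) (not_lt.2 (Finset.mem_Ici.1 h2)))]
      have : (Finset.Iio l ∪ Finset.Ici l : Finset (Fin (L + 1))) = Finset.univ := by
        ext j; simp [lt_or_ge]
      rw [this]
      rfl
    rw [succDec_eq, hres]
    have htrue := passes_of_typical q hN htyp (hcap l hl)
    have hpass := hfp l (h, recv q h (Finset.Ici l) (pick x w) z) ⟨w l, htrue⟩
    -- The selector returns some passing codeword because the true one passes; a different one is
    -- excluded by the absence of false alarms.
    by_contra hne
    exact hfalse l _ (fun h => hne h.symm) hpass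

/-! ### The posterior probability of the decoded layers -/

/-- Only the tuples agreeing with `w` outside `S` are kept. There are `∏ l ∈ S, sz l` of them, all
with the same density. -/
theorem sum_density_ge (h : ℝ) (S : Finset (Fin (L + 1))) (x : Book sz N)
    (w : (l : Fin (L + 1)) → Fin (sz l)) (z : Fin N → ℂ) :
    (∏ l ∈ S, (sz l : ℝ)) * blockDensity (recvVar q h S) (recv q h S (pick x w) z)
      ≤ ∑ w', blockDensity (recvVar q h S) (recv q h Finset.univ (pick x w) z
          - fun i => ((Real.sqrt h : ℝ) : ℂ) * superpose q Sᶜ (pick x w') i) := by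
  have h1 : ∀ w' ∈ agreeing Sᶜ w, blockDensity (recvVar q h S) (recv q h Finset.univ (pick x w) z
          - fun i => ((Real.sqrt h : ℝ) : ℂ) * superpose q Sᶜ (pick x w') i)
      = blockDensity (recvVar q h S) (recv q h S (pick x w) z) := by
    intro w' hw'
    simp only [agreeing, Finset.mem_filter, Finset.mem_univ, true_and] at hw'
    rw [superpose_congr q (b := pick x w) fun l hl => by simp [pick, hw' l hl]]
    congr 1
    have := recv_sub_superpose q h (disjoint_compl_left (a := S)) (pick x w) z
    rw [Finset.union_comm, Finset.union_compl] at this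
    exact this
  have h2 : ∑ w' ∈ agreeing Sᶜ w, blockDensity (recvVar q h S)
      (recv q h Finset.univ (pick x w) z
          - fun i => ((Real.sqrt h : ℝ) : ℂ) * superpose q Sᶜ (pick x w') i)
      = (∏ l ∈ S, (sz l : ℝ)) * blockDensity (recvVar q h S) (recv q h S (pick x w) z) := by
    rw [Finset.sum_congr rfl h1, Finset.sum_const, card_agreeing, compl_compl, nsmul_eq_mul]
    push_cast
    rfl
  rw [← h2]
  exact Finset.sum_le_sum_of_subset_of_nonneg (Finset.subset_univ _)
    fun w' _ _ => (blockDensity_pos (recvVar_pos' q h S) _).le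

/-- Typicality turns the density in the numerator bound, for the layers above `ψ`, into the one for
`S`, which cancels against the density in `sum_density_ge`. Variances and codebook sizes remain. -/
theorem posterior_le_of_typical (hN : 0 < N) {τ h : ℝ} {x : Book sz N} (hsz : ∀ l, 0 < sz l)
    {w : (l : Fin (L + 1)) → Fin (sz l)} {z : Fin N → ℂ} (htyp : Typical q τ h (pick x w) z)
    {ψ : Fin (L + 1)} {S : Finset (Fin (L + 1))} {C κ : ℝ} (hC : 0 ≤ C) (hκ : 0 < κ)
    (hnum : ∑ w' ∈ agreeing (Finset.Iic ψ) w,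
            likelihood q h x (recv q h Finset.univ (pick x w) z) w'
      ≤ C * blockDensity (recvVar q h (Finset.Ioi ψ)) (recv q h (Finset.Ioi ψ) (pick x w) z))
    (hden : κ * ∑ w', blockDensity (recvVar q h S) (recv q h Finset.univ (pick x w) z
          - fun i => ((Real.sqrt h : ℝ) : ℂ) * superpose q Sᶜ (pick x w') i)
      ≤ ∑ w', likelihood q h x (recv q h Finset.univ (pick x w) z) w') :
    (∑ w' ∈ agreeing (Finset.Iic ψ) w,
        likelihood q h x (recv q h Finset.univ (pick x w) z) w')
      / ∑ w', likelihood q h x (recv q h Finset.univ (pick x w) z) w'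
      ≤ C * ((recvVar q h S / recvVar q h (Finset.Ioi ψ) : ℝ) ^ N * Real.exp (2 * N * τ))
        / (κ * ∏ l ∈ S, (sz l : ℝ)) := by
  have hS := recvVar_pos' q h S
  have hU := recvVar_pos' q h (Finset.Ioi ψ)
  have hφS := blockDensity_pos hS (recv q h S (pick x w) z)
  have hprod : 0 < ∏ l ∈ S, (sz l : ℝ) := Finset.prod_pos fun l _ => by exact_mod_cast hsz l
  have h1 := blockDensity_le_of_typical hU hS hN (htyp (Finset.Ioi ψ)) (htyp S)
  have h2 := (mul_le_mul_of_nonneg_left (sum_density_ge q h S x w z) hκ.le).trans hden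
  have hnum' := hnum.trans (mul_le_mul_of_nonneg_left h1 hC)
  have hZ : 0 < ∑ w', likelihood q h x (recv q h Finset.univ (pick x w) z) w' :=
    lt_of_lt_of_le (by positivity) h2
  rw [div_le_div_iff₀ hZ (by positivity)]
  have hR : 0 ≤ C * ((recvVar q h S / recvVar q h (Finset.Ioi ψ) : ℝ) ^ N * Real.exp (2 * N * τ)) := by
    positivity
  calc _ ≤ (C * ((recvVar q h S / recvVar q h (Finset.Ioi ψ) : ℝ) ^ N * Real.exp (2 * N * τ)
          * blockDensity (recvVar q h S) (recv q h S (pick x w) z))) * (κ * ∏ l ∈ S, (sz l : ℝ)) :=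
        mul_le_mul_of_nonneg_right hnum' (by positivity)
    _ = C * ((recvVar q h S / recvVar q h (Finset.Ioi ψ) : ℝ) ^ N * Real.exp (2 * N * τ))
        * (κ * ((∏ l ∈ S, (sz l : ℝ)) * blockDensity (recvVar q h S) (recv q h S (pick x w) z))) := by
        ring
    _ ≤ _ := mul_le_mul_of_nonneg_left h2 hR

end LayeredKey

end

noncomputable section

namespace LayeredKey

open scoped ENNReal NNReal Topology

namespace Levels

variable {L : ℕ} (s : Levels L) {ρ : ℝ → ℝ}

/-! ### Code parameters -/

/-- The layer powers reduced by the factor `1 - θ`. -/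
def codePower (ρ : ℝ → ℝ) (θ : ℝ) (l : Fin (L + 1)) : ℝ≥0 := ((1 - θ) * s.power ρ l).toNNReal

theorem coe_codePower (hρ : ∀ u, 0 ≤ u → 0 ≤ ρ u) {θ : ℝ} (hθ : θ ≤ 1) (l : Fin (L + 1)) :
    (s.codePower ρ θ l : ℝ) = (1 - θ) * s.power ρ l :=
  Real.coe_toNNReal _ (mul_nonneg (sub_nonneg.2 hθ) (s.power_nonneg hρ l))

theorem recvVar_codePower (hρ : ∀ u, 0 ≤ u → 0 ≤ ρ u) {θ h : ℝ} (hθ : θ ≤ 1) (hh : 0 ≤ h)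
    (T : Finset (Fin (L + 1))) :
    (recvVar (s.codePower ρ θ) h T : ℝ) = 1 + (1 - θ) * h * ∑ l ∈ T, s.power ρ l := by
  rw [coe_recvVar _ hh, Finset.sum_congr rfl fun l _ => s.coe_codePower hρ hθ l, ← Finset.mul_sum]
  ring

/-- The number of codewords in layer `l`. -/
def codeSize (ρ : ℝ → ℝ) (η : ℝ) (N : ℕ) (l : Fin (L + 1)) : ℕ :=
  ⌈Real.exp (N * (s.rate ρ l - η))⌉₊

theorem codeSize_pos (ρ : ℝ → ℝ) (η : ℝ) (N : ℕ) (l : Fin (L + 1)) : 0 < s.codeSize ρ η N l :=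
  Nat.ceil_pos.2 (Real.exp_pos _)

theorem exp_le_codeSize (ρ : ℝ → ℝ) (η : ℝ) (N : ℕ) (l : Fin (L + 1)) :
    Real.exp (N * (s.rate ρ l - η)) ≤ s.codeSize ρ η N l := Nat.le_ceil _

theorem codeSize_sub_one_le (ρ : ℝ → ℝ) (η : ℝ) (N : ℕ) (l : Fin (L + 1)) :
    (s.codeSize ρ η N l : ℝ) - 1 ≤ Real.exp (N * (s.rate ρ l - η)) := by
  have := Nat.ceil_lt_add_one (Real.exp_pos (N * (s.rate ρ l - η))).le
  rw [codeSize]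
  linarith

/-- If the exponent is nonpositive there is one codeword, and the nominal rate is nonnegative.
Otherwise rounding up at most doubles, and `1 ≤ N * η` gives `2 ≤ exp (N * η)`. -/
theorem codeSize_le (hρ : ∀ u, 0 ≤ u → 0 ≤ ρ u) {η : ℝ} {N : ℕ} (hN : 1 ≤ N * η)
    (l : Fin (L + 1)) : (s.codeSize ρ η N l : ℝ) ≤ Real.exp (N * s.rate ρ l) := by
  have hr : 0 ≤ N * s.rate ρ l := mul_nonneg (by positivity) (s.rate_nonneg hρ l)
  rcases le_or_gt (N * (s.rate ρ l - η)) 0 with h | h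
  · have : s.codeSize ρ η N l ≤ 1 := by
      rw [codeSize, Nat.ceil_le]
      simpa using h
    calc (s.codeSize ρ η N l : ℝ) ≤ 1 := by exact_mod_cast this
      _ ≤ _ := Real.one_le_exp hr
  · have h1 := s.codeSize_sub_one_le ρ η N l
    have h2 : 1 ≤ Real.exp (N * (s.rate ρ l - η)) := Real.one_le_exp h.le
    have h3 : Real.exp (N * s.rate ρ l) = Real.exp (N * η) * Real.exp (N * (s.rate ρ l - η)) := by
      rw [← Real.exp_add]; ring_nf
    have h4 : 2 ≤ Real.exp (N * η) := by linarith [Real.add_one_le_exp (N * η)]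
    rw [h3]
    nlinarith

/-- Each layer loses a factor `exp (N η)`, and there are at most `L + 1` of them. -/
theorem exp_rate_le_codeSize (ρ : ℝ → ℝ) (η : ℝ) (N : ℕ) (T : Finset (Fin (L + 1)))
    (hη : 0 ≤ η) :
    Real.exp (N * ∑ l ∈ T, s.rate ρ l)
      ≤ Real.exp (N * ((L + 1) * η)) * ∏ l ∈ T, (s.codeSize ρ η N l : ℝ) := by
  have h1 : ∏ l ∈ T, Real.exp (N * (s.rate ρ l - η)) ≤ ∏ l ∈ T, (s.codeSize ρ η N l : ℝ) :=
    Finset.prod_le_prod (fun l _ => (Real.exp_pos _).le) fun l _ => s.exp_le_codeSize ρ η N l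
  refine le_trans ?_ (mul_le_mul_of_nonneg_left h1 (Real.exp_pos _).le)
  rw [← Real.exp_sum, ← Real.exp_add, Real.exp_le_exp, ← Finset.mul_sum, Finset.sum_sub_distrib,
    Finset.sum_const, nsmul_eq_mul, ← mul_add]
  refine mul_le_mul_of_nonneg_left ?_ (by positivity)
  have h2 : (T.card : ℝ) ≤ L + 1 := by
    have := T.card_le_univ
    rw [Fintype.card_fin] at this
    exact_mod_cast this
  nlinarith

/-- Layer `l` can be decoded at gains above its level. -/
theorem exp_le_recvVar_ratio (hρ : ∀ u, 0 ≤ u → 0 ≤ ρ u) {θ a h : ℝ} (hθ0 : 0 ≤ θ) (hθ : θ < 1)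
    (ha : -Real.log (1 - θ) ≤ a) (l : Fin (L + 1)) (hh : s.level l ≤ h) :
    Real.exp (s.rate ρ l - a) ≤ recvVar (s.codePower ρ θ) h (Finset.Ici l)
      / recvVar (s.codePower ρ θ) h (Finset.Ioi l) := by
  have hl := s.level_nonneg l
  have hsum := s.sum_power_nonneg hρ (Finset.Ioi l)
  have hp := s.power_nonneg hρ l
  have h1θ : 0 < 1 - θ := sub_pos.2 hθ
  have hI : ∑ i ∈ Finset.Ici l, s.power ρ i = s.power ρ l + ∑ i ∈ Finset.Ioi l, s.power ρ i := by
    rw [Finset.Ici_eq_cons_Ioi, Finset.sum_cons]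
  rw [s.recvVar_codePower hρ hθ.le (hl.trans hh), s.recvVar_codePower hρ hθ.le (hl.trans hh)]
  -- By monotonicity in the gain, it suffices to treat the gain equal to the level. The reduced
  -- powers are read as a gain reduced by `1 - θ`.
  refine le_trans ?_ (scaled_ratio_le (c := (1 - θ) * s.level l) hsum (by linarith)
    (by nlinarith) (by nlinarith) (by positivity))
  -- The slack `a` pays for the factor `1 - θ`.
  have h2 : Real.exp (s.rate ρ l - a) ≤ (1 - θ) * Real.exp (s.rate ρ l) := by
    rw [← Real.exp_log h1θ, ← Real.exp_add, Real.exp_le_exp]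
    linarith
  refine h2.trans ?_
  rw [rate, Real.exp_log (by positivity), hI]
  set σ := ∑ i ∈ Finset.Ioi l, s.power ρ i
  rw [le_div_iff₀ (by positivity)]
  have e : (1 - θ) * (1 + s.level l * s.power ρ l / (1 + s.level l * σ))
      * (1 + (1 - θ) * s.level l * σ)
      = (1 - θ) * (1 + (1 - θ) * s.level l * σ) + (1 - θ) * s.level l * s.power ρ l *
        ((1 + (1 - θ) * s.level l * σ) / (1 + s.level l * σ)) := by
    field_simp
  rw [e]
  have h3 : (1 + (1 - θ) * s.level l * σ) / (1 + s.level l * σ) ≤ 1 := by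
    rw [div_le_one (by positivity)]
    nlinarith [mul_nonneg hl hsum]
  have h4 : 0 ≤ (1 - θ) * s.level l * s.power ρ l := by positivity
  have h5 : 0 ≤ (1 - θ) * s.level l * σ := by positivity
  nlinarith [mul_le_mul_of_nonneg_left h3 h4]

/-- Once some decoded layer is hidden, all undecoded ones lie above `h` as well. The hidden and the
undecoded layers together are then all layers above Eve's gain. -/
theorem hidden_union_eq_Ioi_topLayer {ψ : Fin (L + 1)} {h : ℝ} (hh : 0 ≤ h)
    (hne : (s.hidden ψ h).Nonempty) :
    s.hidden ψ h ∪ Finset.Ioi ψ = Finset.Ioi (s.topLayer h) := by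
  ext l
  have h1 : s.topLayer h < l ↔ h < s.level l := by
    rw [← not_le, s.le_topLayer_iff hh, not_le]
  simp only [Finset.mem_union, mem_hidden, Finset.mem_Ioi, h1]
  constructor
  · rintro (h | h)
    · exact h.2
    · exact s.level_lt_of_hidden_nonempty hne h
  · intro h
    by_cases hl : l ≤ ψ
    · exact .inl ⟨hl, h⟩
    · exact .inr (not_le.1 hl)

/-- The mean number of confusable messages above layer `ψ`. -/
theorem sum_subsets_le (hρ : ∀ u, 0 ≤ u → 0 ≤ ρ u) {θ η τ h : ℝ} (hθ0 : 0 ≤ θ) (hθ : θ ≤ 1)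
    (hη : 0 ≤ η) (hh : 0 ≤ h) {ψ : Fin (L + 1)} (hne : (s.hidden ψ h).Nonempty) (N : ℕ) :
    ∑ T ∈ (Finset.Ioi ψ).powerset, (∏ l ∈ T, (s.codeSize ρ η N l : ℝ)) *
        ((recvVar (s.codePower ρ θ) h (Finset.Ioi ψ) / recvVar (s.codePower ρ θ) h T : ℝ) ^ N
          * Real.exp (2 * N * τ))
      ≤ 2 ^ (L + 1) * (Real.exp (2 * N * τ) * Real.exp (N * ((L + 1) * η)) *
        ∏ l ∈ Finset.Ioi ψ, (s.codeSize ρ η N l : ℝ)) := by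
  set B := Real.exp (2 * N * τ) * Real.exp (N * ((L + 1) * η)) *
        ∏ l ∈ Finset.Ioi ψ, (s.codeSize ρ η N l : ℝ) with hB
  have hB0 : 0 ≤ B := by positivity
  have hterm : ∀ T ∈ (Finset.Ioi ψ).powerset, (∏ l ∈ T, (s.codeSize ρ η N l : ℝ)) *
        ((recvVar (s.codePower ρ θ) h (Finset.Ioi ψ) / recvVar (s.codePower ρ θ) h T : ℝ) ^ N
          * Real.exp (2 * N * τ)) ≤ B := by
    intro T hT
    rw [Finset.mem_powerset] at hT
    -- The reduction of the powers is moved to the gain. All layers above `ψ` have levels beyond it,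
    -- so the ratio of the variances for `Finset.Ioi ψ` and `T` is at most the exponential of the
    -- rates of the missing layers.
    have h1 := s.one_add_sum_power_le hρ (h := (1 - θ) * h)
      (mul_nonneg (sub_nonneg.2 hθ) hh) (U := Finset.Ioi ψ)
      (by rw [Finset.coe_Ioi]; exact isUpperSet_Ioi ψ) (Finset.Ioi ψ \ T) fun l hl _ =>
        (by nlinarith [s.level_lt_of_hidden_nonempty hne (Finset.mem_Ioi.1 hl)])
    have e1 : ({i ∈ Finset.Ioi ψ | i ∉ Finset.Ioi ψ \ T} : Finset _) = T := by
      ext i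
      simp only [Finset.mem_filter, Finset.mem_sdiff]
      constructor
      · tauto
      · exact fun hi => ⟨hT hi, by tauto⟩
    have e2 : ({i ∈ Finset.Ioi ψ | i ∈ Finset.Ioi ψ \ T} : Finset _) = Finset.Ioi ψ \ T := by
      ext i; simp only [Finset.mem_filter, Finset.mem_sdiff]; tauto
    rw [e1, e2, ← s.recvVar_codePower hρ hθ hh, ← s.recvVar_codePower hρ hθ hh] at h1
    have hpos := recvVar_pos' (s.codePower ρ θ) h T
    have hpos' := recvVar_pos' (s.codePower ρ θ) h (Finset.Ioi ψ)
    have h2 : (recvVar (s.codePower ρ θ) h (Finset.Ioi ψ) / recvVar (s.codePower ρ θ) h T : ℝ) ^ N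
        ≤ Real.exp (N * ((L + 1) * η)) * ∏ l ∈ Finset.Ioi ψ \ T, (s.codeSize ρ η N l : ℝ) := by
      refine le_trans ?_ (s.exp_rate_le_codeSize ρ η N _ hη)
      rw [Real.exp_nat_mul]
      refine pow_le_pow_left₀ (by positivity) ?_ N
      rw [div_le_iff₀' hpos]
      exact h1
    calc _ ≤ (∏ l ∈ T, (s.codeSize ρ η N l : ℝ)) * (Real.exp (N * ((L + 1) * η)) *
          (∏ l ∈ Finset.Ioi ψ \ T, (s.codeSize ρ η N l : ℝ)) * Real.exp (2 * N * τ)) := by gcongr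
      _ = Real.exp (2 * N * τ) * Real.exp (N * ((L + 1) * η)) *
          ((∏ l ∈ Finset.Ioi ψ \ T, (s.codeSize ρ η N l : ℝ)) *
            ∏ l ∈ T, (s.codeSize ρ η N l : ℝ)) := by ring
      _ = B := by rw [Finset.prod_sdiff hT]
  refine (Finset.sum_le_card_nsmul _ _ _ hterm).trans ?_
  rw [nsmul_eq_mul, Finset.card_powerset]
  refine mul_le_mul_of_nonneg_right ?_ hB0
  push_cast
  refine pow_le_pow_right₀ one_le_two ?_
  have := (Finset.Ioi ψ).card_le_univ
  rwa [Fintype.card_fin] at this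

/-- The exponents only have to be added. The `7 τ` consists of one `τ` each from Markov, from the
factor `2 ^ (L + 1)` and from the denominator, and of two typicality terms `2 τ`. One `(L + 1) η`
comes from the numerator and one from the sizes of the hidden codebooks. The sizes above `ψ` cancel.
-/
theorem leak_bound_le (hρ : ∀ u, 0 ≤ u → 0 ≤ ρ u) {θ η τ h : ℝ} (hθ0 : 0 ≤ θ) (hθ : θ ≤ 1)
    (hη : 0 ≤ η) (hh : 0 ≤ h) {ψ : Fin (L + 1)} (hne : (s.hidden ψ h).Nonempty) {N : ℕ}
    (hN : (2 : ℝ) ^ (L + 1) ≤ Real.exp (N * τ)) :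
    Real.exp (N * τ) * (2 ^ (L + 1) * (Real.exp (2 * N * τ) * Real.exp (N * ((L + 1) * η)) *
        ∏ l ∈ Finset.Ioi ψ, (s.codeSize ρ η N l : ℝ)))
      * ((recvVar (s.codePower ρ θ) h (Finset.Ioi (s.topLayer h))
          / recvVar (s.codePower ρ θ) h (Finset.Ioi ψ) : ℝ) ^ N * Real.exp (2 * N * τ))
      / (Real.exp (-(N * τ)) * ∏ l ∈ Finset.Ioi (s.topLayer h), (s.codeSize ρ η N l : ℝ))
    ≤ Real.exp (-(N * (s.secrecyGain ρ ψ h - (7 * τ + 2 * (L + 1) * η)))) := by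
  have hS := s.hidden_union_eq_Ioi_topLayer hh hne
  have hdisj : Disjoint (s.hidden ψ h) (Finset.Ioi ψ) := by
    rw [Finset.disjoint_left]
    intro i hi hi'
    exact absurd (Finset.mem_Ioi.1 hi') (not_lt.2 (s.mem_hidden.1 hi).1)
  have hpU := s.sum_power_nonneg hρ (Finset.Ioi ψ)
  have hpS := s.sum_power_nonneg hρ (s.hidden ψ h ∪ Finset.Ioi ψ)
  have hsub : ∑ i ∈ Finset.Ioi ψ, s.power ρ i ≤ ∑ i ∈ s.hidden ψ h ∪ Finset.Ioi ψ, s.power ρ i :=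
    Finset.sum_le_sum_of_subset_of_nonneg Finset.subset_union_right
      fun l _ _ => s.power_nonneg hρ l
  have h1θ : 0 ≤ 1 - θ := sub_nonneg.2 hθ
  set lg := Real.log ((1 + h * ∑ i ∈ s.hidden ψ h ∪ Finset.Ioi ψ, s.power ρ i)
      / (1 + h * ∑ i ∈ Finset.Ioi ψ, s.power ρ i)) with hlg
  have hratio : (recvVar (s.codePower ρ θ) h (Finset.Ioi (s.topLayer h))
          / recvVar (s.codePower ρ θ) h (Finset.Ioi ψ) : ℝ) ^ N ≤ Real.exp (N * lg) := by
    have p1 := recvVar_pos' (s.codePower ρ θ) h (Finset.Ioi (s.topLayer h))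
    have p2 := recvVar_pos' (s.codePower ρ θ) h (Finset.Ioi ψ)
    rw [Real.exp_nat_mul]
    refine pow_le_pow_left₀ (by positivity) ?_ N
    rw [hlg, Real.exp_log (by positivity), ← hS, s.recvVar_codePower hρ hθ hh,
      s.recvVar_codePower hρ hθ hh]
    exact scaled_ratio_le hpU hsub hh (by nlinarith) (by positivity)
  have hprod : ∏ l ∈ Finset.Ioi (s.topLayer h), (s.codeSize ρ η N l : ℝ)
      = (∏ l ∈ s.hidden ψ h, (s.codeSize ρ η N l : ℝ))
        * ∏ l ∈ Finset.Ioi ψ, (s.codeSize ρ η N l : ℝ) := by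
    rw [← hS, Finset.prod_union hdisj]
  have hpos : ∀ T : Finset (Fin (L + 1)), 0 < ∏ l ∈ T, (s.codeSize ρ η N l : ℝ) := fun T =>
    Finset.prod_pos fun l _ => by exact_mod_cast s.codeSize_pos ρ η N l
  have hU := hpos (Finset.Ioi ψ)
  have hH := hpos (s.hidden ψ h)
  have hcnt := s.exp_rate_le_codeSize ρ η N (s.hidden ψ h) hη
  rw [hprod, div_le_iff₀ (by positivity)]
  set mH := ∏ l ∈ s.hidden ψ h, (s.codeSize ρ η N l : ℝ)
  set mU := ∏ l ∈ Finset.Ioi ψ, (s.codeSize ρ η N l : ℝ)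
  set r := ∑ l ∈ s.hidden ψ h, s.rate ρ l with hr
  have hg : s.secrecyGain ρ ψ h = r - lg := rfl
  rw [hg]
  calc _ ≤ Real.exp (N * τ) * (Real.exp (N * τ) * (Real.exp (2 * N * τ)
          * Real.exp (N * ((L + 1) * η)) * mU)) * (Real.exp (N * lg) * Real.exp (2 * N * τ)) := by
        gcongr
    _ = Real.exp (-(N * (r - lg - (7 * τ + 2 * (L + 1) * η)))) * (Real.exp (-(N * τ)) *
          (Real.exp (-(N * ((L + 1) * η))) * Real.exp (N * r) * mU)) := by
        have : ∀ a b c d e f : ℝ, Real.exp a * (Real.exp b * (Real.exp c * Real.exp d * mU)) *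
          (Real.exp e * Real.exp f) = Real.exp (a + b + c + d + e + f) * mU := by
          intros; simp only [Real.exp_add]; ring
        rw [this]
        have : ∀ a b c d : ℝ, Real.exp a * (Real.exp b * (Real.exp c * Real.exp d * mU))
           = Real.exp (a + b + c + d) * mU := by
          intros; simp only [Real.exp_add]; ring
        rw [this]
        ring_nf
    _ ≤ _ := by
        gcongr
        rw [Real.exp_neg, inv_mul_le_iff₀ (Real.exp_pos _)]
        exact hcnt

end Levels

end LayeredKey

end

noncomputable section

namespace LayeredKey

open scoped ENNReal NNReal Topology

/-! ### Averages over the codebooks and over one slot -/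

instance (N : ℕ) (v : ℝ≥0) : SFinite (gaussBlock N v) := by
  unfold gaussBlock; infer_instance

variable {L N : ℕ} {sz : Fin (L + 1) → ℕ}

/-- What happens in one slot, for codebooks of given sizes. -/
abbrev BookSlot (sz : Fin (L + 1) → ℕ) (N : ℕ) : Type :=
  ((l : Fin (L + 1)) → Fin (sz l)) × ℝ × ℝ × (Fin N → ℂ) × (Fin N → ℂ)

/-- The law of one slot, for codebooks of given sizes. -/
def bookSlotLaw (sz : Fin (L + 1) → ℕ) (N : ℕ) (μ₁ μ₂ : Measure ℝ) : Measure (BookSlot sz N) :=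
  (uniformOn (Set.univ : Set ((l : Fin (L + 1)) → Fin (sz l)))).prod (μ₁.prod (μ₂.prod
    ((gaussBlock N 1).prod (gaussBlock N 1))))

theorem isProbabilityMeasure_uniformOn (hsz : ∀ l, 0 < sz l) :
    IsProbabilityMeasure (uniformOn (Set.univ : Set ((l : Fin (L + 1)) → Fin (sz l)))) := by
  have : ∀ l, Nonempty (Fin (sz l)) := fun l => ⟨⟨0, hsz l⟩⟩
  exact ProbabilityTheory.isProbabilityMeasure_uniformOn Set.finite_univ Set.univ_nonempty

variable {μ₁ μ₂ : Measure ℝ} [IsProbabilityMeasure μ₁] [IsProbabilityMeasure μ₂]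

theorem isProbabilityMeasure_bookSlotLaw (hsz : ∀ l, 0 < sz l) :
    IsProbabilityMeasure (bookSlotLaw sz N μ₁ μ₂) := by
  have := isProbabilityMeasure_uniformOn hsz
  unfold bookSlotLaw
  infer_instance

/-- Averages over a slot are bounded by averages over the messages and the noise, uniformly in the
gains. -/
theorem lintegral_bookSlotLaw_le (hsz : ∀ l, 0 < sz l) (hμ₁ : ∀ᵐ h ∂μ₁, 0 ≤ h)
    (hμ₂ : ∀ᵐ h ∂μ₂, 0 ≤ h) {F : BookSlot sz N → ℝ≥0∞} (hF : Measurable F) {δ : ℝ≥0∞}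
    (h : ∀ h₁, 0 ≤ h₁ → ∀ h₂, 0 ≤ h₂ →
      ∫⁻ w, ∫⁻ z, F (w, h₁, h₂, z) ∂((gaussBlock N 1).prod (gaussBlock N 1))
        ∂(uniformOn (Set.univ : Set ((l : Fin (L + 1)) → Fin (sz l)))) ≤ δ) :
    ∫⁻ ω, F ω ∂(bookSlotLaw sz N μ₁ μ₂) ≤ δ := by
  have := isProbabilityMeasure_uniformOn hsz
  set U := uniformOn (Set.univ : Set ((l : Fin (L + 1)) → Fin (sz l))) with hU
  set G : ℝ × ℝ × (Fin N → ℂ) × (Fin N → ℂ) → ℝ≥0∞ := fun p => ∫⁻ w, F (w, p) ∂U with hG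
  have hGm : Measurable G := hF.lintegral_prod_left'
  have e1 : ∫⁻ ω, F ω ∂(bookSlotLaw sz N μ₁ μ₂) = ∫⁻ p, G p ∂(μ₁.prod (μ₂.prod ((gaussBlock N 1).prod (gaussBlock N 1)))) :=
    lintegral_prod_symm _ hF.aemeasurable
  rw [e1, lintegral_prod _ hGm.aemeasurable]
  have hle : ∀ᵐ h₁ ∂μ₁, ∫⁻ p, G (h₁, p) ∂(μ₂.prod ((gaussBlock N 1).prod (gaussBlock N 1))) ≤ δ := by
    filter_upwards [hμ₁] with h₁ hh₁
    have hG1 : Measurable fun p : ℝ × (Fin N → ℂ) × (Fin N → ℂ) => G (h₁, p) :=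
      hGm.comp (f := Prod.mk h₁) (g := G) measurable_prodMk_left
    rw [lintegral_prod (fun p => G (h₁, p)) hG1.aemeasurable]
    have hle2 : ∀ᵐ h₂ ∂μ₂, ∫⁻ z, G (h₁, h₂, z) ∂((gaussBlock N 1).prod (gaussBlock N 1)) ≤ δ := by
      filter_upwards [hμ₂] with h₂ hh₂
      refine le_trans (le_of_eq ?_) (h h₁ hh₁ h₂ hh₂)
      have hF2 : Measurable fun p : ((l : Fin (L + 1)) → Fin (sz l)) × ((Fin N → ℂ) × (Fin N → ℂ)) =>
          F (p.1, h₁, h₂, p.2) := by fun_prop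
      exact lintegral_lintegral_swap (f := fun z w => F (w, h₁, h₂, z))
        (hF2.comp measurable_swap).aemeasurable
    refine (lintegral_mono_ae hle2).trans ?_
    simp
  refine (lintegral_mono_ae hle).trans ?_
  simp

/-- The mean over the codebooks of the probability of an event that involves Bob's noise only. -/
theorem lintegral_book_event₁_le (hsz : ∀ l, 0 < sz l) (hμ₁ : ∀ᵐ h ∂μ₁, 0 ≤ h)
    (hμ₂ : ∀ᵐ h ∂μ₂, 0 ≤ h)
    {E : ((l : Fin (L + 1)) → Fin (sz l)) → ℝ → (Fin N → ℂ) → Book sz N → Prop}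
    (hE : ∀ w, MeasurableSet {p : ℝ × (Fin N → ℂ) × Book sz N | E w p.1 p.2.1 p.2.2}) {δ : ℝ≥0∞}
    (h : ∀ h₁, 0 ≤ h₁ → ∀ w, ∫⁻ z, bookLaw sz N {x | E w h₁ z x} ∂(gaussBlock N 1) ≤ δ) :
    Measurable (fun x => bookSlotLaw sz N μ₁ μ₂ {ω | E ω.1 ω.2.1 ω.2.2.2.1 x}) ∧
      ∫⁻ x, bookSlotLaw sz N μ₁ μ₂ {ω | E ω.1 ω.2.1 ω.2.2.2.1 x} ∂(bookLaw sz N) ≤ δ := by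
  have := isProbabilityMeasure_uniformOn hsz
  have := isProbabilityMeasure_bookSlotLaw (N := N) (μ₁ := μ₁) (μ₂ := μ₂) hsz
  have hE' : MeasurableSet {p : ((l : Fin (L + 1)) → Fin (sz l)) × (ℝ × (Fin N → ℂ) × Book sz N) |
      E p.1 p.2.1 p.2.2.1 p.2.2.2} := by
    have : {p : ((l : Fin (L + 1)) → Fin (sz l)) × (ℝ × (Fin N → ℂ) × Book sz N) |
      E p.1 p.2.1 p.2.2.1 p.2.2.2} = ⋃ w, ({w} : Set _) ×ˢ
        {p : ℝ × (Fin N → ℂ) × Book sz N | E w p.1 p.2.1 p.2.2} := by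
      ext p; simp
    rw [this]
    exact MeasurableSet.iUnion fun w => (measurableSet_singleton w).prod (hE w)
  set S : Set (Book sz N × BookSlot sz N) := {p | E p.2.1 p.2.2.1 p.2.2.2.2.1 p.1} with hS
  have hSm : MeasurableSet S := by
    have hm : Measurable fun p : Book sz N × BookSlot sz N =>
      (p.2.1, p.2.2.1, p.2.2.2.2.1, p.1) := by fun_prop
    exact hm hE'
  refine ⟨measurable_measure_prodMk_left hSm, ?_⟩
  calc _ = ((bookLaw sz N).prod (bookSlotLaw sz N μ₁ μ₂)) S := (Measure.prod_apply hSm).symm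
    _ = ∫⁻ ω, bookLaw sz N {x | E ω.1 ω.2.1 ω.2.2.2.1 x} ∂(bookSlotLaw sz N μ₁ μ₂) :=
        Measure.prod_apply_symm hSm
    _ ≤ δ := by
      refine lintegral_bookSlotLaw_le hsz hμ₁ hμ₂ (measurable_measure_prodMk_right hSm)
        fun h₁ hh₁ h₂ _ => ?_
      have : ∀ w, ∫⁻ z, bookLaw sz N {x | E w h₁ z.1 x} ∂((gaussBlock N 1).prod (gaussBlock N 1))
          ≤ δ := by
        intro w
        have hm : Measurable fun z : Fin N → ℂ => bookLaw sz N {x | E w h₁ z x} := by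
          have hm2 : Measurable fun p : (Fin N → ℂ) × Book sz N => (w, h₁, p.1, p.2) := by fun_prop
          exact measurable_measure_prodMk_left (hm2 hE')
        have e := lintegral_prod (μ := gaussBlock N 1) (ν := gaussBlock N 1)
          (fun z => bookLaw sz N {x | E w h₁ z.1 x}) (hm.comp measurable_fst).aemeasurable
        rw [e]
        simpa using h h₁ hh₁ w
      refine (lintegral_mono this).trans ?_
      simp

/-- The mean over the codebooks of the probability of an event that involves Eve's noise only. -/
theorem lintegral_book_event₂_le (hsz : ∀ l, 0 < sz l) (hμ₁ : ∀ᵐ h ∂μ₁, 0 ≤ h)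
    (hμ₂ : ∀ᵐ h ∂μ₂, 0 ≤ h)
    {E : ((l : Fin (L + 1)) → Fin (sz l)) → ℝ → ℝ → (Fin N → ℂ) → Book sz N → Prop}
    (hE : ∀ w, MeasurableSet {p : ℝ × ℝ × (Fin N → ℂ) × Book sz N | E w p.1 p.2.1 p.2.2.1 p.2.2.2})
    {δ : ℝ≥0∞}
    (h : ∀ h₁, 0 ≤ h₁ → ∀ h₂, 0 ≤ h₂ → ∫⁻ w, ∫⁻ z, bookLaw sz N {x | E w h₁ h₂ z x}
      ∂(gaussBlock N 1) ∂(uniformOn (Set.univ : Set ((l : Fin (L + 1)) → Fin (sz l)))) ≤ δ) :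
    Measurable (fun x => bookSlotLaw sz N μ₁ μ₂ {ω | E ω.1 ω.2.1 ω.2.2.1 ω.2.2.2.2 x}) ∧
      ∫⁻ x, bookSlotLaw sz N μ₁ μ₂ {ω | E ω.1 ω.2.1 ω.2.2.1 ω.2.2.2.2 x} ∂(bookLaw sz N) ≤ δ := by
  have := isProbabilityMeasure_uniformOn hsz
  have := isProbabilityMeasure_bookSlotLaw (N := N) (μ₁ := μ₁) (μ₂ := μ₂) hsz
  have hE' : MeasurableSet {p : ((l : Fin (L + 1)) → Fin (sz l)) ×
      (ℝ × ℝ × (Fin N → ℂ) × Book sz N) | E p.1 p.2.1 p.2.2.1 p.2.2.2.1 p.2.2.2.2} := by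
    have : {p : ((l : Fin (L + 1)) → Fin (sz l)) × (ℝ × ℝ × (Fin N → ℂ) × Book sz N) |
      E p.1 p.2.1 p.2.2.1 p.2.2.2.1 p.2.2.2.2} = ⋃ w, ({w} : Set _) ×ˢ
        {p : ℝ × ℝ × (Fin N → ℂ) × Book sz N | E w p.1 p.2.1 p.2.2.1 p.2.2.2} := by
      ext p; simp
    rw [this]
    exact MeasurableSet.iUnion fun w => (measurableSet_singleton w).prod (hE w)
  set S : Set (Book sz N × BookSlot sz N) := {p | E p.2.1 p.2.2.1 p.2.2.2.1 p.2.2.2.2.2 p.1} with hS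
  have hSm : MeasurableSet S := by
    have hm : Measurable fun p : Book sz N × BookSlot sz N =>
      (p.2.1, p.2.2.1, p.2.2.2.1, p.2.2.2.2.2, p.1) := by fun_prop
    exact hm hE'
  refine ⟨measurable_measure_prodMk_left hSm, ?_⟩
  calc _ = ((bookLaw sz N).prod (bookSlotLaw sz N μ₁ μ₂)) S := (Measure.prod_apply hSm).symm
    _ = ∫⁻ ω, bookLaw sz N {x | E ω.1 ω.2.1 ω.2.2.1 ω.2.2.2.2 x} ∂(bookSlotLaw sz N μ₁ μ₂) :=
        Measure.prod_apply_symm hSm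
    _ ≤ δ := by
      refine lintegral_bookSlotLaw_le hsz hμ₁ hμ₂ (measurable_measure_prodMk_right hSm)
        fun h₁ hh₁ h₂ hh₂ => ?_
      -- The average over the messages is kept, unlike for Bob's event: the lower bound for Eve's
      -- denominator holds only in this average.
      refine le_trans (lintegral_mono fun w => ?_) (h h₁ hh₁ h₂ hh₂)
      have hm : Measurable fun z : Fin N → ℂ => bookLaw sz N {x | E w h₁ h₂ z x} := by
        have hm2 : Measurable fun p : (Fin N → ℂ) × Book sz N => (w, h₁, h₂, p.1, p.2) := by
          fun_prop
        exact measurable_measure_prodMk_left (hm2 hE')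
      have e := lintegral_prod (μ := gaussBlock N 1) (ν := gaussBlock N 1)
        (fun z => bookLaw sz N {x | E w h₁ h₂ z.2 x}) (hm.comp measurable_snd).aemeasurable
      refine (le_of_eq e).trans ?_
      simp

/-! ### Bob's error event -/

variable (q : Fin (L + 1) → ℝ≥0)

/-- Bob's block is atypical or a wrong codeword looks likely. -/
def BobFails (τ : ℝ) (t : Fin (L + 1) → ℝ) (w : (l : Fin (L + 1)) → Fin (sz l)) (h : ℝ)
    (z : Fin N → ℂ) (x : Book sz N) : Prop :=
  ¬ Typical q τ h (pick x w) z ∨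
    ∃ l j, w l ≠ j ∧ Passes q (t l) x l j h (recv q h (Finset.Ici l) (pick x w) z)

theorem measurableSet_passes (t : ℝ) (w : (l : Fin (L + 1)) → Fin (sz l)) (l : Fin (L + 1))
    (j : Fin (sz l)) {α : Type*} [MeasurableSpace α] {f : α → ℝ}
    {x : α → Book sz N} {z : α → Fin N → ℂ} (hf : Measurable f) (hx : Measurable x)
    (hz : Measurable z) :
    MeasurableSet {a | Passes q t (x a) l j (f a)
      (recv q (f a) (Finset.Ici l) (pick (x a) w) (z a))} := by
  have h0 : Measurable fun a => recv q (f a) (Finset.Ici l) (pick (x a) w) (z a) :=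
    measurable_recv q _ hf ((measurable_pick w).comp hx) hz
  have h1 : Measurable fun a => (recvVar q (f a) (Finset.Ici l) : ℝ) :=
    (measurable_recvVar q (Finset.Ici l)).comp hf
  have h2 : Measurable fun a => (recvVar q (f a) (Finset.Ioi l) : ℝ) :=
    (measurable_recvVar q (Finset.Ioi l)).comp hf
  have h3 : Measurable fun a => (recv q (f a) (Finset.Ici l) (pick (x a) w) (z a) - fun i =>
      ((Real.sqrt (f a) : ℝ) : ℂ) * (((Real.sqrt (q l) : ℝ) : ℂ) * x a l j i)) := by fun_prop
  exact measurableSet_le ((measurable_blockDensity_comp h1 h0).const_mul _)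
    (measurable_blockDensity_comp h2 h3)

theorem measurableSet_bobFails (τ : ℝ) (t : Fin (L + 1) → ℝ)
    (w : (l : Fin (L + 1)) → Fin (sz l)) {α : Type*} [MeasurableSpace α] {f : α → ℝ}
    {x : α → Book sz N} {z : α → Fin N → ℂ} (hf : Measurable f) (hx : Measurable x)
    (hz : Measurable z) : MeasurableSet {a | BobFails q τ t w (f a) (z a) (x a)} := by
  have e : {a | ∃ l j, w l ≠ j ∧ Passes q (t l) (x a) l j (f a)
      (recv q (f a) (Finset.Ici l) (pick (x a) w) (z a))} = ⋃ l, ⋃ j, {_a | w l ≠ j} ∩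
        {a | Passes q (t l) (x a) l j (f a)
          (recv q (f a) (Finset.Ici l) (pick (x a) w) (z a))} := by
    ext a; simp
  have h2 : MeasurableSet {a | ∃ l j, w l ≠ j ∧ Passes q (t l) (x a) l j (f a)
      (recv q (f a) (Finset.Ici l) (pick (x a) w) (z a))} := by
    rw [e]
    exact MeasurableSet.iUnion fun l => MeasurableSet.iUnion fun j =>
      (MeasurableSet.const _).inter (measurableSet_passes q (t l) w l j hf hx hz)
  exact (measurableSet_typical q τ hf ((measurable_pick w).comp hx) hz).compl.union h2

/-- A union bound. Only the `sz l - 1` wrong codewords are counted, which also removes the effect of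
rounding up the codebook size. -/
theorem lintegral_bobFails_le (hN : 0 < N) {τ : ℝ} (hτ : 0 < τ) (t : Fin (L + 1) → ℝ) (h : ℝ)
    (w : (l : Fin (L + 1)) → Fin (sz l)) :
    ∫⁻ z, bookLaw sz N {x | BobFails q τ t w h z x} ∂(gaussBlock N 1)
      ≤ 2 ^ (L + 1) * ENNReal.ofReal (energyVar / N / τ ^ 2)
        + ∑ l, ENNReal.ofReal (((sz l : ℝ) - 1) * Real.exp (-(N * t l))) := by
  classical
  have hpt : ∀ z, bookLaw sz N {x | BobFails q τ t w h z x}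
      ≤ bookLaw sz N {x | ¬ Typical q τ h (pick x w) z}
        + ∑ l, ∑ j ∈ Finset.univ.erase (w l), bookLaw sz N
          {x | Passes q (t l) x l j h (recv q h (Finset.Ici l) (pick x w) z)} := by
    intro z
    have hsub : {x : Book sz N | BobFails q τ t w h z x} ⊆
        {x | ¬ Typical q τ h (pick x w) z} ∪ ⋃ l ∈ (Finset.univ : Finset (Fin (L + 1))),
          ⋃ j ∈ Finset.univ.erase (w l),
            {x | Passes q (t l) x l j h (recv q h (Finset.Ici l) (pick x w) z)} := by
      rintro x (hx | ⟨l, j, hj, hx⟩)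
      · exact .inl hx
      · refine .inr ?_
        simp only [Set.mem_iUnion]
        exact ⟨l, Finset.mem_univ _, j, Finset.mem_erase.2 ⟨hj.symm, Finset.mem_univ _⟩, hx⟩
    refine (measure_mono hsub).trans ((measure_union_le _ _).trans ?_)
    gcongr
    refine (measure_biUnion_finset_le _ _).trans (Finset.sum_le_sum fun l _ => ?_)
    exact measure_biUnion_finset_le _ _
  have hm : ∀ l j, Measurable fun z : Fin N → ℂ => bookLaw sz N
          {x | Passes q (t l) x l j h (recv q h (Finset.Ici l) (pick x w) z)} := fun l j =>
    measurable_measure_prodMk_left (s := {p : (Fin N → ℂ) × Book sz N |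
      Passes q (t l) p.2 l j h (recv q h (Finset.Ici l) (pick p.2 w) p.1)})
      (measurableSet_passes q (t l) w l j measurable_const measurable_snd measurable_fst)
  refine (lintegral_mono hpt).trans ?_
  rw [lintegral_add_right _ (Finset.measurable_sum _ fun l _ => Finset.measurable_sum _
      fun j _ => hm l j),
    lintegral_finsetSum _ fun l _ => Finset.measurable_sum _ fun j _ => hm l j]
  refine add_le_add (lintegral_not_typical_le q hN hτ h w) (Finset.sum_le_sum fun l _ => ?_)
  rw [lintegral_finsetSum _ fun j _ => hm l j]
  have hw : 1 ≤ sz l := (Nat.zero_le _).trans_lt (w l).2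
  calc _ ≤ ∑ j ∈ Finset.univ.erase (w l), ENNReal.ofReal (Real.exp (-(N * t l))) :=
        Finset.sum_le_sum fun j hj =>
          lintegral_false_alarm_le q h (t l) w l (Finset.ne_of_mem_erase hj).symm
    _ = _ := by
        rw [Finset.sum_const, Finset.card_erase_of_mem (Finset.mem_univ _), Finset.card_univ,
          Fintype.card_fin, nsmul_eq_mul, ENNReal.ofReal_mul (by simpa using hw),
          ← ENNReal.ofReal_natCast, Nat.cast_sub hw, Nat.cast_one]

end LayeredKey

end

noncomputable section

namespace LayeredKey

open scoped ENNReal NNReal Topology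

variable {L N : ℕ} {sz : Fin (L + 1) → ℕ} (q : Fin (L + 1) → ℝ≥0)

/-! ### What Eve learns -/

/-- The posterior probability, given the block `y`, of the messages in the layers up to `ψ`. -/
def classPosterior (h : ℝ) (x : Book sz N) (y : Fin N → ℂ) (ψ : Fin (L + 1))
    (w : (l : Fin (L + 1)) → Fin (sz l)) : ℝ :=
  (∑ w' ∈ agreeing (Finset.Iic ψ) w, likelihood q h x y w') / ∑ w', likelihood q h x y w'

theorem classPosterior_nonneg (h : ℝ) (x : Book sz N) (y : Fin N → ℂ) (ψ : Fin (L + 1))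
    (w : (l : Fin (L + 1)) → Fin (sz l)) : 0 ≤ classPosterior q h x y ψ w :=
  div_nonneg (Finset.sum_nonneg fun _ _ => (likelihood_pos q h x y _).le)
    (Finset.sum_nonneg fun _ _ => (likelihood_pos q h x y _).le)

theorem classPosterior_le_one (h : ℝ) (x : Book sz N) (y : Fin N → ℂ) (ψ : Fin (L + 1))
    (w : (l : Fin (L + 1)) → Fin (sz l)) : classPosterior q h x y ψ w ≤ 1 :=
  div_le_one_of_le₀ (Finset.sum_le_sum_of_subset_of_nonneg (Finset.subset_univ _)
    fun _ _ _ => (likelihood_pos q h x y _).le)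
    (Finset.sum_nonneg fun _ _ => (likelihood_pos q h x y _).le)

@[fun_prop]
theorem measurable_classPosterior (ψ : Fin (L + 1)) (w : (l : Fin (L + 1)) → Fin (sz l))
    {α : Type*} [MeasurableSpace α] {f : α → ℝ} {x : α → Book sz N} {y : α → Fin N → ℂ}
    (hf : Measurable f) (hx : Measurable x) (hy : Measurable y) :
    Measurable fun t => classPosterior q (f t) (x t) (y t) ψ w := by
  unfold classPosterior
  fun_prop

variable (s : Levels L) {ρ : ℝ → ℝ}

/-- The posterior probability of the messages up to layer `ψ` exceeds the secrecy gain by `κ`. -/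
def EveLearns (ρ : ℝ → ℝ) (κ : ℝ) (ψ : Fin (L + 1)) (w : (l : Fin (L + 1)) → Fin (sz l)) (h : ℝ)
    (z : Fin N → ℂ) (x : Book sz N) : Prop :=
  Real.exp (-(N * (s.secrecyGain ρ ψ h - κ)))
    < classPosterior q h x (recv q h Finset.univ (pick x w) z) ψ w

theorem measurableSet_eveLearns (ρ : ℝ → ℝ) (κ : ℝ) (w : (l : Fin (L + 1)) → Fin (sz l)) :
    MeasurableSet {p : ℝ × ℝ × (Fin N → ℂ) × Book sz N |
      EveLearns q s ρ κ (s.topLayer p.1) w p.2.1 p.2.2.1 p.2.2.2} := by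
  have e : {p : ℝ × ℝ × (Fin N → ℂ) × Book sz N |
      EveLearns q s ρ κ (s.topLayer p.1) w p.2.1 p.2.2.1 p.2.2.2}
      = ⋃ ψ, (Prod.fst ⁻¹' (s.topLayer ⁻¹' {ψ})) ∩ {p : ℝ × ℝ × (Fin N → ℂ) × Book sz N |
          EveLearns q s ρ κ ψ w p.2.1 p.2.2.1 p.2.2.2} := by
    ext p; simp
  rw [e]
  refine MeasurableSet.iUnion fun ψ => (measurable_fst (s.measurable_topLayer
    (measurableSet_singleton ψ))).inter ?_
  have hψ : Measurable (s.secrecyGain ρ ψ) :=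
    (s.measurable_secrecyGain ρ).comp (f := fun h : ℝ => (ψ, h)) (by fun_prop)
  have h1 : Measurable fun p : ℝ × ℝ × (Fin N → ℂ) × Book sz N =>
      Real.exp (-(N * (s.secrecyGain ρ ψ p.2.1 - κ))) := by fun_prop
  have h2 : Measurable fun p : ℝ × ℝ × (Fin N → ℂ) × Book sz N =>
      classPosterior q p.2.1 p.2.2.2 (recv q p.2.1 Finset.univ (pick p.2.2.2 w) p.2.2.1) ψ w := by
    fun_prop
  exact measurableSet_lt h1 h2

/-- The messages up to layer `ψ` rarely have a posterior probability above the secrecy gain. -/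
theorem lintegral_leak_le (hρ : ∀ u, 0 ≤ u → 0 ≤ ρ u) {θ η τ h : ℝ} (hθ0 : 0 ≤ θ) (hθ : θ ≤ 1)
    (hη : 0 ≤ η) (hτ : 0 < τ) (hh : 0 ≤ h) (ψ : Fin (L + 1)) (hN0 : 0 < N)
    (hN : (2 : ℝ) ^ (L + 1) ≤ Real.exp (N * τ)) :
    ∫⁻ w, ∫⁻ z, bookLaw (s.codeSize ρ η N) N
      {x | EveLearns (s.codePower ρ θ) s ρ (7 * τ + 2 * (L + 1) * η) ψ w h z x} ∂(gaussBlock N 1)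
      ∂(uniformOn (Set.univ : Set ((l : Fin (L + 1)) → Fin (s.codeSize ρ η N l))))
    ≤ 2 ^ (L + 1) * ENNReal.ofReal (energyVar / N / τ ^ 2)
      + (ENNReal.ofReal (Real.exp (-(N * τ))) + ENNReal.ofReal (Real.exp (-(N * τ)))) := by
  have hsz := s.codeSize_pos ρ η N
  have := isProbabilityMeasure_uniformOn hsz
  set sz := s.codeSize ρ η N with hszdef
  set q := s.codePower ρ θ with hq
  -- With nothing hidden the gain is zero and the threshold is at least one, which no probability
  -- exceeds.
  rcases (s.hidden ψ h).eq_empty_or_nonempty with he | hne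
  · have : ∀ (w : (l : Fin (L + 1)) → Fin (sz l)) (z : Fin N → ℂ),
        {x : Book sz N | EveLearns q s ρ (7 * τ + 2 * (L + 1) * η) ψ w h z x} = ∅ := by
      intro w z
      refine Set.eq_empty_of_forall_notMem fun x hx => ?_
      rw [Set.mem_ofPred_eq, EveLearns, s.secrecyGain_of_hidden_empty he] at hx
      have h1 : 1 ≤ Real.exp (-(N * (0 - (7 * τ + 2 * (L + 1) * η)))) := by
        refine Real.one_le_exp ?_
        rw [zero_sub, mul_neg, neg_neg]
        positivity
      exact absurd (lt_of_le_of_lt h1 hx) (not_lt.2 (classPosterior_le_one q h x _ ψ w))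
    simp only [this]
    simp
  -- In the comparison density, exactly the layers above Eve's gain are replaced by Gaussian noise.
  set S := Finset.Ioi (s.topLayer h) with hS
  set B := 2 ^ (L + 1) * (Real.exp (2 * N * τ) * Real.exp (N * ((L + 1) * η)) *
        ∏ l ∈ Finset.Ioi ψ, (sz l : ℝ)) with hB
  -- `B` bounds the mean of the numerator, so this choice makes Markov give `exp (-(N * τ))`.
  set C := Real.exp (N * τ) * B with hC
  have hB0 : 0 < B := by
    have : 0 < ∏ l ∈ Finset.Ioi ψ, (sz l : ℝ) :=
      Finset.prod_pos fun l _ => by exact_mod_cast hsz l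
    positivity
  have hC0 : 0 < C := by positivity
  set E1 : ((l : Fin (L + 1)) → Fin (sz l)) → (Fin N → ℂ) → Set (Book sz N) := fun w z =>
    {x | ¬ Typical q τ h (pick x w) z} with hE1
  set E2 : ((l : Fin (L + 1)) → Fin (sz l)) → (Fin N → ℂ) → Set (Book sz N) := fun w z =>
    {x | Typical q τ h (pick x w) z ∧
        C * blockDensity (recvVar q h (Finset.Ioi ψ)) (recv q h (Finset.Ioi ψ) (pick x w) z)
          < ∑ w' ∈ agreeing (Finset.Iic ψ) w,
            likelihood q h x (recv q h Finset.univ (pick x w) z) w'} with hE2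
  set E3 : ((l : Fin (L + 1)) → Fin (sz l)) → (Fin N → ℂ) → Set (Book sz N) := fun w z =>
    {x | ∑ w', likelihood q h x (recv q h Finset.univ (pick x w) z) w'
        < Real.exp (-(N * τ)) * ∑ w', blockDensity (recvVar q h S)
          (recv q h Finset.univ (pick x w) z
          - fun i => ((Real.sqrt h : ℝ) : ℂ) * superpose q Sᶜ (pick x w') i)} with hE3
  have hT : ∀ w : (l : Fin (L + 1)) → Fin (sz l), MeasurableSet {p : (Fin N → ℂ) × Book sz N |
      Typical q τ h (pick p.2 w) p.1} := fun w =>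
    measurableSet_typical q τ measurable_const (by fun_prop) (by fun_prop)
  have m1 : ∀ w, Measurable fun z => bookLaw sz N (E1 w z) := fun w =>
    measurable_measure_prodMk_left (hT w).compl
  have m2 : ∀ w, Measurable fun z => bookLaw sz N (E2 w z) := fun w => by
    have hm1 : Measurable fun p : (Fin N → ℂ) × Book sz N => C *
        blockDensity (recvVar q h (Finset.Ioi ψ)) (recv q h (Finset.Ioi ψ) (pick p.2 w) p.1) := by
      fun_prop
    have hm2 : Measurable fun p : (Fin N → ℂ) × Book sz N =>
        ∑ w' ∈ agreeing (Finset.Iic ψ) w,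
          likelihood q h p.2 (recv q h Finset.univ (pick p.2 w) p.1) w' := by fun_prop
    exact measurable_measure_prodMk_left ((hT w).inter (measurableSet_lt hm1 hm2))
  have ms3 : ∀ w, MeasurableSet {p : (Fin N → ℂ) × Book sz N | p.2 ∈ E3 w p.1} := fun w => by
    have hm1 : Measurable fun p : (Fin N → ℂ) × Book sz N => ∑ w',
          likelihood q h p.2 (recv q h Finset.univ (pick p.2 w) p.1) w' := by fun_prop
    have hm2 : Measurable fun p : (Fin N → ℂ) × Book sz N => Real.exp (-(N * τ)) *
        ∑ w', blockDensity (recvVar q h S) (recv q h Finset.univ (pick p.2 w) p.1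
          - fun i => ((Real.sqrt h : ℝ) : ℂ) * superpose q Sᶜ (pick p.2 w') i) := by fun_prop
    exact measurableSet_lt hm1 hm2
  have hsub : ∀ w z, bookLaw sz N
      {x | EveLearns q s ρ (7 * τ + 2 * (L + 1) * η) ψ w h z x}
      ≤ bookLaw sz N (E1 w z) + (bookLaw sz N (E2 w z) + bookLaw sz N (E3 w z)) := by
    intro w z
    refine le_trans (measure_mono fun x hx => ?_) ((measure_union_le (E1 w z) (E2 w z ∪ E3 w z)).trans
      (add_le_add le_rfl (measure_union_le _ _)))
    by_contra hc
    simp only [Set.mem_union, not_or] at hc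
    obtain ⟨h1, h2, h3⟩ := hc
    have htyp : Typical q τ h (pick x w) z := not_not.1 h1
    have hnum := not_lt.1 fun h => h2 ⟨htyp, h⟩
    simp only [hE3, Set.mem_ofPred_eq, not_lt] at h3
    have hle := posterior_le_of_typical q hN0 hsz htyp hC0.le (Real.exp_pos (-(N * τ))) hnum h3
    have hle2 := s.leak_bound_le hρ hθ0 hθ hη hh hne hN
    exact absurd hx (not_lt.2 (hle.trans hle2))
  have i1 : ∀ w, ∫⁻ z, bookLaw sz N (E1 w z) ∂(gaussBlock N 1)
      ≤ 2 ^ (L + 1) * ENNReal.ofReal (energyVar / N / τ ^ 2) := fun w =>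
    lintegral_not_typical_le q hN0 hτ h w
  have i2 : ∀ w, ∫⁻ z, bookLaw sz N (E2 w z) ∂(gaussBlock N 1)
      ≤ ENNReal.ofReal (Real.exp (-(N * τ))) := fun w => by
    refine (lintegral_numerator_le q hN0 τ h w ψ hC0).trans (ENNReal.ofReal_le_ofReal ?_)
    rw [div_le_iff₀ hC0, hC, ← mul_assoc, ← Real.exp_add]
    refine (s.sum_subsets_le hρ hθ0 hθ hη hh hne N).trans (le_of_eq ?_)
    rw [neg_add_cancel, Real.exp_zero, one_mul, hB]
  -- The denominator bound holds for every codebook, so the codebook integral is moved outside.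
  have i3 : ∫⁻ w, ∫⁻ z, bookLaw sz N (E3 w z) ∂(gaussBlock N 1)
      ∂(uniformOn (Set.univ : Set ((l : Fin (L + 1)) → Fin (sz l))))
      ≤ ENNReal.ofReal (Real.exp (-(N * τ))) := by
    have e1 : ∀ w, ∫⁻ z, bookLaw sz N (E3 w z) ∂(gaussBlock N 1)
        = ∫⁻ x, gaussBlock N 1 {z | x ∈ E3 w z} ∂(bookLaw sz N) := fun w =>
      (Measure.prod_apply (ms3 w)).symm.trans (Measure.prod_apply_symm (ms3 w))
    have hmx : ∀ w, Measurable fun x => gaussBlock N 1 {z | x ∈ E3 w z} := fun w =>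
      measurable_measure_prodMk_right (ms3 w)
    simp only [e1]
    have : ∀ l, Nonempty (Fin (sz l)) := fun l => ⟨⟨0, hsz l⟩⟩
    rw [lintegral_uniformOn_univ, ← lintegral_finsetSum _ fun w _ => hmx w,
      ← lintegral_const_mul _ (Finset.measurable_sum _ fun w _ => hmx w)]
    have hx : ∀ x, ((Fintype.card ((l : Fin (L + 1)) → Fin (sz l)) : ℝ≥0∞))⁻¹
        * ∑ w, gaussBlock N 1 {z | x ∈ E3 w z} ≤ ENNReal.ofReal (Real.exp (-(N * τ))) := fun x => by
      rw [← lintegral_uniformOn_univ]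
      exact lintegral_denominator_le q h hsz x S (Real.exp_pos _).le
    refine (lintegral_mono hx).trans ?_
    simp
  calc _ ≤ ∫⁻ w, (2 ^ (L + 1) * ENNReal.ofReal (energyVar / N / τ ^ 2)
          + (ENNReal.ofReal (Real.exp (-(N * τ)))
            + ∫⁻ z, bookLaw sz N (E3 w z) ∂(gaussBlock N 1)))
          ∂(uniformOn (Set.univ : Set ((l : Fin (L + 1)) → Fin (sz l)))) := by
        refine lintegral_mono fun w => (lintegral_mono (hsub w)).trans ?_
        rw [lintegral_add_left (m1 w), lintegral_add_left (m2 w)]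
        exact add_le_add (i1 w) (add_le_add (i2 w) le_rfl)
    _ ≤ _ := by
        rw [lintegral_add_left measurable_const, lintegral_add_left measurable_const]
        simp only [lintegral_const, measure_univ, mul_one]
        exact add_le_add le_rfl (add_le_add le_rfl i3)

/-! ### Powers -/

/-- By Cauchy–Schwarz the square of the average is at most the average of the squares. Independence
is not needed; the blocks of different message tuples may share codewords. -/
theorem measure_average_deviation_le {Ω ι : Type*} [MeasurableSpace Ω] [Fintype ι] [Nonempty ι]
    (μ : Measure Ω) {g : ι → Ω → ℝ} (hg : ∀ i, Measurable (g i)) {c t : ℝ} (ht : 0 < t)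
    (h : ∀ i, ∫⁻ ω, ENNReal.ofReal (g i ω ^ 2) ∂μ ≤ ENNReal.ofReal c) :
    μ {ω | t ≤ |(∑ i, g i ω) / Fintype.card ι|} ≤ ENNReal.ofReal (c / t ^ 2) := by
  have hcard : (0 : ℝ) < Fintype.card ι := by exact_mod_cast Fintype.card_pos
  refine measure_le_of_lintegral_sq
    ((Finset.measurable_sum _ fun i _ => hg i).div_const _).aemeasurable ht ?_
  have hpt : ∀ ω, ENNReal.ofReal (((∑ i, g i ω) / Fintype.card ι) ^ 2)
      ≤ ENNReal.ofReal ((Fintype.card ι : ℝ)⁻¹) * ∑ i, ENNReal.ofReal (g i ω ^ 2) := by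
    intro ω
    rw [← ENNReal.ofReal_sum_of_nonneg fun i _ => sq_nonneg _, ← ENNReal.ofReal_mul (by positivity)]
    refine ENNReal.ofReal_le_ofReal ?_
    have := sq_sum_le_card_mul_sum_sq (s := Finset.univ) (f := fun i => g i ω)
    rw [Finset.card_univ] at this
    rw [div_pow, div_le_iff₀ (by positivity)]
    calc _ ≤ _ := this
      _ = _ := by field_simp
  refine (lintegral_mono hpt).trans ?_
  rw [lintegral_const_mul' _ _ ENNReal.ofReal_ne_top,
    lintegral_finsetSum _ fun i _ => ((hg i).pow_const 2).ennreal_ofReal]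
  refine (mul_le_mul_right (Finset.sum_le_sum fun i _ => h i) _).trans (le_of_eq ?_)
  rw [Finset.sum_const, nsmul_eq_mul, ← mul_assoc, Finset.card_univ, ← ENNReal.ofReal_natCast,
    ← ENNReal.ofReal_mul (by positivity), inv_mul_cancel₀ hcard.ne']
  simp

theorem bookLaw_layer_deviation_le (hN : 0 < N) (hsz : ∀ l, 0 < sz l) {t : ℝ} (ht : 0 < t)
    (l : Fin (L + 1)) :
    bookLaw sz N {x | t ≤ |(∑ j, (energy (x l j) / N - 1)) / sz l|}
      ≤ ENNReal.ofReal (energyVar / N / t ^ 2) := by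
  have : Nonempty (Fin (sz l)) := ⟨⟨0, hsz l⟩⟩
  have h := measure_average_deviation_le (bookLaw sz N)
    (g := fun (j : Fin (sz l)) x => energy (x l j) / N - 1) (fun j => by fun_prop)
    (c := energyVar / N) ht fun j => ?_
  · rwa [Fintype.card_fin] at h
  · have h1 := lintegral_energy_sq_deviation hN 1
    simp only [NNReal.coe_one, one_pow, one_mul] at h1
    have mp : MeasurePreserving (fun x : Book sz N => x l j) (bookLaw sz N) (gaussBlock N 1) :=
      (measurePreserving_eval (fun _ : Fin (sz l) => gaussBlock N 1) j).comp
        (measurePreserving_eval (fun l : Fin (L + 1) =>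
          Measure.pi fun _ : Fin (sz l) => gaussBlock N 1) l)
    rw [← h1, ← mp.lintegral_comp (f := fun y => ENNReal.ofReal ((energy y / N - 1) ^ 2))
      (by fun_prop)]

theorem bookLaw_total_deviation_le (hN : 0 < N) (hsz : ∀ l, 0 < sz l) {t : ℝ} (ht : 0 < t) :
    bookLaw sz N {x | t ≤ |(∑ w : (l : Fin (L + 1)) → Fin (sz l),
        (energy (superpose q Finset.univ (pick x w)) / N - ∑ l, (q l : ℝ)))
        / Fintype.card ((l : Fin (L + 1)) → Fin (sz l))|}
      ≤ ENNReal.ofReal ((∑ l, (q l : ℝ)) ^ 2 * (energyVar / N) / t ^ 2) := by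
  have : ∀ l, Nonempty (Fin (sz l)) := fun l => ⟨⟨0, hsz l⟩⟩
  refine measure_average_deviation_le (bookLaw sz N)
    (g := fun (w : (l : Fin (L + 1)) → Fin (sz l)) x =>
      energy (superpose q Finset.univ (pick x w)) / N - ∑ l, (q l : ℝ))
    (fun w => by fun_prop) ht fun w => ?_
  have h1 := lintegral_energy_sq_deviation hN (∑ l, q l)
  have h2 := map_superpose (N := N) q Finset.univ 1
  simp only [NNReal.coe_one, Real.sqrt_one, Complex.ofReal_one, one_mul] at h2
  rw [← h2, lintegral_map (f := fun y => ENNReal.ofReal ((energy y / N - (∑ l, q l : ℝ≥0)) ^ 2))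
    (by fun_prop) (measurable_superpose q _)] at h1
  rw [lintegral_book_pick sz N w (F := fun a => ENNReal.ofReal
    ((energy (superpose q Finset.univ a) / N - ∑ l, (q l : ℝ)) ^ 2)) (by fun_prop)]
  simp only [NNReal.coe_sum] at h1
  exact h1.le

theorem bookCode_layerPower (hN : 0 < N) (hsz : ∀ l, 0 < sz l) (x : Book sz N) (l : Fin (L + 1)) :
    (bookCode q hsz x).layerPower l
      = q l * (1 + (∑ j, (energy (x l j) / N - 1)) / sz l) := by
  have hN' : (0 : ℝ) < N := by exact_mod_cast hN
  have hs : (0 : ℝ) < sz l := by exact_mod_cast hsz l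
  have h1 : ∀ j : Fin (sz l), ∑ i, ‖(bookCode q hsz x).codeword l j i‖ ^ 2
      = q l * energy (x l j) := fun j => by
    have := energy_mul (Real.sqrt (q l)) (x l j)
    rw [Real.sq_sqrt (NNReal.coe_nonneg _)] at this
    exact this
  have h2 : (bookCode q hsz x).layerPower l = (∑ j : Fin (sz l), q l * energy (x l j)) / sz l / N := by
    rw [LayeredCode.layerPower]
    congr 2
    exact Finset.sum_congr rfl fun j _ => h1 j
  rw [h2, ← Finset.mul_sum, Finset.sum_sub_distrib, ← Finset.sum_div, Finset.sum_const,
    Finset.card_univ, Fintype.card_fin, nsmul_eq_mul, mul_one]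
  field_simp
  ring

theorem bookCode_totalPower (hN : 0 < N) (hsz : ∀ l, 0 < sz l) (x : Book sz N) :
    (bookCode q hsz x).totalPower = ∑ l, (q l : ℝ)
      + (∑ w : (l : Fin (L + 1)) → Fin (sz l),
        (energy (superpose q Finset.univ (pick x w)) / N - ∑ l, (q l : ℝ)))
        / Fintype.card ((l : Fin (L + 1)) → Fin (sz l)) := by
  have : ∀ l, Nonempty (Fin (sz l)) := fun l => ⟨⟨0, hsz l⟩⟩
  have hN' : (0 : ℝ) < N := by exact_mod_cast hN
  have hc : (0 : ℝ) < Fintype.card ((l : Fin (L + 1)) → Fin (sz l)) := by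
    exact_mod_cast Fintype.card_pos
  have h2 : (bookCode q hsz x).totalPower = (∑ w : (l : Fin (L + 1)) → Fin (sz l),
      energy (superpose q Finset.univ (pick x w)))
        / Fintype.card ((l : Fin (L + 1)) → Fin (sz l)) / N := by
    rw [LayeredCode.totalPower]
    congr 2
    exact Finset.sum_congr rfl fun w _ => by rw [bookCode_signal q hsz x w]; rfl
  rw [h2, Finset.sum_sub_distrib, ← Finset.sum_div, Finset.sum_const,
    Finset.card_univ, nsmul_eq_mul]
  field_simp
  ring

end LayeredKey

end

noncomputable section

namespace LayeredKey

open scoped ENNReal NNReal Topology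

/-! ### A good code for one slot -/

/-- Markov, with the bad set given by a strict inequality so that its complement directly yields an
upper bound. -/
theorem measure_lt_of_lintegral_le {α : Type*} [MeasurableSpace α] {μ : Measure α} {f : α → ℝ≥0∞}
    (hf : Measurable f) {b ε : ℝ} (hε : 0 < ε) (h : ∫⁻ x, f x ∂μ ≤ ENNReal.ofReal b) :
    μ {x | ENNReal.ofReal ε < f x} ≤ ENNReal.ofReal (b / ε) := by
  have hsub : {x | ENNReal.ofReal ε < f x} ⊆ {x | ENNReal.ofReal ε ≤ f x} := fun x hx => by
    rw [Set.mem_ofPred_eq] at hx ⊢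
    exact hx.le
  refine (measure_mono hsub).trans
    ((meas_ge_le_lintegral_div hf.aemeasurable (ENNReal.ofReal_pos.2 hε).ne'
      ENNReal.ofReal_ne_top).trans ?_)
  rw [ENNReal.ofReal_div_of_pos hε]
  exact ENNReal.div_le_div_right h _

variable {L N : ℕ} {sz : Fin (L + 1) → ℕ} (s : Levels L) {ρ : ℝ → ℝ} {P : ℝ}
  {μ₁ μ₂ : Measure ℝ} [IsProbabilityMeasure μ₁] [IsProbabilityMeasure μ₂]

/-- The reduced layer powers sum to `(1 - θ) P`, which leaves the margin `θ P` for Chebyshev. -/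
theorem bookLaw_totalPower_le (hρ : ∀ u, 0 ≤ u → 0 ≤ ρ u) (hρi : IntegrableOn ρ (Set.Ioi 0))
    (hP : interference ρ 0 = P) (hN : 0 < N) (hsz : ∀ l, 0 < sz l) {θ : ℝ} (hθ0 : 0 < θ)
    (hθ : θ ≤ 1) :
    bookLaw sz N {x | P < (bookCode (s.codePower ρ θ) hsz x).totalPower}
      ≤ ENNReal.ofReal (energyVar / N / θ ^ 2) := by
  have hv := energyVar_nonneg
  have hsum : ∑ l, (s.codePower ρ θ l : ℝ) = (1 - θ) * P := by
    rw [Finset.sum_congr rfl fun l _ => s.coe_codePower hρ hθ l, ← Finset.mul_sum,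
      s.sum_power_univ hρi, hP]
  have hP0 : 0 ≤ P := by
    rw [← hP, ← s.sum_power_univ hρi]
    exact s.sum_power_nonneg hρ _
  -- For `P = 0` the margin vanishes, but then the code is identically zero.
  rcases hP0.eq_or_lt with h0 | hpos
  · have hq : ∀ l, (s.codePower ρ θ l : ℝ) = 0 := by
      intro l
      rw [← h0, mul_zero] at hsum
      exact (Finset.sum_eq_zero_iff_of_nonneg fun l _ => NNReal.coe_nonneg _).1 hsum l
        (Finset.mem_univ l)
    have : {x : Book sz N | P < (bookCode (s.codePower ρ θ) hsz x).totalPower} = ∅ := by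
      refine Set.eq_empty_of_forall_notMem fun x hx => ?_
      rw [Set.mem_ofPred_eq, bookCode_totalPower _ hN, hsum, ← h0] at hx
      simp [superpose, hq, energy] at hx
    rw [this]
    simp
  · refine (measure_mono fun x hx => ?_).trans
      ((bookLaw_total_deviation_le (s.codePower ρ θ) hN hsz (t := θ * P) (by positivity)).trans
        (ENNReal.ofReal_le_ofReal ?_))
    · rw [Set.mem_ofPred_eq, bookCode_totalPower _ hN] at hx
      rw [hsum] at hx
      rw [Set.mem_ofPred_eq, hsum]
      exact le_trans (by linarith) (le_abs_self _)
    · rw [hsum]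
      have h1 : ((1 - θ) * P) ^ 2 ≤ P ^ 2 := by
        refine pow_le_pow_left₀ (mul_nonneg (by linarith) hP0) ?_ 2
        nlinarith
      calc _ ≤ P ^ 2 * (energyVar / N) / (θ * P) ^ 2 := by gcongr
        _ = _ := by field_simp

/-- A relative deviation of at most `θ` leaves the layer power between `(1 - θ)² p` and `(1 - θ²)
p`. The first is at least `p - 2 θ P`, and the second never exceeds `p`. -/
theorem fits_bookCode (hρ : ∀ u, 0 ≤ u → 0 ≤ ρ u) (hρi : IntegrableOn ρ (Set.Ioi 0))
    (hP : interference ρ 0 = P) (hN : 0 < N) {θ η η' : ℝ} (hθ0 : 0 ≤ θ) (hθ : θ ≤ 1)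
    (hθP : 2 * θ * P ≤ η) (hη' : η' ≤ η) (hNη : 1 ≤ N * η') {x : Book (s.codeSize ρ η' N) N}
    (htot : (bookCode (s.codePower ρ θ) (s.codeSize_pos ρ η' N) x).totalPower ≤ P)
    (hlay : ∀ l, |(∑ j, (energy (x l j) / N - 1)) / s.codeSize ρ η' N l| ≤ θ) :
    (bookCode (s.codePower ρ θ) (s.codeSize_pos ρ η' N) x).Fits s ρ P η := by
  refine ⟨fun l => ?_, fun l => ⟨?_, s.codeSize_le hρ hNη l⟩, htot⟩
  · rw [bookCode_layerPower _ hN, s.coe_codePower hρ hθ]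
    have hp := s.power_nonneg hρ l
    have hpP : s.power ρ l ≤ P := by
      rw [← hP, ← s.sum_power_univ hρi]
      exact Finset.single_le_sum (f := fun l => s.power ρ l) (fun l _ => s.power_nonneg hρ l)
        (Finset.mem_univ l)
    have h1 := abs_le.1 (hlay l)
    set d := (∑ j, (energy (x l j) / N - 1)) / s.codeSize ρ η' N l
    have h2 : (1 - θ) * (1 - θ) ≤ (1 - θ) * (1 + d) :=
      mul_le_mul_of_nonneg_left (by linarith [h1.1]) (by linarith)
    have h3 : (1 - θ) * (1 + d) ≤ (1 - θ) * (1 + θ) :=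
      mul_le_mul_of_nonneg_left (by linarith [h1.2]) (by linarith)
    have e : (1 - θ) * s.power ρ l * (1 + d) = (1 - θ) * (1 + d) * s.power ρ l := by ring
    rw [e]
    constructor
    · have h4 := mul_le_mul_of_nonneg_right h2 hp
      have h5 : θ * s.power ρ l ≤ θ * P := mul_le_mul_of_nonneg_left hpP hθ0
      nlinarith [mul_nonneg (sq_nonneg θ) hp]
    · have h4 := mul_le_mul_of_nonneg_right h3 hp
      nlinarith [mul_nonneg (sq_nonneg θ) hp]
  · refine le_trans (Real.exp_le_exp.2 ?_) (s.exp_le_codeSize ρ η' N l)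
    exact mul_le_mul_of_nonneg_left (by linarith) (by positivity)

/-- Bob's error event and the event that Eve learns too much are both unlikely for some codebooks. -/
theorem exists_good_book (hρ : ∀ u, 0 ≤ u → 0 ≤ ρ u) (hρi : IntegrableOn ρ (Set.Ioi 0))
    (hP : interference ρ 0 = P) (hμ₁ : ∀ᵐ h ∂μ₁, 0 ≤ h) (hμ₂ : ∀ᵐ h ∂μ₂, 0 ≤ h) {θ η τ ε : ℝ}
    (hθ0 : 0 < θ) (hθ : θ ≤ 1) (hη : 0 < η) (hτ : 0 < τ) (hε : 0 < ε) :
    ∀ᶠ N : ℕ in atTop, ∃ x : Book (s.codeSize ρ η N) N,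
      bookSlotLaw (s.codeSize ρ η N) N μ₁ μ₂ {ω | BobFails (s.codePower ρ θ) τ
        (fun l => s.rate ρ l - η / 2) ω.1 ω.2.1 ω.2.2.2.1 x} ≤ ENNReal.ofReal ε ∧
      bookSlotLaw (s.codeSize ρ η N) N μ₁ μ₂ {ω | EveLearns (s.codePower ρ θ) s ρ
        (7 * τ + 2 * (L + 1) * η) (s.topLayer ω.2.1) ω.1 ω.2.2.1 ω.2.2.2.2 x} ≤ ENNReal.ofReal ε ∧
      (bookCode (s.codePower ρ θ) (s.codeSize_pos ρ η N) x).totalPower ≤ P ∧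
      ∀ l, |(∑ j, (energy (x l j) / N - 1)) / s.codeSize ρ η N l| ≤ θ := by
  have hv := energyVar_nonneg
  have hcast : Tendsto (fun N : ℕ => (N : ℝ)) atTop atTop := tendsto_natCast_atTop_atTop
  have hexp : ∀ a : ℝ, 0 < a → Tendsto (fun N : ℕ => Real.exp (-(N * a))) atTop (𝓝 0) := fun a ha =>
    Real.tendsto_exp_neg_atTop_nhds_zero.comp (hcast.atTop_mul_const ha)
  have hinv : ∀ t : ℝ, Tendsto (fun N : ℕ => energyVar / N / t ^ 2) atTop (𝓝 0) := fun t => by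
    have := (tendsto_const_nhds (x := energyVar)).div_atTop hcast
    simpa using this.div_const (t ^ 2)
  -- `β₁` bounds the mean probability of Bob's failure, `β₂` that of Eve learning too much, and `β₃`
  -- the probability of each power deviation. Markov divides the first two by `ε`.
  set β₁ : ℕ → ℝ := fun N => 2 ^ (L + 1) * (energyVar / N / τ ^ 2)
    + (L + 1) * Real.exp (-(N * (η / 2))) with hβ₁
  set β₂ : ℕ → ℝ := fun N => 2 ^ (L + 1) * (energyVar / N / τ ^ 2)
    + (Real.exp (-(N * τ)) + Real.exp (-(N * τ))) with hβ₂
  set β₃ : ℕ → ℝ := fun N => energyVar / N / θ ^ 2 with hβ₃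
  have t1 : Tendsto β₁ atTop (𝓝 0) := by
    have := ((hinv τ).const_mul (2 ^ (L + 1))).add ((hexp (η / 2) (by positivity)).const_mul
      ((L : ℝ) + 1))
    simpa using this
  have t2 : Tendsto β₂ atTop (𝓝 0) := by
    have := ((hinv τ).const_mul (2 ^ (L + 1))).add ((hexp τ hτ).add (hexp τ hτ))
    simpa using this
  have t3 : Tendsto β₃ atTop (𝓝 0) := hinv θ
  have t : Tendsto (fun N => β₁ N / ε + β₂ N / ε + (β₃ N + (L + 1) * β₃ N)) atTop (𝓝 0) := by
    have := ((t1.div_const ε).add (t2.div_const ε)).add (t3.add (t3.const_mul ((L : ℝ) + 1)))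
    simpa using this
  have hbig : ∀ᶠ N : ℕ in atTop, (2 : ℝ) ^ (L + 1) ≤ Real.exp (N * τ) :=
    (Real.tendsto_exp_atTop.comp (hcast.atTop_mul_const hτ)).eventually_ge_atTop _
  filter_upwards [t.eventually_lt_const one_pos, hbig, eventually_gt_atTop 0] with N hN1 hN2 hN
  have hsz := s.codeSize_pos ρ η N
  set sz := s.codeSize ρ η N with hszd
  set q := s.codePower ρ θ with hq
  set t : Fin (L + 1) → ℝ := fun l => s.rate ρ l - η / 2 with ht
  have hβ0 : 0 ≤ β₃ N ∧ 0 ≤ β₁ N ∧ 0 ≤ β₂ N := by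
    simp only [hβ₁, hβ₂, hβ₃]
    refine ⟨by positivity, by positivity, by positivity⟩
  obtain ⟨m1, i1⟩ := lintegral_book_event₁_le (μ₁ := μ₁) (μ₂ := μ₂) hsz hμ₁ hμ₂
    (E := BobFails q τ t) (δ := ENNReal.ofReal (β₁ N))
    (fun w => measurableSet_bobFails q τ t w measurable_fst (by fun_prop) (by fun_prop))
    (fun h₁ _ w => by
      refine (lintegral_bobFails_le q hN hτ t h₁ w).trans ?_
      rw [hβ₁, ENNReal.ofReal_add (by positivity) (by positivity),
        ENNReal.ofReal_mul (p := 2 ^ (L + 1)) (by positivity), ENNReal.ofReal_pow (by positivity)]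
      refine add_le_add (by simp) ?_
      -- There are at most `exp (N (r - η))` wrong codewords, against the threshold exponent `r - η
      -- / 2`.
      have : ∀ l ∈ (Finset.univ : Finset (Fin (L + 1))),
          ENNReal.ofReal (((sz l : ℝ) - 1) * Real.exp (-(N * t l)))
          ≤ ENNReal.ofReal (Real.exp (-(N * (η / 2)))) := fun l _ => by
        refine ENNReal.ofReal_le_ofReal ?_
        refine (mul_le_mul_of_nonneg_right (s.codeSize_sub_one_le ρ η N l)
          (Real.exp_pos _).le).trans (le_of_eq ?_)
        rw [← Real.exp_add]
        congr 1
        simp only [ht]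
        ring
      refine (Finset.sum_le_card_nsmul _ _ _ this).trans (le_of_eq ?_)
      rw [Finset.card_univ, Fintype.card_fin, nsmul_eq_mul,
        ENNReal.ofReal_mul (by positivity), ← ENNReal.ofReal_natCast]
      push_cast
      rfl)
  obtain ⟨m2, i2⟩ := lintegral_book_event₂_le (μ₁ := μ₁) (μ₂ := μ₂) hsz hμ₁ hμ₂
    (E := fun w h₁ h₂ z x => EveLearns q s ρ (7 * τ + 2 * (L + 1) * η) (s.topLayer h₁) w h₂ z x)
    (δ := ENNReal.ofReal (β₂ N)) (measurableSet_eveLearns q s ρ _)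
    (fun h₁ _ h₂ hh₂ => by
      refine (lintegral_leak_le s hρ hθ0.le hθ hη.le hτ hh₂ (s.topLayer h₁) hN hN2).trans
        (le_of_eq ?_)
      rw [hβ₂, ENNReal.ofReal_add (by positivity) (by positivity),
        ENNReal.ofReal_mul (p := 2 ^ (L + 1)) (by positivity), ENNReal.ofReal_pow (by positivity),
        ENNReal.ofReal_add (by positivity) (by positivity)]
      simp)
  have b1 := measure_lt_of_lintegral_le m1 hε i1
  have b2 := measure_lt_of_lintegral_le m2 hε i2
  have b3 := bookLaw_totalPower_le s hρ hρi hP hN hsz hθ0 hθ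
  have b4 := fun l => bookLaw_layer_deviation_le hN hsz hθ0 l
  set B₁ := {x | ENNReal.ofReal ε < bookSlotLaw sz N μ₁ μ₂
    {ω | BobFails q τ t ω.1 ω.2.1 ω.2.2.2.1 x}} with hB₁
  set B₂ := {x | ENNReal.ofReal ε < bookSlotLaw sz N μ₁ μ₂
    {ω | EveLearns q s ρ (7 * τ + 2 * (L + 1) * η) (s.topLayer ω.2.1) ω.1 ω.2.2.1 ω.2.2.2.2 x}} with hB₂
  set B₃ := {x | P < (bookCode q hsz x).totalPower} with hB₃
  set B₄ : Fin (L + 1) → Set (Book sz N) := fun l =>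
    {x | θ ≤ |(∑ j, (energy (x l j) / N - 1)) / sz l|} with hB₄
  -- The bad codebooks do not fill the space, so one codebook avoids all defects simultaneously.
  have hlt : bookLaw sz N (B₁ ∪ B₂ ∪ (B₃ ∪ ⋃ l, B₄ l)) < 1 := by
    calc _ ≤ ENNReal.ofReal (β₁ N / ε) + ENNReal.ofReal (β₂ N / ε)
          + (ENNReal.ofReal (β₃ N) + ∑ _l : Fin (L + 1), ENNReal.ofReal (β₃ N)) := by
          refine (measure_union_le _ _).trans (add_le_add ((measure_union_le _ _).trans
            (add_le_add b1 b2)) ((measure_union_le _ _).trans (add_le_add b3 ?_)))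
          exact (measure_iUnion_fintype_le _ _).trans (Finset.sum_le_sum fun l _ => b4 l)
      _ = ENNReal.ofReal (β₁ N / ε + β₂ N / ε + (β₃ N + (L + 1) * β₃ N)) := by
          have h1 := div_nonneg hβ0.2.1 hε.le
          have h2 := div_nonneg hβ0.2.2 hε.le
          have h3 : 0 ≤ ((L : ℝ) + 1) * β₃ N := mul_nonneg (by positivity) hβ0.1
          rw [ENNReal.ofReal_add (add_nonneg h1 h2) (add_nonneg hβ0.1 h3),
            ENNReal.ofReal_add h1 h2, ENNReal.ofReal_add hβ0.1 h3,
            ENNReal.ofReal_mul (by positivity), Finset.sum_const, Finset.card_univ,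
            Fintype.card_fin, nsmul_eq_mul, ← ENNReal.ofReal_natCast]
          push_cast
          rfl
      _ < 1 := by
          rw [ENNReal.ofReal_lt_one]
          exact hN1
  have hex : ∃ x, x ∉ B₁ ∪ B₂ ∪ (B₃ ∪ ⋃ l, B₄ l) := by
    by_contra hc
    push Not at hc
    rw [Set.eq_univ_of_forall hc, measure_univ] at hlt
    exact lt_irrefl _ hlt
  obtain ⟨x, hx⟩ := hex
  simp only [Set.mem_union, Set.mem_iUnion, not_or, not_exists] at hx
  obtain ⟨⟨x1, x2⟩, x3, x4⟩ := hx
  exact ⟨x, not_lt.1 x1, not_lt.1 x2, not_lt.1 x3, fun l => (not_le.1 (x4 l)).le⟩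

end LayeredKey

end

noncomputable section

namespace LayeredKey

open scoped ENNReal NNReal Topology

variable {L N : ℕ} {sz : Fin (L + 1) → ℕ} (s : Levels L) {ρ : ℝ → ℝ} {P : ℝ}
  {μ₁ μ₂ : Measure ℝ} [IsProbabilityMeasure μ₁] [IsProbabilityMeasure μ₂]

theorem EveLearns.anti {q : Fin (L + 1) → ℝ≥0} {κ κ' : ℝ} (hκ : κ' ≤ κ) {ψ : Fin (L + 1)}
    {w : (l : Fin (L + 1)) → Fin (sz l)} {h : ℝ} {z : Fin N → ℂ} {x : Book sz N}
    (H : EveLearns q s ρ κ ψ w h z x) : EveLearns q s ρ κ' ψ w h z x := by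
  refine lt_of_le_of_lt (Real.exp_le_exp.2 (neg_le_neg ?_)) H
  exact mul_le_mul_of_nonneg_left (by linarith) (by positivity)

/-- A code for one slot, with a successive decoder that recovers the layers below Bob's gain and
hides the layers above Eve's gain. -/
theorem exists_slot_code (hρ : ∀ u, 0 ≤ u → 0 ≤ ρ u) (hρi : IntegrableOn ρ (Set.Ioi 0))
    (hP : interference ρ 0 = P) (hμ₁ : ∀ᵐ h ∂μ₁, 0 ≤ h) (hμ₂ : ∀ᵐ h ∂μ₂, 0 ≤ h) {η κ ε : ℝ}
    (hη : 0 < η) (hκ : 0 < κ) (hε : 0 < ε) :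
    ∀ᶠ N : ℕ in atTop, ∃ (sz : Fin (L + 1) → ℕ) (hsz : ∀ l, 0 < sz l) (q : Fin (L + 1) → ℝ≥0)
      (x : Book sz N) (dec : ℝ → (Fin N → ℂ) → (bookCode q hsz x).Msg),
      (Measurable fun p : ℝ × (Fin N → ℂ) => dec p.1 p.2) ∧
      (∀ l, ∃ stage : ℝ → (Fin N → ℂ) → Fin ((bookCode q hsz x).size l), ∀ h y,
        dec h y l = stage h (y - (Real.sqrt h : ℂ) •
          ∑ j ∈ Finset.Iio l, (bookCode q hsz x).codeword j (dec h y j))) ∧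
      (bookCode q hsz x).Fits s ρ P η ∧
      bookSlotLaw sz N μ₁ μ₂ {ω | ∃ l ≤ s.topLayer ω.2.1,
        dec ω.2.1 (recv q ω.2.1 Finset.univ (pick x ω.1) ω.2.2.2.1) l ≠ ω.1 l}
        ≤ ENNReal.ofReal ε ∧
      bookSlotLaw sz N μ₁ μ₂ {ω | EveLearns q s ρ κ (s.topLayer ω.2.1) ω.1 ω.2.2.1 ω.2.2.2.2 x}
        ≤ ENNReal.ofReal ε := by
  have hP0 : 0 ≤ P := by
    rw [← hP, ← s.sum_power_univ hρi]
    exact s.sum_power_nonneg hρ _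
  -- The leak slack `7 τ + 2 (L + 1) η'` is split into halves of `κ`.
  set η' := min η (κ / (4 * (L + 1))) with hη'
  have hη'0 : 0 < η' := lt_min hη (by positivity)
  have hη'1 : 2 * (L + 1) * η' ≤ κ / 2 := by
    calc _ ≤ 2 * (L + 1) * (κ / (4 * (L + 1))) := by gcongr; exact min_le_right _ _
      _ = κ / 2 := by field_simp; ring
  -- Besides its half of `κ`, this leaves `2 τ ≤ η' / 4` for Bob's threshold.
  set τ := min (η' / 8) (κ / 14) with hτd
  have hτ : 0 < τ := lt_min (by positivity) (by positivity)
  have hτ1 : 7 * τ ≤ κ / 2 := by linarith [min_le_right (η' / 8) (κ / 14)]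
  have hτ2 : 2 * τ ≤ η' / 4 := by linarith [min_le_left (η' / 8) (κ / 14)]
  have hexp : Real.exp (-(η' / 4)) < 1 := Real.exp_lt_one_iff.2 (by linarith)
  -- The first bound makes the power back-off cost at most `η' / 4` in rate. Together with `2 τ` it
  -- fits into the gap `η' / 2` between threshold and nominal rate. The second controls the powers,
  -- with `P + 1` because `P` may vanish.
  set θ := min (1 - Real.exp (-(η' / 4))) (η / (2 * (P + 1))) with hθd
  have hθ0 : 0 < θ := lt_min (by linarith) (by positivity)
  have hθ1 : θ ≤ 1 - Real.exp (-(η' / 4)) := min_le_left _ _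
  have hθlt : θ < 1 := by linarith [Real.exp_pos (-(η' / 4))]
  have hθP : 2 * θ * P ≤ η := by
    calc 2 * θ * P ≤ 2 * θ * (P + 1) := by gcongr; linarith
      _ ≤ 2 * (η / (2 * (P + 1))) * (P + 1) := by gcongr; exact min_le_right _ _
      _ = η := by field_simp
  have hlog : -Real.log (1 - θ) ≤ η' / 4 := by
    rw [neg_le, Real.le_log_iff_exp_le (by linarith)]
    linarith
  have hcast : Tendsto (fun N : ℕ => (N : ℝ)) atTop atTop := tendsto_natCast_atTop_atTop
  filter_upwards [exists_good_book s hρ hρi hP hμ₁ hμ₂ hθ0 hθlt.le hη'0 hτ hε,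
    (hcast.atTop_mul_const hη'0).eventually_ge_atTop 1, eventually_gt_atTop 0] with N hx hNη hN
  obtain ⟨x, x1, x2, x3, x4⟩ := hx
  have hsz := s.codeSize_pos ρ η' N
  obtain ⟨dec, d1, d2, d3⟩ := exists_decoder (s.codePower ρ θ) hN hsz x
    (fun l => s.rate ρ l - η' / 2) (τ := τ)
  refine ⟨s.codeSize ρ η' N, hsz, s.codePower ρ θ, x, dec, d1, d2,
    fits_bookCode s hρ hρi hP hN hθ0.le hθlt.le hθP (min_le_left _ _) hNη x3 x4, ?_, ?_⟩
  · refine le_trans (measure_mono_ae ?_) x1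
    have := isProbabilityMeasure_uniformOn hsz
    -- The feedback characterises the decodable levels only for nonnegative gains, so a null set is
    -- removed.
    have hpos : ∀ᵐ ω ∂(bookSlotLaw (s.codeSize ρ η' N) N μ₁ μ₂), 0 ≤ ω.2.1 :=
      Measure.quasiMeasurePreserving_snd.ae (Measure.quasiMeasurePreserving_fst.ae hμ₁)
    filter_upwards [hpos] with ω hω herr
    by_contra hno
    obtain ⟨l, hl, hne⟩ := herr
    have hno' : ¬ BobFails (s.codePower ρ θ) τ (fun l => s.rate ρ l - η' / 2) ω.1 ω.2.1
      ω.2.2.2.1 x := hno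
    rw [BobFails, not_or, not_not] at hno'
    refine hne (d3 ω.2.1 ω.1 ω.2.2.2.1 (s.topLayer ω.2.1) hno'.1 (fun l hl => ?_)
      (fun l j hj hp => hno'.2 ⟨l, j, hj, hp⟩) l hl)
    refine le_trans (Real.exp_le_exp.2 ?_)
      (s.exp_le_recvVar_ratio hρ hθ0.le hθlt hlog l ((s.le_topLayer_iff hω l).1 hl))
    linarith
  · refine le_trans (measure_mono fun ω hω => ?_) x2
    exact EveLearns.anti s (by linarith) hω

/-! ### The law of Eve's observation -/

variable (q : Fin (L + 1) → ℝ≥0)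

/-- What Eve observes in one slot. -/
def slotView (x : Book sz N) (ω : BookSlot sz N) : Fin (L + 1) × ℝ × (Fin N → ℂ) :=
  (s.topLayer ω.2.1, ω.2.2.1, recv q ω.2.2.1 Finset.univ (pick x ω.1) ω.2.2.2.2)

theorem measurable_slotView (x : Book sz N) : Measurable (slotView s q x) := by
  refine measurable_from_prod_countable_right fun w => ?_
  have h1 : Measurable fun p : ℝ × ℝ × (Fin N → ℂ) × (Fin N → ℂ) => s.topLayer p.1 :=
    s.measurable_topLayer.comp measurable_fst
  have h2 : Measurable fun p : ℝ × ℝ × (Fin N → ℂ) × (Fin N → ℂ) =>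
      recv q p.2.1 Finset.univ (pick x w) p.2.2.2 := by fun_prop
  have h3 : Measurable fun p : ℝ × ℝ × (Fin N → ℂ) × (Fin N → ℂ) => p.2.1 := by fun_prop
  exact h1.prodMk (h3.prodMk h2)

/-- The joint density of the messages `w` and Eve's observation in one slot. -/
def slotDensity (x : Book sz N) (w : (l : Fin (L + 1)) → Fin (sz l))
    (v : Fin (L + 1) × ℝ × (Fin N → ℂ)) : ℝ :=
  (Fintype.card ((l : Fin (L + 1)) → Fin (sz l)) : ℝ)⁻¹ * likelihood q v.2.1 x v.2.2 w

theorem measurable_slotDensity (x : Book sz N) (w : (l : Fin (L + 1)) → Fin (sz l)) :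
    Measurable (slotDensity q x w) := by
  unfold slotDensity
  fun_prop

theorem slotDensity_pos (hsz : ∀ l, 0 < sz l) (x : Book sz N)
    (w : (l : Fin (L + 1)) → Fin (sz l)) (v : Fin (L + 1) × ℝ × (Fin N → ℂ)) :
    0 < slotDensity q x w v := by
  have : ∀ l, Nonempty (Fin (sz l)) := fun l => ⟨⟨0, hsz l⟩⟩
  have h1 := likelihood_pos q v.2.1 x v.2.2 w
  have h2 : (0 : ℝ) < Fintype.card ((l : Fin (L + 1)) → Fin (sz l)) := by
    exact_mod_cast Fintype.card_pos
  unfold slotDensity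
  positivity

/-- Given the message, Eve's block is the noise translated by the signal, and Bob's noise integrates
out. Gains and feedback do not depend on the message, so they enter the reference measure and leave
only the likelihood in the density. -/
theorem map_slotView (hsz : ∀ l, 0 < sz l) (x : Book sz N) (w : (l : Fin (L + 1)) → Fin (sz l)) :
    ((bookSlotLaw sz N μ₁ μ₂).restrict (Prod.fst ⁻¹' {w})).map (slotView s q x)
      = ((μ₁.map s.topLayer).prod (μ₂.prod volume)).withDensity
        fun v => ENNReal.ofReal (slotDensity q x w v) := by
  classical
  have hne : ∀ l, Nonempty (Fin (sz l)) := fun l => ⟨⟨0, hsz l⟩⟩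
  have := isProbabilityMeasure_uniformOn hsz
  have := Measure.isProbabilityMeasure_map (μ := μ₁) s.measurable_topLayer.aemeasurable
  refine Measure.ext_of_lintegral _ fun F hF => ?_
  have hvm := measurable_slotView s q x
  have hwm : MeasurableSet (Prod.fst ⁻¹' {w} : Set (BookSlot sz N)) :=
    measurable_fst (measurableSet_singleton w)
  have hFv : Measurable fun ω => F (slotView s q x ω) := hF.comp hvm
  rw [lintegral_map hF hvm, ← lintegral_indicator hwm, bookSlotLaw,
    lintegral_prod _ (hFv.indicator hwm).aemeasurable, lintegral_uniformOn_univ]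
  have e1 : ∀ w', ∫⁻ p, (Prod.fst ⁻¹' {w} : Set (BookSlot sz N)).indicator
        (fun ω => F (slotView s q x ω)) (w', p)
        ∂(μ₁.prod (μ₂.prod ((gaussBlock N 1).prod (gaussBlock N 1))))
      = if w' = w then ∫⁻ p, F (slotView s q x (w, p))
        ∂(μ₁.prod (μ₂.prod ((gaussBlock N 1).prod (gaussBlock N 1)))) else 0 := by
    intro w'
    split_ifs with h
    · subst h
      exact lintegral_congr fun p => by simp
    · rw [← lintegral_zero (μ := μ₁.prod (μ₂.prod ((gaussBlock N 1).prod (gaussBlock N 1))))]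
      exact lintegral_congr fun p => by simp [h]
  simp only [e1, Finset.sum_ite_eq', Finset.mem_univ, if_true]
  set c : ℝ≥0∞ := (Fintype.card ((l : Fin (L + 1)) → Fin (sz l)) : ℝ≥0∞)⁻¹ with hc
  have hcr : ENNReal.ofReal ((Fintype.card ((l : Fin (L + 1)) → Fin (sz l)) : ℝ)⁻¹) = c := by
    rw [hc, ENNReal.ofReal_inv_of_pos (by exact_mod_cast Fintype.card_pos),
      ENNReal.ofReal_natCast]
  have hdm : Measurable fun v => ENNReal.ofReal (slotDensity q x w v) :=
    (measurable_slotDensity q x w).ennreal_ofReal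
  rw [lintegral_withDensity_eq_lintegral_mul _ hdm hF]
  simp only [Pi.mul_apply]
  have hdF : Measurable fun v => ENNReal.ofReal (slotDensity q x w v) * F v := hdm.mul hF
  rw [lintegral_prod _ hdF.aemeasurable, lintegral_map ?_ s.measurable_topLayer]
  swap
  · exact hdF.lintegral_prod_right'
  have hF2 : Measurable fun p : ℝ × ℝ × (Fin N → ℂ) × (Fin N → ℂ) => F (slotView s q x (w, p)) :=
    hFv.comp measurable_prodMk_left
  rw [lintegral_prod _ hF2.aemeasurable, ← lintegral_const_mul _ hF2.lintegral_prod_right']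
  refine lintegral_congr fun h₁ => ?_
  have hF3 : Measurable fun p : ℝ × (Fin N → ℂ) × (Fin N → ℂ) =>
      F (slotView s q x (w, h₁, p)) := hF2.comp (f := fun p => (h₁, p)) (by fun_prop)
  have hD3 : Measurable fun p : ℝ × (Fin N → ℂ) =>
      ENNReal.ofReal (slotDensity q x w (s.topLayer h₁, p)) * F (s.topLayer h₁, p) :=
    hdF.comp (f := fun p => (s.topLayer h₁, p)) (by fun_prop)
  rw [lintegral_prod _ hF3.aemeasurable, lintegral_prod _ hD3.aemeasurable,
    ← lintegral_const_mul _ hF3.lintegral_prod_right']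
  refine lintegral_congr fun h₂ => ?_
  have hF4 : Measurable fun p : (Fin N → ℂ) × (Fin N → ℂ) =>
      F (slotView s q x (w, h₁, h₂, p)) := hF3.comp (f := fun p => (h₂, p)) (by fun_prop)
  rw [lintegral_prod _ hF4.aemeasurable]
  set m : Fin N → ℂ := fun i => ((Real.sqrt h₂ : ℝ) : ℂ) * superpose q Finset.univ (pick x w) i
  have e2 : ∀ z z', F (slotView s q x (w, h₁, h₂, z, z')) = F (s.topLayer h₁, h₂, z' + m) := by
    intro z z'
    have : recv q h₂ Finset.univ (pick x w) z' = z' + m := by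
      ext i; simp only [recv, Pi.add_apply, m]; ring
    simp only [slotView, this]
  have hF5 : Measurable fun y : Fin N → ℂ => F (s.topLayer h₁, h₂, y) :=
    hF.comp (f := fun y => (s.topLayer h₁, h₂, y)) (by fun_prop)
  simp only [e2, lintegral_const, measure_univ, mul_one]
  rw [lintegral_gaussBlock (F := fun z => F (s.topLayer h₁, h₂, z + m)) one_pos
    (hF5.comp (measurable_add_const m))]
  have e3 : ∫⁻ z : Fin N → ℂ, ENNReal.ofReal (blockDensity 1 z) * F (s.topLayer h₁, h₂, z + m)
      = ∫⁻ y : Fin N → ℂ, ENNReal.ofReal (blockDensity 1 (y - m)) * F (s.topLayer h₁, h₂, y) := by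
    rw [← lintegral_add_right_eq_self (fun y => ENNReal.ofReal (blockDensity 1 (y - m)) *
      F (s.topLayer h₁, h₂, y)) m]
    simp only [add_sub_cancel_right]
  have hb : Measurable fun y : Fin N → ℂ =>
      ENNReal.ofReal (blockDensity 1 (y - m)) * F (s.topLayer h₁, h₂, y) :=
    Measurable.mul (by fun_prop) hF5
  simp only [NNReal.coe_one]
  rw [e3, ← lintegral_const_mul _ hb]
  refine lintegral_congr fun y => ?_
  rw [← mul_assoc, ← hcr, ← ENNReal.ofReal_mul (by positivity)]
  rfl

end LayeredKey

end

noncomputable section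

namespace LayeredKey

open scoped ENNReal NNReal Topology

/-! ### Random binning -/

/-- Two distinct arguments collide under a `1 / k` fraction of all functions to `k` bins. -/
theorem card_collision_mul_le {Ψ : Type*} [Fintype Ψ] [DecidableEq Ψ] {D : Ψ → Type*}
    [∀ ψ, Fintype (D ψ)] [∀ ψ, DecidableEq (D ψ)] {k : ℕ} (ψ : Ψ) {a a' : D ψ} (h : a ≠ a') :
    (Finset.univ.filter fun β : (ψ : Ψ) → D ψ → Fin k => β ψ a' = β ψ a).card * k
      ≤ Fintype.card ((ψ : Ψ) → D ψ → Fin k) := by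
  have hcard : (Finset.univ.filter fun β : (ψ : Ψ) → D ψ → Fin k => β ψ a' = β ψ a).card * k
      = ((Finset.univ.filter fun β : (ψ : Ψ) → D ψ → Fin k => β ψ a' = β ψ a)
        ×ˢ (Finset.univ : Finset (Fin k))).card := by
    rw [Finset.card_product, Finset.card_univ, Fintype.card_fin]
  rw [hcard, ← Finset.card_univ]
  -- From a colliding function and a bin, overwrite the value at `a'` by the bin. The lost value is
  -- recovered from `a`, since `a ≠ a'` and the function collided there.
  refine Finset.card_le_card_of_injOn
    (fun p => Function.update p.1 ψ (Function.update (p.1 ψ) a' p.2))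
    (fun _ _ => Finset.mem_coe.2 (Finset.mem_univ _)) ?_
  rintro ⟨β, j⟩ hβ ⟨β', j'⟩ hβ' heq
  simp only [Finset.coe_product, Set.mem_prod, Finset.mem_coe, Finset.mem_filter, Finset.mem_univ,
    true_and, and_true] at hβ hβ'
  have hψ : Function.update (β ψ) a' j = Function.update (β' ψ) a' j' := by
    have := congrFun heq ψ
    simpa using this
  have hj : j = j' := by
    have := congrFun hψ a'
    simpa using this
  have ha : β ψ a = β' ψ a := by
    have := congrFun hψ a
    simpa [Function.update_of_ne h] using this
  have hβeq : β = β' := by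
    funext ψ'
    by_cases hp : ψ' = ψ
    · subst hp
      funext d
      by_cases hd : d = a'
      · subst hd
        rw [hβ, hβ', ha]
      · have := congrFun hψ d
        simpa [Function.update_of_ne hd] using this
    · have := congrFun heq ψ'
      simpa [Function.update_of_ne hp] using this
  rw [hj, hβeq]

variable {L N M : ℕ} {sz : Fin (L + 1) → ℕ} (s : Levels L) {ρ : ℝ → ℝ} {P : ℝ}
  {μ₁ μ₂ : Measure ℝ} [IsProbabilityMeasure μ₁] [IsProbabilityMeasure μ₂]
  (q : Fin (L + 1) → ℝ≥0)

/-! ### Several slots -/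

theorem map_pi_slotView (hsz : ∀ l, 0 < sz l) (x : Book sz N)
    (w : Fin M → (l : Fin (L + 1)) → Fin (sz l)) :
    ((Measure.pi fun _ : Fin M => bookSlotLaw sz N μ₁ μ₂).restrict
        ((fun ω m => (ω m).1) ⁻¹' {w})).map (fun ω m => slotView s q x (ω m))
      = (Measure.pi fun _ : Fin M => (μ₁.map s.topLayer).prod (μ₂.prod volume)).withDensity
        fun v => ENNReal.ofReal (∏ m, slotDensity q x (w m) (v m)) := by
  have := isProbabilityMeasure_bookSlotLaw (N := N) (μ₁ := μ₁) (μ₂ := μ₂) hsz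
  have := Measure.isProbabilityMeasure_map (μ := μ₁) s.measurable_topLayer.aemeasurable
  have e : ((fun (ω : Fin M → BookSlot sz N) m => (ω m).1) ⁻¹' {w})
      = Set.univ.pi fun m => (Prod.fst ⁻¹' {w m} : Set (BookSlot sz N)) := by
    ext ω
    simp [funext_iff]
  have hσ : ∀ m, SigmaFinite (((μ₁.map s.topLayer).prod
      (μ₂.prod (volume : Measure (Fin N → ℂ)))).withDensity
      fun v => ENNReal.ofReal (slotDensity q x (w m) v)) := fun m => by
    rw [← map_slotView s q hsz]
    infer_instance
  have hvol : SigmaFinite (volume : Measure (Fin N → ℂ)) := inferInstance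
  have hν : SigmaFinite ((μ₁.map s.topLayer).prod (μ₂.prod (volume : Measure (Fin N → ℂ)))) :=
    Measure.prod.instSigmaFinite
  rw [e, Measure.restrict_pi_pi,
    Measure.pi_map_pi fun m => (measurable_slotView s q x).aemeasurable]
  simp only [map_slotView s q hsz]
  rw [pi_withDensity (fun _ => (μ₁.map s.topLayer).prod (μ₂.prod volume))
    (fun m v => ENNReal.ofReal (slotDensity q x (w m) v))
    fun m => (measurable_slotDensity q x (w m)).ennreal_ofReal]
  congr 1
  ext v
  rw [ENNReal.ofReal_prod_of_nonneg fun m _ => (slotDensity_pos q hsz x _ _).le]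

/-- The messages consistent with the true decoded ones form a product set over the slots, and the
joint density is a product. Numerator and denominator both factorise. -/
theorem sum_posterior_eq_prod (hsz : ∀ l, 0 < sz l) (x : Book sz N)
    (w : Fin M → (l : Fin (L + 1)) → Fin (sz l)) (v : Fin M → Fin (L + 1) × ℝ × (Fin N → ℂ)) :
    (∑ w' : Fin M → (l : Fin (L + 1)) → Fin (sz l), if ∀ m, ∀ l ≤ (v m).1, w' m l = w m l then
        (∏ m, slotDensity q x (w' m) (v m)) /
          ∑ w'' : Fin M → (l : Fin (L + 1)) → Fin (sz l), ∏ m, slotDensity q x (w'' m) (v m) else 0)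
      = ∏ m, classPosterior q (v m).2.1 x (v m).2.2 (v m).1 (w m) := by
  classical
  have : ∀ l, Nonempty (Fin (sz l)) := fun l => ⟨⟨0, hsz l⟩⟩
  have hc : (Fintype.card ((l : Fin (L + 1)) → Fin (sz l)) : ℝ) ≠ 0 :=
    Nat.cast_ne_zero.2 Fintype.card_ne_zero
  have e1 : (∑ w' : Fin M → (l : Fin (L + 1)) → Fin (sz l), ∏ m, slotDensity q x (w' m) (v m))
      = ∏ m, ∑ w', slotDensity q x w' (v m) := by
    rw [Finset.prod_univ_sum, Fintype.piFinset_univ]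
  have e2 : (Finset.univ.filter fun w' : Fin M → (l : Fin (L + 1)) → Fin (sz l) =>
      ∀ m, ∀ l ≤ (v m).1, w' m l = w m l)
      = Fintype.piFinset fun m => agreeing (Finset.Iic (v m).1) (w m) := by
    ext w'
    simp [agreeing]
  have e3 : (∑ w' ∈ Fintype.piFinset fun m => agreeing (Finset.Iic (v m).1) (w m),
      ∏ m, slotDensity q x (w' m) (v m))
      = ∏ m, ∑ w' ∈ agreeing (Finset.Iic (v m).1) (w m), slotDensity q x w' (v m) := by
    rw [Finset.prod_univ_sum]
  rw [← Finset.sum_filter, ← Finset.sum_div, e1, e2, e3, ← Finset.prod_div_distrib]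
  refine Finset.prod_congr rfl fun m _ => ?_
  simp only [slotDensity, classPosterior, ← Finset.mul_sum]
  rw [mul_div_mul_left _ _ (inv_ne_zero hc)]

theorem bookCode_out₁ (hsz : ∀ l, 0 < sz l) (x : Book sz N) (ω : Fin M → BookSlot sz N)
    (m : Fin M) : (bookCode q hsz x).out₁ ω m
      = recv q (ω m).2.1 Finset.univ (pick x (ω m).1) (ω m).2.2.2.1 := by
  funext i
  exact congrArg (fun f : Fin N → ℂ => ((Real.sqrt (ω m).2.1 : ℝ) : ℂ) * f i + (ω m).2.2.2.1 i)
    (bookCode_signal q hsz x (ω m).1)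

theorem bookCode_out₂ (hsz : ∀ l, 0 < sz l) (x : Book sz N) (ω : Fin M → BookSlot sz N)
    (m : Fin M) : (bookCode q hsz x).out₂ ω m
      = recv q (ω m).2.2.1 Finset.univ (pick x (ω m).1) (ω m).2.2.2.2 := by
  funext i
  exact congrArg (fun f : Fin N → ℂ => ((Real.sqrt (ω m).2.2.1 : ℝ) : ℂ) * f i + (ω m).2.2.2.2 i)
    (bookCode_signal q hsz x (ω m).1)

/-- Conditional entropy sees an observation only through its σ-algebra, so Eve's view may be
regrouped slot by slot. -/
theorem condEntropy_congr_comap {Ω κ V V' : Type*} [MeasurableSpace Ω] [Fintype κ]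
    [MeasurableSpace V] [MeasurableSpace V'] (μ : Measure Ω) (K : Ω → κ) {X : Ω → V} {Y : Ω → V'}
    {f : V → V'} {g : V' → V} (hf : Measurable f) (hg : Measurable g) (hY : ∀ ω, Y ω = f (X ω))
    (hX : ∀ ω, X ω = g (Y ω)) : condEntropy μ K X = condEntropy μ K Y := by
  have h : MeasurableSpace.comap X inferInstance = MeasurableSpace.comap Y inferInstance := by
    refine le_antisymm ?_ ?_
    · rw [← measurable_iff_comap_le]
      have : X = g ∘ Y := funext hX
      rw [this]
      exact hg.comp (comap_measurable Y)
    · rw [← measurable_iff_comap_le]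
      have : Y = f ∘ X := funext hY
      rw [this]
      exact hf.comp (comap_measurable X)
  rw [condEntropy, condEntropy, h]

/-- A binning map whose bins Eve cannot guess, when the messages are hard to guess. -/
theorem exists_bin_equivocation (hsz : ∀ l, 0 < sz l) (x : Book sz N) {k : ℕ} (hk : 0 < k) {p : ℝ}
    (hp : 0 ≤ p) :
    ∃ bin : (ψ : Fin M → Fin (L + 1)) →
        ((m : Fin M) → (l : {l : Fin (L + 1) // l ≤ ψ m}) → Fin (sz l)) → Fin k,
      (Measure.pi fun _ : Fin M => bookSlotLaw sz N μ₁ μ₂).real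
        {ω | ∏ m, classPosterior q (ω m).2.2.1 x (recv q (ω m).2.2.1 Finset.univ
          (pick x (ω m).1) (ω m).2.2.2.2) (s.topLayer (ω m).2.1) (ω m).1 ≤ p}
          * (1 - Real.log (p + 1 / k)) - 1
      ≤ condEntropy ((bookCode q hsz x).law μ₁ μ₂ M)
        (fun ω => bin ((bookCode q hsz x).feedback ω s)
          fun m l => (bookCode q hsz x).msg ω m l)
        (fun ω => (bookCode q hsz x).eveView ω s) := by
  classical
  have := isProbabilityMeasure_bookSlotLaw (N := N) (μ₁ := μ₁) (μ₂ := μ₂) hsz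
  have hkf : Nonempty (Fin k) := ⟨⟨0, hk⟩⟩
  set W : (Fin M → BookSlot sz N) → Fin M → (l : Fin (L + 1)) → Fin (sz l) :=
    fun ω m => (ω m).1 with hWd
  set V : (Fin M → BookSlot sz N) → Fin M → Fin (L + 1) × ℝ × (Fin N → ℂ) :=
    fun ω m => slotView s q x (ω m) with hVd
  have hW : Measurable W := by simp only [hWd]; fun_prop
  have hV : Measurable V := measurable_pi_lambda _ fun m =>
    (measurable_slotView s q x).comp (measurable_pi_apply m)
  have hfm : ∀ w : Fin M → (l : Fin (L + 1)) → Fin (sz l), Measurable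
      fun v : Fin M → Fin (L + 1) × ℝ × (Fin N → ℂ) => ∏ m, slotDensity q x (w m) (v m) := fun w =>
    Finset.measurable_prod _ fun m _ => (measurable_slotDensity q x (w m)).comp (measurable_pi_apply m)
  have hpost := isPosterior_of_density (μ := Measure.pi fun _ : Fin M => bookSlotLaw sz N μ₁ μ₂)
    hW hV hfm (fun w v => Finset.prod_nonneg fun m _ => (slotDensity_pos q hsz x _ _).le)
    (map_pi_slotView s q hsz x)
  -- The family consists of all binning functions, chosen separately for every feedback sequence;
  -- the feedback is part of the observation.
  set b : ((ψ : Fin M → Fin (L + 1)) →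
        ((m : Fin M) → (l : {l : Fin (L + 1) // l ≤ ψ m}) → Fin (sz l)) → Fin k) →
      (Fin M → Fin (L + 1) × ℝ × (Fin N → ℂ)) → (Fin M → (l : Fin (L + 1)) → Fin (sz l)) → Fin k :=
    fun β v w => β (fun m => (v m).1) fun m l => w m l with hb
  have hψ : Measurable fun (v : Fin M → Fin (L + 1) × ℝ × (Fin N → ℂ)) m => (v m).1 := by fun_prop
  have hcp : ∀ (w : (l : Fin (L + 1)) → Fin (sz l)),
      Measurable fun v : Fin (L + 1) × ℝ × (Fin N → ℂ) =>
        classPosterior q v.2.1 x v.2.2 v.1 w := fun w =>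
    measurable_from_prod_countable_right fun ψ =>
      measurable_classPosterior q ψ w measurable_fst measurable_const measurable_snd
  obtain ⟨β, hβ⟩ := exists_bin_le_condEntropy hW hV hpost b
    (fun β w j => by
      have : Measurable fun ψ : Fin M → Fin (L + 1) => β ψ fun m l => w m l := .of_discrete
      exact (this.comp hψ) (measurableSet_singleton j))
    -- Messages agreeing on all decoded layers are never separated by a bin, so they form one class;
    -- any others are distinct arguments of the binning function.
    (fun v w w' => ∀ m, ∀ l ≤ (v m).1, w' m l = w m l) hk
    (fun v w w' hne => by
      refine card_collision_mul_le (fun m => (v m).1) fun heq => hne fun m l hl => ?_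
      exact (congrFun (congrFun heq m) ⟨l, hl⟩).symm)
    (G := fun w => {v | ∏ m, classPosterior q (v m).2.1 x (v m).2.2 (v m).1 (w m) ≤ p})
    (fun w => measurableSet_le (Finset.measurable_prod _ fun m _ =>
      (hcp (w m)).comp (measurable_pi_apply m)) measurable_const) hp
    (fun w v hv => (sum_posterior_eq_prod q hsz x w v).le.trans hv)
  refine ⟨β, hβ.trans (le_of_eq ?_)⟩
  refine condEntropy_congr_comap _ _
    (f := fun v => (fun m => (v m).2.2, fun m => (v m).2.1, fun m => (v m).1))
    (g := fun v m => (v.2.2 m, v.2.1 m, v.1 m)) (by fun_prop) (by fun_prop) (fun ω => ?_)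
    (fun ω => ?_)
  · exact Prod.ext (funext fun m => bookCode_out₂ q hsz x ω m) rfl
  · funext m
    exact Prod.ext rfl (Prod.ext rfl (bookCode_out₂ q hsz x ω m).symm)

end LayeredKey

end

noncomputable section

namespace LayeredKey

open scoped ENNReal NNReal Topology

/-! ### Concentration over the slots -/

/-- Subadditivity suffices, so the event need not be measurable. -/
theorem one_sub_le_measureReal {Ω : Type*} [MeasurableSpace Ω] {μ : Measure Ω}
    [IsProbabilityMeasure μ] {A : Set Ω} {e : ℝ} (he : 0 ≤ e) (h : μ Aᶜ ≤ ENNReal.ofReal e) :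
    1 - e ≤ μ.real A := by
  have h1 : (1 : ℝ≥0∞) ≤ μ A + μ Aᶜ := by
    rw [← measure_univ (μ := μ), ← Set.union_compl_self A]
    exact measure_union_le _ _
  have h2 : (1 : ℝ≥0∞) ≤ ENNReal.ofReal (μ.real A + e) := by
    rw [ENNReal.ofReal_add measureReal_nonneg he, ofReal_measureReal]
    exact h1.trans (add_le_add le_rfl h)
  rw [ENNReal.one_le_ofReal] at h2
  linarith

theorem pi_exists_le {α : Type*} [MeasurableSpace α] (μ : Measure α) [IsProbabilityMeasure μ]
    {M : ℕ} {B : Set α} {e : ℝ} (hB : μ B ≤ ENNReal.ofReal e) :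
    (Measure.pi fun _ : Fin M => μ) {ω | ∃ m, ω m ∈ B} ≤ ENNReal.ofReal (M * e) := by
  have hsub : {ω : Fin M → α | ∃ m, ω m ∈ B} ⊆ ⋃ m, (fun ω => ω m) ⁻¹' (toMeasurable μ B) := by
    rintro ω ⟨m, hm⟩
    exact Set.mem_iUnion.2 ⟨m, subset_toMeasurable μ B hm⟩
  have h1 : ∀ m : Fin M, (Measure.pi fun _ : Fin M => μ) ((fun ω => ω m) ⁻¹' (toMeasurable μ B))
      ≤ ENNReal.ofReal e := fun m => by
    rw [(measurePreserving_eval (fun _ : Fin M => μ) m).measure_preimage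
      (measurableSet_toMeasurable μ B).nullMeasurableSet, measure_toMeasurable]
    exact hB
  refine (measure_mono hsub).trans ((measure_iUnion_fintype_le _ _).trans
    ((Finset.sum_le_sum fun m _ => h1 m).trans (le_of_eq ?_)))
  rw [Finset.sum_const, Finset.card_univ, Fintype.card_fin, nsmul_eq_mul,
    ENNReal.ofReal_mul (by positivity), ENNReal.ofReal_natCast]

variable {L N M : ℕ} {sz : Fin (L + 1) → ℕ} (s : Levels L) {ρ : ℝ → ℝ} {P : ℝ}
  {μ₁ μ₂ : Measure ℝ} [IsProbabilityMeasure μ₁] [IsProbabilityMeasure μ₂]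

theorem measurePreserving_gains (hsz : ∀ l, 0 < sz l) :
    MeasurePreserving (fun ω : BookSlot sz N => (ω.2.1, ω.2.2.1)) (bookSlotLaw sz N μ₁ μ₂)
      (μ₁.prod μ₂) := by
  have := isProbabilityMeasure_uniformOn hsz
  have h1 : MeasurePreserving (Prod.snd : BookSlot sz N → _) (bookSlotLaw sz N μ₁ μ₂)
      (μ₁.prod (μ₂.prod ((gaussBlock N 1).prod (gaussBlock N 1)))) := measurePreserving_snd
  have h2 : MeasurePreserving (Prod.fst : ℝ × (Fin N → ℂ) × (Fin N → ℂ) → ℝ)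
      (μ₂.prod ((gaussBlock N 1).prod (gaussBlock N 1))) μ₂ := measurePreserving_fst
  exact ((MeasurePreserving.id μ₁).prod h2).comp h1

/-- The mean secrecy gain over many slots is rarely below its expectation. -/
theorem eventually_mean_secrecyGain (hρ : ∀ u, 0 ≤ u → 0 ≤ ρ u)
    (hμ₂ : ∀ᵐ h ∂μ₂, 0 ≤ h) {r t e : ℝ} (ht : 0 < t) (he : 0 < e)
    (hr : ENNReal.ofReal r
      ≤ ∫⁻ h₁, ∫⁻ h₂, ENNReal.ofReal (s.secrecyGain ρ (s.topLayer h₁) h₂) ∂μ₂ ∂μ₁) :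
    ∀ᶠ M : ℕ in atTop, (Measure.pi fun _ : Fin M => μ₁.prod μ₂)
      {p | ∑ m, s.secrecyGain ρ (s.topLayer (p m).1) (p m).2 < M * (r - t)}
        ≤ ENNReal.ofReal e := by
  set f : ℝ × ℝ → ℝ := fun p => s.secrecyGain ρ (s.topLayer p.1) p.2 with hf
  have hfm : Measurable f :=
    (s.measurable_secrecyGain ρ).comp (f := fun p : ℝ × ℝ => (s.topLayer p.1, p.2))
      ((s.measurable_topLayer.comp measurable_fst).prodMk measurable_snd)
  have hpos : ∀ᵐ p ∂(μ₁.prod μ₂), 0 ≤ p.2 := Measure.quasiMeasurePreserving_snd.ae hμ₂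
  have hf0 : ∀ᵐ p ∂(μ₁.prod μ₂), 0 ≤ f p := by
    filter_upwards [hpos] with p hp using s.secrecyGain_nonneg hρ _ hp
  have hfC : ∀ᵐ p ∂(μ₁.prod μ₂), ‖f p‖ ≤ ∑ l, s.rate ρ l := by
    filter_upwards [hpos, hf0] with p hp h0
    rw [Real.norm_of_nonneg h0]
    exact s.secrecyGain_le hρ _ hp
  have hLp : MemLp f 2 (μ₁.prod μ₂) := MemLp.of_bound hfm.aestronglyMeasurable _ hfC
  have hfint : Integrable f (μ₁.prod μ₂) := hLp.integrable one_le_two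
  -- The integrand is almost everywhere nonnegative, so no sign condition on `r` is needed to remove
  -- `ENNReal.ofReal`.
  have hmean : r ≤ ∫ p, f p ∂(μ₁.prod μ₂) := by
    have h1 := ofReal_integral_eq_lintegral_ofReal hfint hf0
    rw [lintegral_prod _ hfm.ennreal_ofReal.aemeasurable] at h1
    rw [← h1] at hr
    exact (ENNReal.ofReal_le_ofReal_iff (integral_nonneg_of_ae hf0)).1 hr
  have hcast : Tendsto (fun N : ℕ => (N : ℝ)) atTop atTop := tendsto_natCast_atTop_atTop
  have htend : Tendsto (fun M : ℕ => Var[f; μ₁.prod μ₂] / M / t ^ 2) atTop (𝓝 0) := by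
    have := (tendsto_const_nhds (x := Var[f; μ₁.prod μ₂])).div_atTop hcast
    simpa using this.div_const (t ^ 2)
  filter_upwards [htend.eventually_le_const he, eventually_gt_atTop 0] with M hM hM0
  refine (measure_mono fun p hp => ?_).trans ((pi_mean_deviation_le (μ₁.prod μ₂) hLp ht hM0).trans
    (ENNReal.ofReal_le_ofReal hM))
  have hM' : (0 : ℝ) < M := by exact_mod_cast hM0
  rw [Set.mem_ofPred_eq] at hp ⊢
  have h2 : (∑ m, f (p m)) / M < r - t := by
    rw [div_lt_iff₀' hM']
    exact hp
  rw [abs_sub_comm]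
  exact le_trans (by linarith) (le_abs_self _)

/-! ### The equivocation rate -/

theorem prod_classPosterior_le (q : Fin (L + 1) → ℝ≥0) (x : Book sz N) {κ r : ℝ}
    {ω : Fin M → BookSlot sz N}
    (h : ∀ m, ¬ EveLearns q s ρ κ (s.topLayer (ω m).2.1) (ω m).1 (ω m).2.2.1 (ω m).2.2.2.2 x)
    (hr : M * r ≤ ∑ m, s.secrecyGain ρ (s.topLayer (ω m).2.1) (ω m).2.2.1) :
    ∏ m, classPosterior q (ω m).2.2.1 x (recv q (ω m).2.2.1 Finset.univ
          (pick x (ω m).1) (ω m).2.2.2.2) (s.topLayer (ω m).2.1) (ω m).1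
      ≤ Real.exp (-(M * N * (r - κ))) := by
  refine (Finset.prod_le_prod (fun m _ => classPosterior_nonneg q _ x _ _ _)
    fun m _ => not_lt.1 (h m)).trans ?_
  rw [← Real.exp_sum, Real.exp_le_exp, Finset.sum_neg_distrib, ← Finset.mul_sum,
    Finset.sum_sub_distrib, Finset.sum_const, Finset.card_univ, Fintype.card_fin, nsmul_eq_mul,
    neg_le_neg_iff]
  calc M * N * (r - κ) = N * (M * r - M * κ) := by ring
    _ ≤ _ := mul_le_mul_of_nonneg_left (by linarith) (by positivity)

/-- Rounding down at most halves the number of bins, so the argument of the logarithm is at most `3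
exp (-(n (R - ε / 2)))`, and `3 ≤ exp 2`. The probability defect costs at most `n ε / 8`, and the
additive constants are absorbed by `8 ≤ n ε`. -/
theorem le_of_log_bound {n R ε e g : ℝ} {k : ℕ} (hn : 1 ≤ n) (hR : 0 ≤ R) (hε : 0 < ε)
    (hnε : 8 ≤ n * ε) (he : 0 ≤ e) (heε : e * (R + ε + 1) ≤ ε / 8) (hg : 1 - e ≤ g) (hg1 : g ≤ 1)
    (hk : k = ⌊Real.exp (n * R)⌋₊) :
    n * (R - ε) ≤ g * (1 - Real.log (Real.exp (-(n * (R - ε / 2))) + 1 / k)) - 1 := by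
  have hexp1 : 1 ≤ Real.exp (n * R) := Real.one_le_exp (by positivity)
  have hk1 : 1 ≤ k := by
    rw [hk, Nat.one_le_floor_iff]
    exact hexp1
  have hk1' : (1 : ℝ) ≤ k := by exact_mod_cast hk1
  have hk2 : Real.exp (n * R) ≤ 2 * k := by
    have := Nat.lt_floor_add_one (Real.exp (n * R))
    rw [← hk] at this
    linarith
  have hinv : 1 / (k : ℝ) ≤ 2 * Real.exp (-(n * (R - ε / 2))) := by
    rw [div_le_iff₀ (by linarith)]
    have h1 : Real.exp (-(n * R)) ≤ Real.exp (-(n * (R - ε / 2))) :=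
      Real.exp_le_exp.2 (by nlinarith)
    have h2 : Real.exp (-(n * R)) * Real.exp (n * R) = 1 := by
      rw [← Real.exp_add]; simp
    have h3 : Real.exp (-(n * R)) * Real.exp (n * R) ≤ Real.exp (-(n * R)) * (2 * k) :=
      mul_le_mul_of_nonneg_left hk2 (Real.exp_pos _).le
    nlinarith [mul_le_mul_of_nonneg_right h1 (show (0 : ℝ) ≤ 2 * k by linarith)]
  set X := 1 - Real.log (Real.exp (-(n * (R - ε / 2))) + 1 / k) with hX
  set Y := n * (R - ε / 2) - 1 with hY
  have hXY : Y ≤ X := by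
    have h1 : Real.log (Real.exp (-(n * (R - ε / 2))) + 1 / k) ≤ 2 - n * (R - ε / 2) := by
      rw [Real.log_le_iff_le_exp (by positivity), sub_eq_add_neg 2, Real.exp_add]
      have h3 : (3 : ℝ) ≤ Real.exp 2 := by linarith [Real.add_one_le_exp 2]
      nlinarith [Real.exp_pos (-(n * (R - ε / 2)))]
    linarith
  have habs : |Y| ≤ n * (R + ε + 1) := by
    rw [abs_le]
    constructor <;> nlinarith [mul_nonneg (show 0 ≤ n by linarith) hR]
  have heY : e * |Y| ≤ n * (ε / 8) := by
    calc e * |Y| ≤ e * (n * (R + ε + 1)) := mul_le_mul_of_nonneg_left habs he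
      _ = n * (e * (R + ε + 1)) := by ring
      _ ≤ _ := mul_le_mul_of_nonneg_left heε (by linarith)
  have he1 : e ≤ 1 := by
    by_contra hc
    nlinarith
  -- `R - ε / 2` may be negative, so multiplication by the probability `g` is treated by the signs
  -- of `X` and `Y`.
  have hgX : Y - e * |Y| ≤ g * X := by
    have h0 : 0 ≤ e * |Y| := by positivity
    rcases le_or_gt 0 X with hX0 | hX0
    · rcases le_or_gt 0 Y with hY0 | hY0
      · rw [abs_of_nonneg hY0]
        nlinarith [mul_le_mul_of_nonneg_right hg hX0,
          mul_le_mul_of_nonneg_left hXY (show 0 ≤ 1 - e by linarith)]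
      · nlinarith [mul_nonneg (show 0 ≤ g by linarith) hX0]
    · nlinarith
  nlinarith

end LayeredKey

end

/-! ### Assembly of the scheme -/

theorem theorem1 (ρ : ℝ → ℝ) (P : ℝ)
    (hρ_nonneg : ∀ s, 0 ≤ s → 0 ≤ ρ s)
    (hρ_int : MeasureTheory.IntegrableOn ρ (Set.Ioi 0))
    (hρ_power : LayeredKey.interference ρ 0 = P)
    (μ₁ μ₂ : MeasureTheory.Measure ℝ)
    [MeasureTheory.IsProbabilityMeasure μ₁] [MeasureTheory.IsProbabilityMeasure μ₂]
    (hμ₁ : ∀ᵐ h ∂μ₁, 0 ≤ h) (hμ₂ : ∀ᵐ h ∂μ₂, 0 ≤ h)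
    (R : ℝ) (hR_nonneg : 0 ≤ R)
    (hR : ENNReal.ofReal R ≤ LayeredKey.secrecyKeyRate ρ μ₁ μ₂) :
    LayeredKey.AchievesKeyRate ρ P μ₁ μ₂ R := by
  intro ε hε
  -- The posterior exponent may fall short of `R` by `ε / 2`: `ε / 8` for the discretisation, `ε /
  -- 8` for the average over slots, and `ε / 4` for the leak slack `κ`.
  obtain ⟨δ, hδ, A, hfine⟩ := LayeredKey.exists_fine_levels hρ_nonneg hρ_int μ₁ μ₂
    (ε := ε / 8) (by positivity) hR
  refine ⟨δ, hδ, A, fun L s hs η hη => ?_⟩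
  have hmean := hfine L s hs
  -- The bad event must be rare enough for Bob, and its probability times the key rate must be small
  -- compared with `ε`.
  set e := min ε (ε / 8 / (R + ε + 1)) with he
  have he0 : 0 < e := lt_min hε (by positivity)
  have heε : e * (R + ε + 1) ≤ ε / 8 := by
    calc _ ≤ ε / 8 / (R + ε + 1) * (R + ε + 1) := by gcongr; exact min_le_right _ _
      _ = _ := by field_simp
  filter_upwards [LayeredKey.eventually_mean_secrecyGain s hρ_nonneg hμ₂
    (t := ε / 8) (e := e / 2) (by positivity) (by positivity) hmean,
    eventually_gt_atTop 0] with M hM hM0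
  have hM1 : (1 : ℝ) ≤ M := by exact_mod_cast hM0
  have hcast : Tendsto (fun N : ℕ => (N : ℝ)) atTop atTop := tendsto_natCast_atTop_atTop
  -- The failure probability per slot is `e / (2 M)`, so the union over all slots costs `e / 2`;
  -- hence `N` is chosen after `M`.
  filter_upwards [LayeredKey.exists_slot_code s hρ_nonneg hρ_int hρ_power hμ₁ hμ₂ hη
    (κ := ε / 4) (ε := e / (2 * M)) (by positivity) (by positivity), eventually_gt_atTop 0,
    hcast.eventually_ge_atTop (8 / ε)] with N hcode hN0 hNε
  obtain ⟨sz, hsz, q, x, dec, hdec, hsucc, hfits, hbob, heve⟩ := hcode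
  have hN1 : (1 : ℝ) ≤ N := by exact_mod_cast hN0
  have hMN : (1 : ℝ) ≤ M * N := by nlinarith
  have hk : 0 < ⌊Real.exp (M * N * R)⌋₊ := by
    rw [Nat.floor_pos]
    exact Real.one_le_exp (by positivity)
  obtain ⟨bin, hbin⟩ := LayeredKey.exists_bin_equivocation (M := M) (μ₁ := μ₁) (μ₂ := μ₂) s q hsz x
    hk (Real.exp_pos (-(M * N * (R - ε / 2)))).le
  have hprob := LayeredKey.isProbabilityMeasure_bookSlotLaw (N := N) (μ₁ := μ₁) (μ₂ := μ₂) hsz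
  set Λ : Measure (Fin M → LayeredKey.BookSlot sz N) :=
    Measure.pi fun _ : Fin M => LayeredKey.bookSlotLaw sz N μ₁ μ₂ with hΛ
  have hMe : (M : ℝ) * (e / (2 * M)) = e / 2 := by field_simp
  set S : LayeredKey.Scheme L N M ⌊Real.exp (M * N * R)⌋₊ :=
    { code := LayeredKey.bookCode q hsz x
      dec := dec
      measurable_dec := hdec
      successive := hsucc
      bin := bin } with hS
  have hcorrect : 1 - ε ≤ (S.code.law μ₁ μ₂ M).real
      {ω | ∀ m, ∀ l ≤ S.code.feedback ω s m, S.estimate ω m l = S.code.msg ω m l} := by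
    have hb := LayeredKey.pi_exists_le (LayeredKey.bookSlotLaw sz N μ₁ μ₂) (M := M) hbob
    rw [hMe] at hb
    have hle : e / 2 ≤ ε := by linarith [min_le_left ε (ε / 8 / (R + ε + 1))]
    refine LayeredKey.one_sub_le_measureReal (μ := Λ) hε.le
      ((MeasureTheory.measure_mono fun ω hω => ?_).trans (hb.trans (ENNReal.ofReal_le_ofReal hle)))
    by_contra hno
    refine hω fun m l hl => ?_
    by_contra hne
    refine hno ⟨m, l, hl, fun h => hne ?_⟩
    rw [← LayeredKey.bookCode_out₁ q hsz x ω m] at h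
    exact h
  -- The keys agree whenever all decoded layers are correct, since the bin depends on nothing else
  -- but the feedback.
  refine ⟨S, hfits, hcorrect, hcorrect.trans ?_, ?_⟩
  · refine MeasureTheory.measureReal_mono (μ := Λ) fun ω hω => ?_
    refine congrArg (bin _) ?_
    funext m l
    exact (hω m l l.2).symm
  · rw [LayeredKey.Scheme.equivocationRate, le_div_iff₀ (by positivity), mul_comm]
    refine le_trans ?_ hbin
    refine LayeredKey.le_of_log_bound hMN hR_nonneg hε ?_ he0.le heε ?_
      MeasureTheory.measureReal_le_one rfl
    · rw [div_le_iff₀ hε] at hNε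
      nlinarith
    · have h1 := LayeredKey.pi_exists_le (LayeredKey.bookSlotLaw sz N μ₁ μ₂) (M := M) heve
      rw [hMe] at h1
      -- The concentration statement concerns pairs of gains and is pulled back to whole slots along
      -- the projection.
      have hmp := measurePreserving_pi (fun _ : Fin M => LayeredKey.bookSlotLaw sz N μ₁ μ₂)
        (fun _ : Fin M => μ₁.prod μ₂) fun _ => LayeredKey.measurePreserving_gains (N := N) hsz
      have h2 := (hmp.measure_preimage_le _).trans hM
      refine LayeredKey.one_sub_le_measureReal (μ := Λ) he0.le ?_
      have e2 : ENNReal.ofReal e = ENNReal.ofReal (e / 2) + ENNReal.ofReal (e / 2) := by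
        rw [← ENNReal.ofReal_add (by positivity) (by positivity), add_halves]
      rw [e2]
      refine le_trans (MeasureTheory.measure_mono fun ω hω => ?_)
        ((MeasureTheory.measure_union_le _ _).trans (add_le_add h1 h2))
      by_contra hc
      rw [Set.mem_union, not_or] at hc
      obtain ⟨c1, c2⟩ := hc
      refine hω ?_
      have c1' : ∀ m, ¬ LayeredKey.EveLearns q s ρ (ε / 4) (s.topLayer (ω m).2.1) (ω m).1
        (ω m).2.2.1 (ω m).2.2.2.2 x := fun m hm => c1 ⟨m, hm⟩
      have c2' : M * (R - ε / 8 - ε / 8)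
          ≤ ∑ m, s.secrecyGain ρ (s.topLayer (ω m).2.1) (ω m).2.2.1 := not_lt.1 fun h => c2 h
      have h3 := LayeredKey.prod_classPosterior_le s q x c1' c2'
      refine h3.trans (le_of_eq ?_)
      ring_nf
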